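/- Let $\varphi_0 = e^{123}-e^1(e^{45}+e^{67})-e^2(e^{46}+e^{75})-e^3(e^{47}+e^{56})$ and ${*}\varphi_0 = e^{4567}-e^{23}(e^{45}+e^{67})-e^{31}(e^{46}+e^{75})-e^{12}(e^{47}+e^{56})$ on $\mathbb{R}^7$. Let $M$ be a connected smooth $7$-manifold with a $3$-form $\varphi$ that is pointwise linearly equivalent to $\varphi_0$; a basis of $T_pM$ realising this equivalence is called adapted. Let $g$ be the Riemannian metric for which adapted bases are orthonormal, and let ${*}\varphi$ be the $4$-form that equals ${*}\varphi_0$ in adapted bases. Suppose that $(M,\varphi)$ is a toric $G_2$-manifold, that is: * the structure is torsion-free: $d\varphi = 0$ and $d{*}\varphi = 0$; * the torus $T^3$ acts on $M$ smoothly and effectively, preserving $\varphi$, with infinitesimal generators $U_1,U_2,U_3$; * the action is multi-Hamiltonian for $\varphi$ and ${*}\varphi$: there are smooth $T^3$-invariant maps $\nu=(\nu_1,\nu_2,\nu_3)\colon M\to\mathbb{R}^3$ and $\mu\colon M\to\mathbb{R}$ with $d\nu_i=\varphi(U_j,U_k,\cdot)$ for each cyclic permutation $(ijk)$ of $(123)$,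 and $d\mu = {*}\varphi(U_1,U_2,U_3,\cdot)$. Let $M_0\subset M$ be the open set of points at which $U_1,U_2,U_3$ are linearly independent, and on $M_0$ put $V = B^{-1}$, where $B_{ij}=g(U_i,U_j)$. Suppose that $V$ depends only on $\mu$, i.e. each point of $M_0$ has a neighbourhood on which $V$ is a function of $\mu$ (equivalently, $\partial V/\partial\nu_i = 0$ for $i=1,2,3$ in the local coordinates $(\nu,\mu)$ on $M_0/T^3$). If the metric $g$ is complete, then $g$ is flat (its Riemann curvature tensor vanishes), and $(M,g)$ is locally isometric to $\mathbb{R}^7$. -/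

import Mathlib

open Filter
open scoped Topology Manifold ContDiff

noncomputable section

namespace ToricG2

/-- The model space `ℝ⁷` with its Euclidean inner product. -/
abbrev E7 : Type := EuclideanSpace ℝ (Fin 7)

/-! ### Linear algebra of `G₂`-forms -/

/-- The monomial form `e^{i₁} ∧ ⋯ ∧ e^{i_k}` on `ℝ⁷` for a list of indices `idx = (i₁, …, i_k)`;
its value at `(u₁, …, u_k)` is the determinant of the matrix with entries `e^{i_s}(u_r)`. -/
def coform {k : ℕ} (idx : Fin k → Fin 7) : E7 [⋀^Fin k]→L[ℝ] ℝ where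
  toMultilinearMap :=
    (((Matrix.detRowAlternating (n := Fin k) (R := ℝ)).compLinearMap
      (LinearMap.pi fun s => (EuclideanSpace.proj (idx s) : E7 →L[ℝ] ℝ).toLinearMap)) :
      E7 [⋀^Fin k]→ₗ[ℝ] ℝ).toMultilinearMap
  cont := by
    change Continuous fun u : Fin k → E7 => Matrix.det (Matrix.of fun r s => u r (idx s))
    refine Continuous.matrix_det ?_
    fun_prop
  map_eq_zero_of_eq' := fun v i j h hij =>
    AlternatingMap.map_eq_zero_of_eq
      ((Matrix.detRowAlternating (n := Fin k) (R := ℝ)).compLinearMap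
        (LinearMap.pi fun s => (EuclideanSpace.proj (idx s) : E7 →L[ℝ] ℝ).toLinearMap)) v h hij

theorem coform_apply {k : ℕ} (idx : Fin k → Fin 7) (u : Fin k → E7) :
    coform idx u = Matrix.det (Matrix.of fun r s => u r (idx s)) := rfl

/-- The model 3-form
`φ₀ = e¹²³ - e¹(e⁴⁵ + e⁶⁷) - e²(e⁴⁶ + e⁷⁵) - e³(e⁴⁷ + e⁵⁶)`
(the indices in the code are shifted by one). -/
def phi0 : E7 [⋀^Fin 3]→L[ℝ] ℝ :=
  coform ![0, 1, 2]
    - (coform ![0, 3, 4] + coform ![0, 5, 6])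
    - (coform ![1, 3, 5] + coform ![1, 6, 4])
    - (coform ![2, 3, 6] + coform ![2, 4, 5])

/-- The Hodge dual 4-form
`*φ₀ = e⁴⁵⁶⁷ - e²³(e⁴⁵ + e⁶⁷) - e³¹(e⁴⁶ + e⁷⁵) - e¹²(e⁴⁷ + e⁵⁶)`
(the indices in the code are shifted by one). -/
def psi0 : E7 [⋀^Fin 4]→L[ℝ] ℝ :=
  coform ![3, 4, 5, 6]
    - (coform ![1, 2, 3, 4] + coform ![1, 2, 5, 6])
    - (coform ![2, 0, 3, 5] + coform ![2, 0, 6, 4])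
    - (coform ![0, 1, 3, 6] + coform ![0, 1, 4, 5])

section LinearAlgebra

variable {W : Type*} [AddCommGroup W] [Module ℝ W] [TopologicalSpace W]

/-- A linear isomorphism `ℝ⁷ ≃ W` (that is, a basis of `W`) is adapted to the 3-form `φ` on `W`
if it identifies `φ` with `φ₀`. -/
def IsAdapted (φ : W [⋀^Fin 3]→L[ℝ] ℝ) (L : E7 ≃L[ℝ] W) : Prop :=
  φ.compContinuousLinearMap (L : E7 →L[ℝ] W) = phi0

open Classical in
/-- The inner product determined by a `G₂`-form `φ`: the one which makes an adapted basis
orthonormal. (It does not depend on the adapted basis, as the stabiliser of `φ₀` lies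
in `SO(7)`. It is set to zero if there is no adapted basis.) -/
def innerOf (φ : W [⋀^Fin 3]→L[ℝ] ℝ) (u v : W) : ℝ :=
  if h : ∃ L : E7 ≃L[ℝ] W, IsAdapted φ L then inner ℝ (h.choose.symm u) (h.choose.symm v) else 0

open Classical in
/-- The dual 4-form `*φ` of a `G₂`-form `φ`: it is `*φ₀` in an adapted basis.
(It does not depend on the adapted basis.) -/
def dualOf (φ : W [⋀^Fin 3]→L[ℝ] ℝ) : W [⋀^Fin 4]→L[ℝ] ℝ :=
  if h : ∃ L : E7 ≃L[ℝ] W, IsAdapted φ L then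
    psi0.compContinuousLinearMap (h.choose.symm : W →L[ℝ] E7) else 0

end LinearAlgebra

/-! ### Differential forms, metrics, distance and curvature on a 7-manifold -/

section Manifold

variable {M : Type*} [TopologicalSpace M] [ChartedSpace E7 M]

/-- The coordinate expression in the chart at `x₀` of a field `η` of alternating `k`-forms. -/
def formInChart {k : ℕ} (η : ∀ p : M, TangentSpace (𝓡 7) p [⋀^Fin k]→L[ℝ] ℝ) (x₀ : M) (y : E7) :
    E7 [⋀^Fin k]→L[ℝ] ℝ :=
  (η ((extChartAt (𝓡 7) x₀).symm y)).compContinuousLinearMap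
    (mfderiv 𝓘(ℝ, E7) (𝓡 7) (extChartAt (𝓡 7) x₀).symm y)

/-- `η` is a smooth differential form and `dη = 0`. -/
def IsClosedForm {k : ℕ} (η : ∀ p : M, TangentSpace (𝓡 7) p [⋀^Fin k]→L[ℝ] ℝ) : Prop :=
  ∀ x₀ : M, ContDiffOn ℝ ∞ (formInChart η x₀) (extChartAt (𝓡 7) x₀).target ∧
    ∀ y ∈ (extChartAt (𝓡 7) x₀).target, extDeriv (formInChart η x₀) y = 0

/-- The field of inner products determined by the field of `G₂`-forms `φ`. -/
def metric (φ : ∀ p : M, TangentSpace (𝓡 7) p [⋀^Fin 3]→L[ℝ] ℝ) (p : M)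
    (u v : TangentSpace (𝓡 7) p) : ℝ :=
  innerOf (φ p) u v

/-- The 4-form `*φ`. -/
def dual (φ : ∀ p : M, TangentSpace (𝓡 7) p [⋀^Fin 3]→L[ℝ] ℝ) (p : M) :
    TangentSpace (𝓡 7) p [⋀^Fin 4]→L[ℝ] ℝ :=
  dualOf (φ p)

/-- A torsion-free `G₂`-structure: `φ` is pointwise linearly equivalent to `φ₀`,
and `φ` and `*φ` are closed (smooth) forms. -/
structure IsG2Manifold (φ : ∀ p : M, TangentSpace (𝓡 7) p [⋀^Fin 3]→L[ℝ] ℝ) : Prop where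
  adapted : ∀ p, ∃ L : E7 ≃L[ℝ] TangentSpace (𝓡 7) p, IsAdapted (φ p) L
  closed : IsClosedForm φ
  coclosed : IsClosedForm (dual φ)

/-- The Riemannian distance of the metric of `φ`: the infimum of the lengths
`∫ √(g(γ', γ'))` of `C¹` paths. -/
def riemDist (φ : ∀ p : M, TangentSpace (𝓡 7) p [⋀^Fin 3]→L[ℝ] ℝ) (x y : M) : ENNReal :=
  letI : ∀ p : M, ENorm (TangentSpace (𝓡 7) p) :=
    fun p => ⟨fun v => ENNReal.ofReal (Real.sqrt (metric φ p v v))⟩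
  Manifold.riemannianEDist (𝓡 7) x y

/-- Completeness of the Riemannian metric of `φ`: every Cauchy sequence for the Riemannian
distance converges. -/
def IsCompleteMetric (φ : ∀ p : M, TangentSpace (𝓡 7) p [⋀^Fin 3]→L[ℝ] ℝ) : Prop :=
  ∀ u : ℕ → M,
    (∀ ε : ENNReal, 0 < ε → ∃ N, ∀ m ≥ N, ∀ n ≥ N, riemDist φ (u m) (u n) < ε) →
      ∃ x, Tendsto u atTop (𝓝 x)

/-- The partial derivative `∂_k f` on `ℝ⁷`. -/
def pderiv (k : Fin 7) (f : E7 → ℝ) (y : E7) : ℝ :=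
  fderiv ℝ f y (EuclideanSpace.single k 1)

/-- The Christoffel symbol `Γ^l_{ij} = ½ g^{lm} (∂_i g_{jm} + ∂_j g_{im} - ∂_m g_{ij})` of the
matrix-valued function `G = (g_{ij})`. -/
def christoffel (G : E7 → Matrix (Fin 7) (Fin 7) ℝ) (l i j : Fin 7) (y : E7) : ℝ :=
  ∑ m, (G y)⁻¹ l m *
    (pderiv i (fun z => G z j m) y + pderiv j (fun z => G z i m) y
      - pderiv m (fun z => G z i j) y) / 2

/-- The coefficient `R^l_{kij}` of the Riemann curvature tensor,
`R(∂_i, ∂_j) ∂_k = R^l_{kij} ∂_l`, of the metric with coefficients `G = (g_{ij})`. -/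
def curvature (G : E7 → Matrix (Fin 7) (Fin 7) ℝ) (l k i j : Fin 7) (y : E7) : ℝ :=
  pderiv i (christoffel G l j k) y - pderiv j (christoffel G l i k) y
    + ∑ m, (christoffel G l i m y * christoffel G m j k y
      - christoffel G l j m y * christoffel G m i k y)

/-- The coefficients `g_{ij}` of the metric of `φ` in the chart at `x₀`. -/
def metricInChart (φ : ∀ p : M, TangentSpace (𝓡 7) p [⋀^Fin 3]→L[ℝ] ℝ) (x₀ : M) (y : E7) :
    Matrix (Fin 7) (Fin 7) ℝ :=
  Matrix.of fun i j => metric φ ((extChartAt (𝓡 7) x₀).symm y)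
    (mfderiv 𝓘(ℝ, E7) (𝓡 7) (extChartAt (𝓡 7) x₀).symm y (EuclideanSpace.single i 1))
    (mfderiv 𝓘(ℝ, E7) (𝓡 7) (extChartAt (𝓡 7) x₀).symm y (EuclideanSpace.single j 1))

/-- The Riemann curvature tensor of the metric of `φ` vanishes. -/
def IsFlat (φ : ∀ p : M, TangentSpace (𝓡 7) p [⋀^Fin 3]→L[ℝ] ℝ) : Prop :=
  ∀ x₀ : M, ∀ y ∈ (extChartAt (𝓡 7) x₀).target, ∀ l k i j : Fin 7,
    curvature (metricInChart φ x₀) l k i j y = 0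

/-- The metric of `φ` is locally isometric to Euclidean `ℝ⁷`: around each point there is a smooth
chart which is an isometry onto an open subset of `ℝ⁷`. -/
def IsLocallyIsometricToE7 (φ : ∀ p : M, TangentSpace (𝓡 7) p [⋀^Fin 3]→L[ℝ] ℝ) : Prop :=
  ∀ p : M, ∃ f ∈ IsManifold.maximalAtlas (𝓡 7) ∞ M, p ∈ f.source ∧
    ∀ q ∈ f.source, ∀ u v : TangentSpace (𝓡 7) q,
      @inner ℝ E7 _ (mfderiv (𝓡 7) 𝓘(ℝ, E7) f q u) (mfderiv (𝓡 7) 𝓘(ℝ, E7) f q v)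
        = metric φ q u v

/-! ### Torus actions -/

/-- The torus `T³ = S¹ × S¹ × S¹`. -/
abbrev T3 : Type := Fin 3 → Circle

variable [MulAction T3 M]

/-- The fundamental vector field `U_i` of the `i`-th circle factor of `T³`. -/
def gen (i : Fin 3) (p : M) : TangentSpace (𝓡 7) p :=
  mfderiv 𝓘(ℝ, ℝ) (𝓡 7) (fun t : ℝ => (Pi.mulSingle i (Circle.exp t) : T3) • p) 0 (1 : ℝ)

/-- A toric `G₂`-manifold with multi-moment maps `(ν, μ)`: a torsion-free `G₂`-structure with an
effective smooth action of `T³` that preserves `φ`, where `ν` is a multi-moment map for `φ`,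
`dν_i = φ(U_j, U_k, ·)` for `(ijk)` a cyclic permutation of `(123)`, and `μ` is a multi-moment
map for `*φ`, `dμ = *φ(U₁, U₂, U₃, ·)`. -/
structure IsToricG2Manifold (φ : ∀ p : M, TangentSpace (𝓡 7) p [⋀^Fin 3]→L[ℝ] ℝ)
    (ν : M → Fin 3 → ℝ) (μ : M → ℝ) : Prop extends IsG2Manifold φ where
  /-- The action is smooth; the map `(s₁, s₂, s₃) ↦ (e^{i s₁}, e^{i s₂}, e^{i s₃})` is the
  universal covering of `T³`. -/
  smooth_action : ContMDiff ((𝓘(ℝ, Fin 3 → ℝ)).prod (𝓡 7)) (𝓡 7) ∞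
    (fun x : (Fin 3 → ℝ) × M => (fun j => Circle.exp (x.1 j) : T3) • x.2)
  effective : ∀ t : T3, (∀ p : M, t • p = p) → t = 1
  invariant : ∀ (t : T3) (p : M),
    (φ (t • p)).compContinuousLinearMap (mfderiv (𝓡 7) (𝓡 7) (fun q : M => t • q) p) = φ p
  smooth_nu : ∀ i, ContMDiff (𝓡 7) 𝓘(ℝ, ℝ) ∞ (fun p => ν p i)
  invariant_nu : ∀ (t : T3) (p : M), ν (t • p) = ν p
  deriv_nu : ∀ (i : Fin 3) (p : M) (v : TangentSpace (𝓡 7) p),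
    (mfderiv (𝓡 7) 𝓘(ℝ, ℝ) (fun q => ν q i) p v : ℝ) = φ p ![gen (i + 1) p, gen (i + 2) p, v]
  smooth_mu : ContMDiff (𝓡 7) 𝓘(ℝ, ℝ) ∞ μ
  invariant_mu : ∀ (t : T3) (p : M), μ (t • p) = μ p
  deriv_mu : ∀ (p : M) (v : TangentSpace (𝓡 7) p),
    (mfderiv (𝓡 7) 𝓘(ℝ, ℝ) μ p v : ℝ) = dual φ p ![gen 0 p, gen 1 p, gen 2 p, v]

variable (M) in
/-- The set `M₀` of points at which the infinitesimal action is injective. -/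
def regularSet : Set M := {p | LinearIndependent ℝ (fun i : Fin 3 => gen i p)}

/-- The matrix `B` of inner products of the generators. -/
def matB (φ : ∀ p : M, TangentSpace (𝓡 7) p [⋀^Fin 3]→L[ℝ] ℝ) (p : M) :
    Matrix (Fin 3) (Fin 3) ℝ :=
  Matrix.of fun i j => metric φ p (gen i p) (gen j p)

/-- The matrix `V = B⁻¹` (meaningful on `M₀`). -/
def matV (φ : ∀ p : M, TangentSpace (𝓡 7) p [⋀^Fin 3]→L[ℝ] ℝ) (p : M) :
    Matrix (Fin 3) (Fin 3) ℝ :=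
  (matB φ p)⁻¹

/-- `V` depends only on `μ`: in a neighbourhood of each point of `M₀`, the matrix `V` is a function
of `μ`; equivalently, `∂V/∂ν_i = 0` in the local coordinates `(ν, μ)` of `M₀/T³`. -/
def DependsOnlyOnMu (φ : ∀ p : M, TangentSpace (𝓡 7) p [⋀^Fin 3]→L[ℝ] ℝ) (μ : M → ℝ) : Prop :=
  ∀ p ∈ regularSet M, ∃ F : ℝ → Matrix (Fin 3) (Fin 3) ℝ, ∀ᶠ q in 𝓝 p, matV φ q = F (μ q)

end Manifold

end ToricG2

end

open Filter
open scoped Topology Manifold ContDiff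

noncomputable section

namespace ToricG2

/-! Near a regular point the torus parameters and the multi-moment maps give coordinates `(s, ν,
μ)`. Write `θ_i` for the connection forms dual to the generators (`conn`). Linear algebra of an
isotropic triple in `ℝ⁷` expresses everything through `V = B⁻¹`: the metric is `∑ B θθ + ∑ (adj V)
dν dν + (det V) dμ²` (`metric_eq`), and the contractions of `φ` and `*φ` with generators have
similar formulas (`phi_gen`, `dual_gen`).

Closedness of `*φ` says that the `ν`-components of `dθ_i` are the entries of `∂V/∂μ`. Closedness of
`φ` says that the mixed `ν`-`μ` components vanish, because `adj V` does not depend on `ν`. Hence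
`d(dθ_i) = 0` becomes `∂²V/∂μ² = 0`, and locally `V = A + μ C` (`exists_local_affine`).

Completeness excludes a nonconstant `V`. If `xᵀ C x ≠ 0`, move along the gradient of `μ` in the
direction in which `xᵀ V x` decreases. Positivity of `V` forbids `μ` to pass the value at which `xᵀ
(A + μ C) x` vanishes. On the other hand `|dμ|² = det B = 1 / det V`, so the length of the way is
controlled by the polynomial `det (A + μ C)` on a bounded interval. The way therefore converges, and
its limit is again regular with the same `A`, `C`, because `det B · det (A + μ C) = 1` passes to
limits. From there one can move on, a contradiction (`not_bounded_of_exists_step`,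
`eventually_matV_eq`).

With `V` locally constant the `θ_i` are closed. Their potentials together with `ν` and `μ` become,
after a linear change, Euclidean coordinates (`exists_isometric_chart`).

It remains to see that every point is regular. The regular set is nonempty: otherwise every
stabiliser would contain a nontrivial torsion element, by Baire one such element would fix an open
set, hence all of `M`, against effectiveness (`nonempty_regularSet`). Since `det B` is locally
constant on the regular set, a nonzero level set of `det B` is open and closed, so it is all of the
connected `M` (`mem_regularSet_of_complete`).

The metric is defined by choosing an adapted basis. The determinant identity `det_phi0_add_sq`
recovers it from `φ`, which shows that the choice is immaterial and that the metric varies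
continuously. -/

/-! ### Cross products and the identities between `φ₀`, `*φ₀` and the inner product. -/

theorem phi0_apply (u v w : E7) : phi0 ![u, v, w] =
    u 0 * (v 1 * w 2 - v 2 * w 1) - u 1 * (v 0 * w 2 - v 2 * w 0) + u 2 * (v 0 * w 1 - v 1 * w 0)
    - (u 0 * (v 3 * w 4 - v 4 * w 3) - u 3 * (v 0 * w 4 - v 4 * w 0) + u 4 * (v 0 * w 3 - v 3 * w 0)
      + u 0 * (v 5 * w 6 - v 6 * w 5) - u 5 * (v 0 * w 6 - v 6 * w 0)
      + u 6 * (v 0 * w 5 - v 5 * w 0))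
    - (u 1 * (v 3 * w 5 - v 5 * w 3) - u 3 * (v 1 * w 5 - v 5 * w 1) + u 5 * (v 1 * w 3 - v 3 * w 1)
      + u 1 * (v 6 * w 4 - v 4 * w 6) - u 6 * (v 1 * w 4 - v 4 * w 1)
      + u 4 * (v 1 * w 6 - v 6 * w 1))
    - (u 2 * (v 3 * w 6 - v 6 * w 3) - u 3 * (v 2 * w 6 - v 6 * w 2) + u 6 * (v 2 * w 3 - v 3 * w 2)
      + u 2 * (v 4 * w 5 - v 5 * w 4) - u 4 * (v 2 * w 5 - v 5 * w 2)
      + u 5 * (v 2 * w 4 - v 4 * w 2)) := by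
  simp [phi0, coform_apply, Matrix.det_fin_three]
  ring

/-- The cross product of `ℝ⁷` determined by `φ₀`. -/
def cross (u v : E7) : E7 := WithLp.toLp 2 fun k => phi0 ![u, v, EuclideanSpace.single k 1]

theorem inner_cross (u v w : E7) : inner ℝ (cross u v) w = phi0 ![u, v, w] := by
  simp [cross, phi0_apply, PiLp.inner_apply, Fin.sum_univ_succ]
  ring

-- The identity linking the two model forms, verified in coordinates. Solved for `psi0` it expresses
-- the 4-form by `phi0` and the inner product, so whatever preserves these two also preserves
-- `psi0`.
set_option maxHeartbeats 2000000 in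
theorem phi0_cross (u v w z : E7) : phi0 ![u, cross v w, z] =
    inner ℝ u w * inner ℝ v z - inner ℝ u v * inner ℝ w z - psi0 ![u, v, w, z] := by
  simp [cross, phi0_apply, PiLp.inner_apply, psi0, coform_apply, Matrix.det_succ_row_zero,
    Fin.sum_univ_succ, Fin.succAbove]
  ring

theorem psi0_apply (u v w z : E7) : psi0 ![u, v, w, z] =
    inner ℝ u w * inner ℝ v z - inner ℝ u v * inner ℝ w z - phi0 ![u, cross v w, z] := by
  linarith [phi0_cross u v w z]

section Multilinear

variable {W : Type*} [AddCommGroup W] [Module ℝ W] [TopologicalSpace W]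

theorem alt3_swap (η : W [⋀^Fin 3]→L[ℝ] ℝ) (u v w : W) : η ![u, w, v] = -η ![u, v, w] := by
  have h := η.toAlternatingMap.map_swap ![u, v, w] (i := 1) (j := 2) (by decide)
  have e : (![u, v, w] ∘ (Equiv.swap (1 : Fin 3) 2)) = ![u, w, v] := by
    ext i; fin_cases i <;> rfl
  rw [e] at h; exact h

theorem alt3_swap' (η : W [⋀^Fin 3]→L[ℝ] ℝ) (u v w : W) : η ![v, u, w] = -η ![u, v, w] := by
  have h := η.toAlternatingMap.map_swap ![u, v, w] (i := 0) (j := 1) (by decide)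
  have e : (![u, v, w] ∘ (Equiv.swap (0 : Fin 3) 1)) = ![v, u, w] := by
    ext i; fin_cases i <;> rfl
  rw [e] at h; exact h

theorem alt3_self (η : W [⋀^Fin 3]→L[ℝ] ℝ) (u v : W) : η ![u, v, v] = 0 := by
  linarith [alt3_swap η u v v]

theorem alt3_self' (η : W [⋀^Fin 3]→L[ℝ] ℝ) (u v : W) : η ![u, u, v] = 0 := by
  linarith [alt3_swap' η u u v]

theorem alt3_add (η : W [⋀^Fin 3]→L[ℝ] ℝ) (u v w w' : W) :
    η ![u, v, w + w'] = η ![u, v, w] + η ![u, v, w'] := by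
  have h := η.toMultilinearMap.map_update_add ![u, v, 0] 2 w w'
  have e : ∀ x, Function.update ![u, v, 0] 2 x = ![u, v, x] := by
    intro x; ext i; fin_cases i <;> rfl
  simp only [e] at h; exact h

theorem alt3_smul (η : W [⋀^Fin 3]→L[ℝ] ℝ) (u v w : W) (r : ℝ) :
    η ![u, v, r • w] = r * η ![u, v, w] := by
  have h := η.toMultilinearMap.map_update_smul ![u, v, 0] 2 r w
  have e : ∀ x, Function.update ![u, v, 0] 2 x = ![u, v, x] := by
    intro x; ext i; fin_cases i <;> rfl
  simp only [e] at h; exact h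

theorem alt3_add_mid (η : W [⋀^Fin 3]→L[ℝ] ℝ) (u v v' w : W) :
    η ![u, v + v', w] = η ![u, v, w] + η ![u, v', w] := by
  linarith [alt3_swap η u (v + v') w, alt3_swap η u v w, alt3_swap η u v' w, alt3_add η u w v v']

theorem alt3_smul_mid (η : W [⋀^Fin 3]→L[ℝ] ℝ) (u v w : W) (r : ℝ) :
    η ![u, r • v, w] = r * η ![u, v, w] := by
  rw [← neg_inj, ← alt3_swap, alt3_smul, alt3_swap η u v w]; ring

theorem alt3_sub_mid (η : W [⋀^Fin 3]→L[ℝ] ℝ) (u v v' w : W) :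
    η ![u, v - v', w] = η ![u, v, w] - η ![u, v', w] := by
  rw [sub_eq_add_neg, ← neg_one_smul ℝ v', alt3_add_mid, alt3_smul_mid]; ring

theorem alt4_swap (η : W [⋀^Fin 4]→L[ℝ] ℝ) (u v w z : W) :
    η ![u, v, z, w] = -η ![u, v, w, z] := by
  have h := η.toAlternatingMap.map_swap ![u, v, w, z] (i := 2) (j := 3) (by decide)
  have e : (![u, v, w, z] ∘ (Equiv.swap (2 : Fin 4) 3)) = ![u, v, z, w] := by
    ext i; fin_cases i <;> rfl
  rw [e] at h; exact h

theorem alt4_swap_mid (η : W [⋀^Fin 4]→L[ℝ] ℝ) (u v w z : W) :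
    η ![u, w, v, z] = -η ![u, v, w, z] := by
  have h := η.toAlternatingMap.map_swap ![u, v, w, z] (i := 1) (j := 2) (by decide)
  have e : (![u, v, w, z] ∘ (Equiv.swap (1 : Fin 4) 2)) = ![u, w, v, z] := by
    ext i; fin_cases i <;> rfl
  rw [e] at h; exact h

theorem alt4_swap_left (η : W [⋀^Fin 4]→L[ℝ] ℝ) (u v w z : W) :
    η ![v, u, w, z] = -η ![u, v, w, z] := by
  have h := η.toAlternatingMap.map_swap ![u, v, w, z] (i := 0) (j := 1) (by decide)
  have e : (![u, v, w, z] ∘ (Equiv.swap (0 : Fin 4) 1)) = ![v, u, w, z] := by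
    ext i; fin_cases i <;> rfl
  rw [e] at h; exact h

theorem alt4_rotate (η : W [⋀^Fin 4]→L[ℝ] ℝ) (u v w z : W) :
    η ![v, w, u, z] = η ![u, v, w, z] := by
  linarith [alt4_swap_left η u v w z, alt4_swap_mid η v u w z]

theorem alt4_add (η : W [⋀^Fin 4]→L[ℝ] ℝ) (u v w z z' : W) :
    η ![u, v, w, z + z'] = η ![u, v, w, z] + η ![u, v, w, z'] := by
  have h := η.toMultilinearMap.map_update_add ![u, v, w, 0] 3 z z'
  have e : ∀ x, Function.update ![u, v, w, 0] 3 x = ![u, v, w, x] := by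
    intro x; ext i; fin_cases i <;> rfl
  simp only [e] at h; exact h

theorem alt4_smul (η : W [⋀^Fin 4]→L[ℝ] ℝ) (u v w z : W) (r : ℝ) :
    η ![u, v, w, r • z] = r * η ![u, v, w, z] := by
  have h := η.toMultilinearMap.map_update_smul ![u, v, w, 0] 3 r z
  have e : ∀ x, Function.update ![u, v, w, 0] 3 x = ![u, v, w, x] := by
    intro x; ext i; fin_cases i <;> rfl
  simp only [e] at h; exact h

end Multilinear

/-- The triple cross product of `ℝ⁷` determined by `*φ₀`. -/
def chi (u v w : E7) : E7 := WithLp.toLp 2 fun k => psi0 ![u, v, w, EuclideanSpace.single k 1]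

theorem inner_chi (u v w z : E7) : inner ℝ (chi u v w) z = psi0 ![u, v, w, z] := by
  have h : z = ∑ k, z k • EuclideanSpace.single k (1 : ℝ) := by
    ext j; simp [Pi.single_apply]
  conv_rhs => rw [h]
  simp only [Fin.sum_univ_succ, Finset.univ_eq_empty, Finset.sum_empty, add_zero, alt4_add,
    alt4_smul, chi, PiLp.inner_apply]
  simp

/-- Lagrange's identity with `psi0` as the defect. The left side is `phi0` with a cross product in
its last slot, so `phi0_cross` applies after permuting arguments. -/
theorem inner_cross_cross (u v w z : E7) : inner ℝ (cross u v) (cross w z) =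
    inner ℝ u w * inner ℝ v z - inner ℝ u z * inner ℝ v w + psi0 ![u, v, w, z] := by
  have h := phi0_cross v w z u
  rw [inner_cross]
  have e3 := alt4_swap psi0 v w u z
  have e4 := alt4_swap_mid psi0 v u w z
  have e5 := alt4_swap_left psi0 u v w z
  have e6 := alt3_swap phi0 v u (cross w z)
  have e7 := alt3_swap' phi0 u v (cross w z)
  simp only [real_inner_comm u] at *
  linarith

/-- Three vectors of `ℝ⁷` with `φ₀(a, b, c) = 0` and nonzero Gram determinant. -/
structure IsIsotropicTriple (a b c : E7) : Prop where
  phi_eq_zero : phi0 ![a, b, c] = 0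

/-- The Gram determinant of three vectors. -/
def gram3 (a b c : E7) : ℝ :=
  inner ℝ a a * (inner ℝ b b * inner ℝ c c - inner ℝ b c * inner ℝ b c)
    - inner ℝ a b * (inner ℝ a b * inner ℝ c c - inner ℝ b c * inner ℝ a c)
    + inner ℝ a c * (inner ℝ a b * inner ℝ b c - inner ℝ b b * inner ℝ a c)

/-! ### The frame of `ℝ⁷` generated by an isotropic triple. -/

namespace IsIsotropicTriple

variable {a b c : E7}

theorem rotate (h : IsIsotropicTriple a b c) : IsIsotropicTriple b c a := by
  constructor
  have := h.phi_eq_zero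
  linarith [alt3_swap phi0 b a c, alt3_swap' phi0 a b c]

theorem gram3_rotate : gram3 b c a = gram3 a b c := by
  simp only [gram3, real_inner_comm a]; ring

theorem chi_rotate : chi b c a = chi a b c := by
  refine ext_inner_right ℝ fun z => ?_
  rw [inner_chi, inner_chi]; exact alt4_rotate psi0 a b c z

/-- This is what isotropy gives: the triple is orthogonal to its cross products. -/
theorem inner_left_cross (h : IsIsotropicTriple a b c) : inner ℝ a (cross b c) = 0 := by
  rw [real_inner_comm, inner_cross]; exact h.rotate.phi_eq_zero

theorem inner_fst_cross (u v : E7) : inner ℝ u (cross u v) = 0 := by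
  rw [real_inner_comm, inner_cross, alt3_swap, alt3_self', neg_zero]

theorem inner_snd_cross (u v : E7) : inner ℝ v (cross u v) = 0 := by
  rw [real_inner_comm, inner_cross, alt3_self]

theorem inner_fst_chi : inner ℝ a (chi a b c) = 0 := by
  rw [real_inner_comm, inner_chi]
  linarith [alt4_swap_mid psi0 a b c a, alt4_swap_left psi0 a b c a, alt4_swap psi0 b c a a,
    alt4_rotate psi0 a b c a]

theorem inner_cross_chi : inner ℝ (cross b c) (chi a b c) = 0 := by
  rw [real_inner_comm, inner_chi, psi0_apply, inner_fst_cross, inner_snd_cross, alt3_self]; ring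

theorem phi_cross (a b c z : E7) : phi0 ![a, cross b c, z] =
    inner ℝ a c * inner ℝ b z - inner ℝ a b * inner ℝ c z - inner ℝ (chi a b c) z := by
  rw [inner_chi, phi0_cross]

theorem cross_cross (a b c : E7) : cross a (cross b c) =
    inner ℝ a c • b - inner ℝ a b • c - chi a b c := by
  refine ext_inner_right ℝ fun z => ?_
  rw [inner_cross, phi_cross]
  simp only [inner_sub_left, inner_smul_left]; rfl

/-- Compute `|a × (b × c)|²` twice: it is `|a|² |b × c|²` because `a` is orthogonal to `b × c`, and
it can be expanded by `cross_cross`, where `chi a b c` is orthogonal to `b` and `c`. In geometric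
terms this becomes `|dμ|² = det B`. -/
theorem inner_chi_chi (h : IsIsotropicTriple a b c) :
    inner ℝ (chi a b c) (chi a b c) = gram3 a b c := by
  have h1 := inner_cross_cross a (cross b c) a (cross b c)
  have h2 := inner_cross_cross b c b c
  have h3 : psi0 ![b, c, b, c] = 0 := by
    linarith [alt4_swap_mid psi0 b b c c, alt4_swap psi0 b b c c]
  have h4 : psi0 ![a, cross b c, a, cross b c] = 0 := by
    linarith [alt4_swap_mid psi0 a a (cross b c) (cross b c),
      alt4_swap psi0 a a (cross b c) (cross b c)]
  rw [cross_cross, h4, real_inner_comm a (cross b c), h.inner_left_cross, h2, h3] at h1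
  have ha : inner ℝ b (chi a b c) = 0 := by rw [← chi_rotate]; exact inner_fst_chi
  have hb : inner ℝ c (chi a b c) = 0 := by rw [← chi_rotate, ← chi_rotate]; exact inner_fst_chi
  have ha' := real_inner_comm b (chi a b c)
  have hb' := real_inner_comm c (chi a b c)
  simp only [inner_sub_left, inner_sub_right, inner_smul_left, inner_smul_right, ha, hb, ha', hb',
    RCLike.conj_to_real, real_inner_comm b c] at h1
  rw [gram3]
  linarith

theorem inner_cross_self (a b : E7) : inner ℝ (cross a b) (cross a b) =
    inner ℝ a a * inner ℝ b b - inner ℝ a b * inner ℝ a b := by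
  have h3 : psi0 ![a, b, a, b] = 0 := by
    linarith [alt4_swap_mid psi0 a a b b, alt4_swap psi0 a a b b]
  rw [inner_cross_cross, h3, real_inner_comm a b]; ring

theorem inner_cross_cross_rotate (a b c : E7) : inner ℝ (cross a b) (cross b c) =
    inner ℝ a b * inner ℝ b c - inner ℝ a c * inner ℝ b b := by
  have h3 : psi0 ![a, b, b, c] = 0 := by linarith [alt4_swap_mid psi0 a b b c]
  rw [inner_cross_cross, h3]; ring

end IsIsotropicTriple

namespace IsIsotropicTriple

variable {a b c : E7}

/-- The triple, its cross products and `chi a b c` span mutually orthogonal subspaces. The Gram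
matrix of the cross products is the adjugate of that of the triple. Rotating the triple yields the
remaining entries in `inner_tables`. -/
theorem inner_table (h : IsIsotropicTriple a b c) (x₁ x₂ x₃ y₁ y₂ y₃ z : ℝ) {u : E7}
    (hu : u = x₁ • a + x₂ • b + x₃ • c + (y₁ • cross b c + y₂ • cross c a + y₃ • cross a b)
      + z • chi a b c) :
    inner ℝ a u = inner ℝ a a * x₁ + inner ℝ a b * x₂ + inner ℝ a c * x₃ ∧
    inner ℝ (cross b c) u = (inner ℝ b b * inner ℝ c c - inner ℝ b c * inner ℝ b c) * y₁
      + (inner ℝ b c * inner ℝ a c - inner ℝ a b * inner ℝ c c) * y₂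
      + (inner ℝ a b * inner ℝ b c - inner ℝ a c * inner ℝ b b) * y₃ ∧
    inner ℝ (chi a b c) u = gram3 a b c * z := by
  have hb : inner ℝ b (chi a b c) = 0 := by rw [← chi_rotate]; exact inner_fst_chi
  have hc : inner ℝ c (chi a b c) = 0 := by rw [← chi_rotate, ← chi_rotate]; exact inner_fst_chi
  have hB : inner ℝ (cross c a) (chi a b c) = 0 := by rw [← chi_rotate]; exact inner_cross_chi
  have hC : inner ℝ (cross a b) (chi a b c) = 0 := by
    rw [← chi_rotate, ← chi_rotate]; exact inner_cross_chi
  have hmA := real_inner_comm (cross b c) (chi a b c)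
  have hmB := real_inner_comm (cross c a) (chi a b c)
  have hmC := real_inner_comm (cross a b) (chi a b c)
  rw [inner_cross_chi] at hmA
  rw [hB] at hmB
  rw [hC] at hmC
  subst hu
  refine ⟨?_, ?_, ?_⟩
  · simp only [inner_add_right, inner_smul_right, h.inner_left_cross, inner_snd_cross,
      inner_fst_cross, inner_fst_chi]
    ring
  · have e1 := inner_cross_cross_rotate b c a
    have e2 := inner_cross_cross_rotate a b c
    rw [real_inner_comm] at e2
    have e3 : inner ℝ (cross b c) a = 0 := by rw [real_inner_comm]; exact h.inner_left_cross
    have e4 : inner ℝ (cross b c) b = 0 := by rw [real_inner_comm]; exact inner_fst_cross _ _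
    have e5 : inner ℝ (cross b c) c = 0 := by rw [real_inner_comm]; exact inner_snd_cross _ _
    simp only [inner_add_right, inner_smul_right, inner_cross_self, inner_cross_chi, e1, e2, e3,
      e4, e5, real_inner_comm a]
    ring
  · have e1 : inner ℝ (chi a b c) a = 0 := by rw [real_inner_comm]; exact inner_fst_chi
    have e2 : inner ℝ (chi a b c) b = 0 := by rw [real_inner_comm]; exact hb
    have e3 : inner ℝ (chi a b c) c = 0 := by rw [real_inner_comm]; exact hc
    simp only [inner_add_right, inner_smul_right, hmA, hmB, hmC, e1, e2, e3, h.inner_chi_chi]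
    ring

/-- The inner products with a vector, in terms of its coefficients in the basis
`a, b, c, b × c, c × a, a × b, χ(a, b, c)`. -/
theorem inner_tables (h : IsIsotropicTriple a b c) (x₁ x₂ x₃ y₁ y₂ y₃ z : ℝ) {u : E7}
    (hu : u = x₁ • a + x₂ • b + x₃ • c + (y₁ • cross b c + y₂ • cross c a + y₃ • cross a b)
      + z • chi a b c) :
    (inner ℝ a u = inner ℝ a a * x₁ + inner ℝ a b * x₂ + inner ℝ a c * x₃ ∧
    inner ℝ b u = inner ℝ a b * x₁ + inner ℝ b b * x₂ + inner ℝ b c * x₃ ∧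
    inner ℝ c u = inner ℝ a c * x₁ + inner ℝ b c * x₂ + inner ℝ c c * x₃) ∧
    (inner ℝ (cross b c) u = (inner ℝ b b * inner ℝ c c - inner ℝ b c * inner ℝ b c) * y₁
      + (inner ℝ b c * inner ℝ a c - inner ℝ a b * inner ℝ c c) * y₂
      + (inner ℝ a b * inner ℝ b c - inner ℝ a c * inner ℝ b b) * y₃ ∧
    inner ℝ (cross c a) u = (inner ℝ b c * inner ℝ a c - inner ℝ a b * inner ℝ c c) * y₁
      + (inner ℝ a a * inner ℝ c c - inner ℝ a c * inner ℝ a c) * y₂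
      + (inner ℝ a b * inner ℝ a c - inner ℝ b c * inner ℝ a a) * y₃ ∧
    inner ℝ (cross a b) u = (inner ℝ a b * inner ℝ b c - inner ℝ a c * inner ℝ b b) * y₁
      + (inner ℝ a b * inner ℝ a c - inner ℝ b c * inner ℝ a a) * y₂
      + (inner ℝ a a * inner ℝ b b - inner ℝ a b * inner ℝ a b) * y₃) ∧
    inner ℝ (chi a b c) u = gram3 a b c * z := by
  obtain ⟨h1, h2, h3⟩ := h.inner_table x₁ x₂ x₃ y₁ y₂ y₃ z hu
  obtain ⟨h4, h5, -⟩ := h.rotate.inner_table x₂ x₃ x₁ y₂ y₃ y₁ z (u := u)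
    (by rw [hu, chi_rotate (a := a)]; abel)
  obtain ⟨h6, h7, -⟩ := h.rotate.rotate.inner_table x₃ x₁ x₂ y₃ y₁ y₂ z (u := u)
    (by rw [hu, chi_rotate (a := b), chi_rotate (a := a)]; abel)
  simp only [real_inner_comm a, real_inner_comm b c] at *
  refine ⟨⟨h1, by rw [h4]; ring, by rw [h6]; ring⟩, ⟨h2, by rw [h5]; ring, by rw [h7]; ring⟩, h3⟩

theorem exists_expansion (h : IsIsotropicTriple a b c) (hD : gram3 a b c ≠ 0) (u : E7) :
    ∃ x₁ x₂ x₃ y₁ y₂ y₃ z : ℝ,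
      u = x₁ • a + x₂ • b + x₃ • c + (y₁ • cross b c + y₂ • cross c a + y₃ • cross a b)
      + z • chi a b c := by
  let S : (Fin 7 → ℝ) →ₗ[ℝ] E7 := Fintype.linearCombination ℝ
    ![a, b, c, cross b c, cross c a, cross a b, chi a b c]
  have hS : ∀ x, S x = x 0 • a + x 1 • b + x 2 • c + (x 3 • cross b c + x 4 • cross c a
      + x 5 • cross a b) + x 6 • chi a b c := by
    intro x
    simp [S, Fintype.linearCombination_apply, Fin.sum_univ_succ]
    abel
  have hinj : Function.Injective S := by
    refine (injective_iff_map_eq_zero S).2 fun x hx => ?_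
    rw [hS] at hx
    obtain ⟨⟨h1, h2, h3⟩, ⟨h4, h5, h6⟩, h7⟩ := h.inner_tables _ _ _ _ _ _ _ hx.symm
    simp only [inner_zero_right] at *
    have hz : x 6 = 0 := by simpa [hD] using h7.symm
    -- The first three coordinates are isolated by the adjugate of the Gram matrix of the triple.
    -- The next three already carry the adjugate, so the Gram matrix itself isolates them.
    have hx0 : gram3 a b c * x 0 = 0 := by
      rw [gram3]
      linear_combination -(inner ℝ b b * inner ℝ c c - inner ℝ b c * inner ℝ b c) * h1
        + (inner ℝ a b * inner ℝ c c - inner ℝ b c * inner ℝ a c) * h2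
        - (inner ℝ a b * inner ℝ b c - inner ℝ b b * inner ℝ a c) * h3
    have hx1 : gram3 a b c * x 1 = 0 := by
      rw [gram3]
      linear_combination (inner ℝ a b * inner ℝ c c - inner ℝ b c * inner ℝ a c) * h1
        - (inner ℝ a a * inner ℝ c c - inner ℝ a c * inner ℝ a c) * h2
        + (inner ℝ a a * inner ℝ b c - inner ℝ a b * inner ℝ a c) * h3
    have hx2 : gram3 a b c * x 2 = 0 := by
      rw [gram3]
      linear_combination -(inner ℝ a b * inner ℝ b c - inner ℝ b b * inner ℝ a c) * h1
        + (inner ℝ a a * inner ℝ b c - inner ℝ a b * inner ℝ a c) * h2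
        - (inner ℝ a a * inner ℝ b b - inner ℝ a b * inner ℝ a b) * h3
    have hx3 : gram3 a b c * x 3 = 0 := by
      rw [gram3]
      linear_combination -inner ℝ a a * h4 - inner ℝ a b * h5 - inner ℝ a c * h6
    have hx4 : gram3 a b c * x 4 = 0 := by
      rw [gram3]
      linear_combination -inner ℝ a b * h4 - inner ℝ b b * h5 - inner ℝ b c * h6
    have hx5 : gram3 a b c * x 5 = 0 := by
      rw [gram3]
      linear_combination -inner ℝ a c * h4 - inner ℝ b c * h5 - inner ℝ c c * h6
    simp only [mul_eq_zero, hD, false_or] at hx0 hx1 hx2 hx3 hx4 hx5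
    ext i; fin_cases i <;> simp <;> assumption
  have hsurj : Function.Surjective S :=
    (LinearMap.injective_iff_surjective_of_finrank_eq_finrank (by simp)).1 hinj
  obtain ⟨x, rfl⟩ := hsurj u
  exact ⟨_, _, _, _, _, _, _, hS x⟩

/-- The connection form dual to `a`: it is `1` on `a`, and vanishes on `b`, `c` and the orthogonal
complement of the triple. -/
def theta (a b c u : E7) : ℝ :=
  ((inner ℝ b b * inner ℝ c c - inner ℝ b c * inner ℝ b c) * inner ℝ a u
    - (inner ℝ a b * inner ℝ c c - inner ℝ b c * inner ℝ a c) * inner ℝ b u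
    + (inner ℝ a b * inner ℝ b c - inner ℝ b b * inner ℝ a c) * inner ℝ c u) / gram3 a b c

theorem theta_eq (h : IsIsotropicTriple a b c) (hD : gram3 a b c ≠ 0)
    {x₁ x₂ x₃ y₁ y₂ y₃ z : ℝ} {u : E7}
    (hu : u = x₁ • a + x₂ • b + x₃ • c + (y₁ • cross b c + y₂ • cross c a + y₃ • cross a b)
      + z • chi a b c) :
    theta a b c u = x₁ ∧ theta b c a u = x₂ ∧ theta c a b u = x₃ := by
  obtain ⟨⟨h1, h2, h3⟩, -, -⟩ := h.inner_tables _ _ _ _ _ _ _ hu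
  simp only [theta, gram3_rotate, h1, h2, h3, real_inner_comm a, real_inner_comm b c]
  refine ⟨?_, ?_, ?_⟩ <;> rw [div_eq_iff hD, gram3] <;> ring

/-- Inner products with the cross products will be the `dν_i`, and with `chi a b c` it will be `dμ`.
So this is the contraction of `φ` with one generator in terms of `θ`, `dν`, `dμ`. Rotating the
triple covers the other generators. -/
theorem phi_fst (h : IsIsotropicTriple a b c) (hD : gram3 a b c ≠ 0) (u v : E7) :
    phi0 ![a, u, v] =
      theta b c a u * inner ℝ (cross a b) v - theta b c a v * inner ℝ (cross a b) u
      - (theta c a b u * inner ℝ (cross c a) v - theta c a b v * inner ℝ (cross c a) u)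
      + (inner ℝ (chi a b c) u * (inner ℝ a a * inner ℝ (cross b c) v
          + inner ℝ a b * inner ℝ (cross c a) v + inner ℝ a c * inner ℝ (cross a b) v)
        - inner ℝ (chi a b c) v * (inner ℝ a a * inner ℝ (cross b c) u
          + inner ℝ a b * inner ℝ (cross c a) u + inner ℝ a c * inner ℝ (cross a b) u))
        / gram3 a b c := by
  obtain ⟨x₁, x₂, x₃, y₁, y₂, y₃, z, hu⟩ := h.exists_expansion hD u
  obtain ⟨x₁', x₂', x₃', y₁', y₂', y₃', z', hv⟩ := h.exists_expansion hD v
  obtain ⟨h1, h2, h3⟩ := h.theta_eq hD hu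
  obtain ⟨h1', h2', h3'⟩ := h.theta_eq hD hv
  obtain ⟨⟨i1, i2, i3⟩, ⟨i4, i5, i6⟩, i7⟩ := h.inner_tables _ _ _ _ _ _ _ hu
  obtain ⟨⟨i1', i2', i3'⟩, ⟨i4', i5', i6'⟩, i7'⟩ := h.inner_tables _ _ _ _ _ _ _ hv
  have key : ∀ {x₁ x₂ x₃ y₁ y₂ y₃ z : ℝ} {u : E7} (w : E7)
    (_ : u = x₁ • a + x₂ • b + x₃ • c + (y₁ • cross b c + y₂ • cross c a + y₃ • cross a b)
      + z • chi a b c), phi0 ![a, u, w] =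
        x₂ * inner ℝ (cross a b) w - x₃ * inner ℝ (cross c a) w
        + y₁ * (inner ℝ a c * inner ℝ b w - inner ℝ a b * inner ℝ c w - inner ℝ (chi a b c) w)
        + y₂ * (inner ℝ a a * inner ℝ c w - inner ℝ a c * inner ℝ a w)
        + y₃ * (inner ℝ a b * inner ℝ a w - inner ℝ a a * inner ℝ b w)
        + z * phi0 ![a, chi a b c, w] := by
    intro x₁ x₂ x₃ y₁ y₂ y₃ z u w hu
    have e1 : psi0 ![a, c, a, w] = 0 := by
      linarith [alt4_swap_mid psi0 a a c w, alt4_swap_left psi0 a a c w]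
    have e2 : psi0 ![a, a, b, w] = 0 := by
      linarith [alt4_swap_left psi0 a a b w]
    have f1 := phi_cross a b c w
    have f2 := phi0_cross a c a w
    have f3 := phi0_cross a a b w
    have f4 := inner_cross a b w
    have f5 := inner_cross c a w
    have f6 := alt3_swap' phi0 a c w
    rw [e1] at f2
    rw [e2] at f3
    rw [hu]
    simp only [alt3_add_mid, alt3_smul_mid, alt3_self', f1, f2, f3, ← f4]
    linear_combination x₃ * f6 + x₃ * f5
  -- The term left open by `key` is found by applying `key` once more, now to `v` with `chi a b c`
  -- in the last slot, where almost everything is orthogonal.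
  have hm : phi0 ![a, chi a b c, v] = gram3 a b c * y₁' := by
    have e := key (chi a b c) hv
    have e' : inner ℝ b (chi a b c) = 0 := by rw [← chi_rotate]; exact inner_fst_chi
    have e2 : inner ℝ c (chi a b c) = 0 := by
      rw [← chi_rotate, ← chi_rotate]; exact inner_fst_chi
    have hB : inner ℝ (cross c a) (chi a b c) = 0 := by rw [← chi_rotate]; exact inner_cross_chi
    have hC : inner ℝ (cross a b) (chi a b c) = 0 := by
      rw [← chi_rotate, ← chi_rotate]; exact inner_cross_chi
    rw [e', e2, hB, hC, inner_fst_chi, alt3_self, h.inner_chi_chi] at e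
    rw [alt3_swap, e]; ring
  rw [key v hu, hm, h2, h3, h2', h3', i4, i5, i6, i4', i5', i6', i1', i2', i3', i7, i7']
  rw [add_div' _ _ _ hD, eq_div_iff hD]
  rw [gram3]; ring

/-- The contraction of `*φ` with two generators: `θ_a ∧ dμ` minus the two-forms `dν_{j+1} ∧
dν_{j+2}` weighted by the first row of the inverse Gram matrix, that is, of `V`. -/
theorem psi_snd (h : IsIsotropicTriple a b c) (hD : gram3 a b c ≠ 0) (u v : E7) :
    psi0 ![b, c, u, v] =
      theta a b c u * inner ℝ (chi a b c) v - theta a b c v * inner ℝ (chi a b c) u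
      - ((inner ℝ b b * inner ℝ c c - inner ℝ b c * inner ℝ b c)
          * (inner ℝ (cross c a) u * inner ℝ (cross a b) v
            - inner ℝ (cross c a) v * inner ℝ (cross a b) u)
        + (inner ℝ b c * inner ℝ a c - inner ℝ a b * inner ℝ c c)
          * (inner ℝ (cross a b) u * inner ℝ (cross b c) v
            - inner ℝ (cross a b) v * inner ℝ (cross b c) u)
        + (inner ℝ a b * inner ℝ b c - inner ℝ a c * inner ℝ b b)
          * (inner ℝ (cross b c) u * inner ℝ (cross c a) v
            - inner ℝ (cross b c) v * inner ℝ (cross c a) u)) / gram3 a b c := by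
  obtain ⟨x₁, x₂, x₃, y₁, y₂, y₃, z, hu⟩ := h.exists_expansion hD u
  obtain ⟨x₁', x₂', x₃', y₁', y₂', y₃', z', hv⟩ := h.exists_expansion hD v
  obtain ⟨h1, h2, h3⟩ := h.theta_eq hD hu
  obtain ⟨h1', h2', h3'⟩ := h.theta_eq hD hv
  obtain ⟨⟨i1, i2, i3⟩, ⟨i4, i5, i6⟩, i7⟩ := h.inner_tables _ _ _ _ _ _ _ hu
  obtain ⟨⟨i1', i2', i3'⟩, ⟨i4', i5', i6'⟩, i7'⟩ := h.inner_tables _ _ _ _ _ _ _ hv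
  have hb : inner ℝ b (chi a b c) = 0 := by rw [← chi_rotate]; exact inner_fst_chi
  have hc : inner ℝ c (chi a b c) = 0 := by
    rw [← chi_rotate, ← chi_rotate]; exact inner_fst_chi
  have hB : inner ℝ (cross c a) (chi a b c) = 0 := by rw [← chi_rotate]; exact inner_cross_chi
  have hC : inner ℝ (cross a b) (chi a b c) = 0 := by
    rw [← chi_rotate, ← chi_rotate]; exact inner_cross_chi
  have key : ∀ {x₁ x₂ x₃ y₁ y₂ y₃ z : ℝ} {u : E7} (w : E7)
    (_ : u = x₁ • a + x₂ • b + x₃ • c + (y₁ • cross b c + y₂ • cross c a + y₃ • cross a b)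
      + z • chi a b c), psi0 ![b, c, w, u] =
        - x₁ * inner ℝ (chi a b c) w
        + y₁ * psi0 ![b, c, w, cross b c] + y₂ * psi0 ![b, c, w, cross c a]
        + y₃ * psi0 ![b, c, w, cross a b]
        + z * psi0 ![b, c, w, chi a b c] := by
    intro x₁ x₂ x₃ y₁ y₂ y₃ z u w hu
    have e1 : psi0 ![b, c, w, b] = 0 := by
      linarith [alt4_swap psi0 b c w b, alt4_swap_mid psi0 b b c w, alt4_swap_left psi0 b b c w]
    have e2 : psi0 ![b, c, w, c] = 0 := by
      linarith [alt4_swap psi0 b c w c, alt4_swap_mid psi0 b c c w]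
    have e3 : psi0 ![b, c, w, a] = - inner ℝ (chi a b c) w := by
      rw [alt4_swap, inner_chi, alt4_rotate]
    rw [hu]
    simp only [alt4_add, alt4_smul, e1, e2, e3]
    ring
  have hbB : inner ℝ b (cross c a) = 0 := h.rotate.inner_left_cross
  have hcC : inner ℝ c (cross a b) = 0 := h.rotate.rotate.inner_left_cross
  have vA : ∀ w, psi0 ![b, c, w, cross b c] = 0 := by
    intro w
    have e1 : chi c b c = 0 := by
      refine ext_inner_right ℝ fun z => ?_
      rw [inner_chi, inner_zero_left]
      linarith [alt4_swap_mid psi0 c b c z, alt4_swap_left psi0 c c b z]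
    rw [alt4_swap, psi0_apply, cross_cross, e1, inner_fst_cross, sub_zero,
      alt3_sub_mid, alt3_smul_mid, alt3_smul_mid, alt3_self', ← inner_cross b c,
      real_inner_comm c b]
    ring
  have vB : ∀ w, psi0 ![b, c, w, cross c a] = inner ℝ b c * inner ℝ (cross c a) w
      + inner ℝ a c * inner ℝ (cross b c) w + inner ℝ c c * inner ℝ (cross a b) w := by
    intro w
    have e1 : chi c c a = 0 := by
      refine ext_inner_right ℝ fun z => ?_
      rw [inner_chi, inner_zero_left]
      linarith [alt4_swap_left psi0 c c a z]
    rw [alt4_swap, psi0_apply, cross_cross, e1, hbB, sub_zero,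
      alt3_sub_mid, alt3_smul_mid, alt3_smul_mid, alt3_swap' phi0 a b w,
      ← inner_cross b c, ← inner_cross a b, real_inner_comm a c]
    ring
  have vC : psi0 ![b, c, chi a b c, cross a b] = 0 := by
    rw [alt4_swap, psi0_apply, cross_cross, inner_snd_cross, alt3_sub_mid, alt3_sub_mid,
      alt3_smul_mid, alt3_smul_mid, alt3_self', alt3_swap' phi0 a b, ← inner_cross a b, hC,
      chi_rotate (a := b), chi_rotate (a := a), alt3_self]
    ring
  have hBm := real_inner_comm (cross c a) (chi a b c)
  have hCm := real_inner_comm (cross a b) (chi a b c)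
  have hAm := real_inner_comm (cross b c) (chi a b c)
  have hBC := real_inner_comm (cross c a) (cross a b)
  have hAC := real_inner_comm (cross b c) (cross a b)
  rw [hB] at hBm
  rw [hC] at hCm
  rw [inner_cross_chi] at hAm
  have e0 : ∀ w, psi0 ![b, c, w, w] = 0 := fun w => by linarith [alt4_swap psi0 b c w w]
  have uC : psi0 ![b, c, u, cross a b] = -y₂ * (inner ℝ b c * inner ℝ (cross c a) (cross a b)
      + inner ℝ a c * inner ℝ (cross b c) (cross a b)
      + inner ℝ c c * inner ℝ (cross a b) (cross a b)) := by
    have e2 : psi0 ![b, c, cross a b, chi a b c] = 0 := by rw [alt4_swap, vC, neg_zero]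
    rw [alt4_swap, key (cross a b) hu, vA, vB, e0, e2, hCm]
    ring
  have um : psi0 ![b, c, u, chi a b c] = x₁ * gram3 a b c := by
    rw [alt4_swap, key (chi a b c) hu, vA, vB, vC, e0, hB, hC, inner_cross_chi, h.inner_chi_chi]
    ring
  have e1 := inner_cross_cross_rotate c a b
  have e2 := inner_cross_cross_rotate a b c
  rw [key u hv, vA, vB, uC, um, ← hAC, e1, e2, inner_cross_self, h1, h1', i4, i5, i6, i4', i5', i6',
    i7, i7', eq_sub_iff_add_eq, add_div' _ _ _ hD, div_eq_iff hD]
  rw [gram3]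
  simp only [real_inner_comm a, real_inner_comm b c]
  ring

end IsIsotropicTriple

namespace IsIsotropicTriple

variable {a b c : E7}

theorem inner_eq (h : IsIsotropicTriple a b c) (hD : gram3 a b c ≠ 0) (u v : E7) :
    inner ℝ u v =
      inner ℝ a a * theta a b c u * theta a b c v + inner ℝ b b * theta b c a u * theta b c a v
      + inner ℝ c c * theta c a b u * theta c a b v
      + inner ℝ a b * (theta a b c u * theta b c a v + theta b c a u * theta a b c v)
      + inner ℝ a c * (theta a b c u * theta c a b v + theta c a b u * theta a b c v)
      + inner ℝ b c * (theta b c a u * theta c a b v + theta c a b u * theta b c a v)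
      + (inner ℝ a a * inner ℝ (cross b c) u * inner ℝ (cross b c) v
      + inner ℝ b b * inner ℝ (cross c a) u * inner ℝ (cross c a) v
      + inner ℝ c c * inner ℝ (cross a b) u * inner ℝ (cross a b) v
      + inner ℝ a b * (inner ℝ (cross b c) u * inner ℝ (cross c a) v
        + inner ℝ (cross c a) u * inner ℝ (cross b c) v)
      + inner ℝ a c * (inner ℝ (cross b c) u * inner ℝ (cross a b) v
        + inner ℝ (cross a b) u * inner ℝ (cross b c) v)
      + inner ℝ b c * (inner ℝ (cross c a) u * inner ℝ (cross a b) v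
        + inner ℝ (cross a b) u * inner ℝ (cross c a) v)
      + inner ℝ (chi a b c) u * inner ℝ (chi a b c) v) / gram3 a b c := by
  obtain ⟨x₁, x₂, x₃, y₁, y₂, y₃, z, hu⟩ := h.exists_expansion hD u
  obtain ⟨x₁', x₂', x₃', y₁', y₂', y₃', z', hv⟩ := h.exists_expansion hD v
  obtain ⟨h1, h2, h3⟩ := h.theta_eq hD hu
  obtain ⟨h1', h2', h3'⟩ := h.theta_eq hD hv
  obtain ⟨⟨i1, i2, i3⟩, ⟨i4, i5, i6⟩, i7⟩ := h.inner_tables _ _ _ _ _ _ _ hu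
  obtain ⟨⟨i1', i2', i3'⟩, ⟨i4', i5', i6'⟩, i7'⟩ := h.inner_tables _ _ _ _ _ _ _ hv
  have key : inner ℝ u v = x₁ * inner ℝ a v + x₂ * inner ℝ b v + x₃ * inner ℝ c v
      + (y₁ * inner ℝ (cross b c) v + y₂ * inner ℝ (cross c a) v + y₃ * inner ℝ (cross a b) v)
      + z * inner ℝ (chi a b c) v := by
    rw [hu]; simp only [inner_add_left, inner_smul_left]; rfl
  rw [key, h1, h2, h3, h1', h2', h3', i4, i5, i6, i4', i5', i6', i1', i2', i3', i7, i7']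
  rw [← sub_eq_iff_eq_add', eq_div_iff hD]
  rw [gram3]; ring

end IsIsotropicTriple

/-! ### The metric recovered from the 3-form: independence of the adapted basis and continuity. -/

-- A skew matrix of odd size is singular; adding `w wᵀ`, with `w` nonzero on the kernel vector `x`,
-- removes the degeneracy, and the determinant sees only `w · x` and `q`.
open Matrix in
theorem det_skew_add_vecMulVec_sq {X : Matrix (Fin 7) (Fin 7) ℝ} {x w : Fin 7 → ℝ} {q : ℝ}
    (hX : Xᵀ = -X) (hx : X *ᵥ x = 0) (hq : x ⬝ᵥ x = q) (hq0 : q ≠ 0)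
    (hXX : X * X = vecMulVec x x - q • (1 : Matrix (Fin 7) (Fin 7) ℝ)) (hw : w ⬝ᵥ x = 1) :
    (X + vecMulVec w w).det ^ 2 = q ^ 4 := by
  have hdet : ∀ u v : Fin 7 → ℝ, (1 + vecMulVec u v).det = 1 + v ⬝ᵥ u := by
    intro u v
    rw [vecMulVec_eq Unit, det_one_add_replicateCol_mul_replicateRow]
  have hx' : x ᵥ* X = 0 := by
    rw [← mulVec_transpose, hX, neg_mulVec, hx, neg_zero]
  set w' : Fin 7 → ℝ := q⁻¹ • x with hw'
  -- A shear of determinant one along the kernel of `X`: as a congruence it fixes `X` and replaces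
  -- `w` by the multiple `w'` of `x`. Then `X + w' w'ᵀ` times its transpose is `q` times a rank-one
  -- perturbation of the identity.
  set S : Matrix (Fin 7) (Fin 7) ℝ := 1 + vecMulVec x (w' - w) with hS
  have hwx' : w' ⬝ᵥ x = 1 := by rw [hw', smul_dotProduct, hq, smul_eq_mul, inv_mul_cancel₀ hq0]
  have hSdet : S.det = 1 := by rw [hS, hdet, sub_dotProduct, hwx', hw]; ring
  have hXS : X * S = X := by
    rw [hS, mul_add, mul_one, mul_vecMulVec, hx, zero_vecMulVec, add_zero]
  have hSX : Sᵀ * X = X := by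
    rw [← transpose_inj, transpose_mul, transpose_transpose, hX, neg_mul, hXS]
  have hwS : w ᵥ* S = w' := by
    rw [hS, vecMul_add, vecMul_one, vecMul_vecMulVec, hw]; simp
  have hconj : Sᵀ * (X + vecMulVec w w) * S = X + vecMulVec w' w' := by
    rw [mul_add Sᵀ, hSX, add_mul _ _ S, hXS, mul_vecMulVec, vecMulVec_mul, hwS, mulVec_transpose, hwS]
  have hd1 : (X + vecMulVec w w).det = (X + vecMulVec w' w').det := by
    rw [← hconj, det_mul, det_mul, det_transpose, hSdet]; ring
  have hXw : X *ᵥ w' = 0 := by rw [hw', mulVec_smul, hx, smul_zero]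
  have hwX : w' ᵥ* X = 0 := by rw [hw', smul_vecMul, hx', smul_zero]
  have hprod : (X + vecMulVec w' w') * (X + vecMulVec w' w')ᵀ =
      q • (1 + vecMulVec x ((q⁻¹ ^ 4 - q⁻¹) • x)) := by
    rw [transpose_add, hX, transpose_vecMulVec, add_mul, mul_add, mul_add, mul_neg, hXX,
      mul_vecMulVec, hXw, mul_neg, vecMulVec_mul, hwX, mul_vecMulVec, vecMulVec_mulVec,
      hw', smul_dotProduct, dotProduct_smul, hq]
    ext i j
    simp [vecMulVec_apply]
    field_simp
    ring
  have h2 := congrArg det hprod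
  rw [det_mul, det_transpose, ← hd1, det_smul, hdet, smul_dotProduct, hq] at h2
  rw [sq, h2]
  simp
  field_simp
  ring

-- This determines `|u|²`, up to a factor independent of `u`, from `phi0` and an arbitrary
-- functional `w` normalised on `u`. No volume form is involved, so it transports along any linear
-- isomorphism preserving the 3-form.
open Matrix in
theorem det_phi0_add_sq (u : E7) (w : E7 →ₗ[ℝ] ℝ) (hw : w u = 1) (e : Fin 7 → E7) :
    (Matrix.of fun i j => phi0 ![u, e i, e j] + w (e i) * w (e j)).det ^ 2 =
      inner ℝ u u ^ 4 * (Matrix.of fun i j => (inner ℝ (e i) (e j) : ℝ)).det ^ 2 := by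
  set X : Matrix (Fin 7) (Fin 7) ℝ := Matrix.of fun i j =>
    phi0 ![u, EuclideanSpace.single i 1, EuclideanSpace.single j 1] with hX
  set wv : Fin 7 → ℝ := fun i => w (EuclideanSpace.single i 1) with hwv
  set P : Matrix (Fin 7) (Fin 7) ℝ := Matrix.of fun k i => e i k with hP
  have hexp : ∀ z : E7, z = ∑ k, z k • EuclideanSpace.single k (1 : ℝ) := by
    intro z; ext j; simp [Pi.single_apply]
  have hwe : ∀ z : E7, w z = ∑ k, z k * wv k := by
    intro z; conv_lhs => rw [hexp z]
    simp [map_sum, hwv]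
  have hright : ∀ y z : E7, phi0 ![u, y, z] =
      ∑ k, z k * phi0 ![u, y, EuclideanSpace.single k 1] := by
    intro y z; conv_lhs => rw [hexp z]
    simp only [Fin.sum_univ_succ, Finset.univ_eq_empty, Finset.sum_empty, add_zero, alt3_add,
      alt3_smul]
  have hmid : ∀ y z : E7, phi0 ![u, y, z] =
      ∑ k, y k * phi0 ![u, EuclideanSpace.single k 1, z] := by
    intro y z
    rw [← neg_inj, ← alt3_swap, hright, ← Finset.sum_neg_distrib]
    refine Finset.sum_congr rfl fun k _ => ?_
    rw [alt3_swap]; ring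
  have hN : (Matrix.of fun i j => phi0 ![u, e i, e j] + w (e i) * w (e j)) =
      Pᵀ * (X + vecMulVec wv wv) * P := by
    ext i j
    have h1 : phi0 ![u, e i, e j] = ∑ l, (∑ k, e i k * X k l) * e j l := by
      rw [hright]
      refine Finset.sum_congr rfl fun l _ => ?_
      rw [hmid, mul_comm]; rfl
    have h2 : w (e i) * w (e j) = ∑ l, (∑ k, e i k * (wv k * wv l)) * e j l := by
      rw [hwe, hwe (e j), Finset.mul_sum]
      refine Finset.sum_congr rfl fun l _ => ?_
      rw [Finset.sum_mul, Finset.sum_mul]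
      refine Finset.sum_congr rfl fun k _ => ?_
      ring
    rw [Matrix.of_apply, h1, h2, ← Finset.sum_add_distrib]
    simp only [Matrix.mul_apply, Matrix.add_apply, vecMulVec_apply, transpose_apply, hP,
      Matrix.of_apply, mul_add, Finset.sum_add_distrib, add_mul]
  have hG : (Matrix.of fun i j => (inner ℝ (e i) (e j) : ℝ)) = Pᵀ * P := by
    ext i j
    simp only [Matrix.mul_apply, transpose_apply, hP, Matrix.of_apply, PiLp.inner_apply]
    refine Finset.sum_congr rfl fun l _ => ?_
    simp [mul_comm]
  have hu0 : (inner ℝ u u : ℝ) ≠ 0 := by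
    intro h0
    rw [inner_self_eq_zero.1 h0, map_zero] at hw
    exact zero_ne_one hw
  have hXskew : Xᵀ = -X := by
    ext i j; simp only [hX, transpose_apply, Matrix.of_apply, Matrix.neg_apply]; rw [alt3_swap]
  have hdot : ∀ y z : E7, (inner ℝ y z : ℝ) = ∑ k, y k * z k := by
    intro y z; simp [PiLp.inner_apply, mul_comm]
  have hXu : X *ᵥ (fun k => u k) = 0 := by
    ext i
    have := hright (EuclideanSpace.single i 1) u
    rw [alt3_swap, alt3_self'] at this
    simp only [mulVec, dotProduct, hX, Matrix.of_apply, Pi.zero_apply]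
    rw [neg_zero] at this
    rw [this]
    exact Finset.sum_congr rfl fun k _ => mul_comm _ _
  have hXX : X * X = vecMulVec (fun k => u k) (fun k => u k)
      - (inner ℝ u u : ℝ) • (1 : Matrix (Fin 7) (Fin 7) ℝ) := by
    ext i j
    have h1 := inner_cross_cross u (EuclideanSpace.single i 1) u (EuclideanSpace.single j 1)
    have h2 : psi0 ![u, EuclideanSpace.single i 1, u, EuclideanSpace.single j 1] = 0 := by
      linarith [alt4_swap_mid psi0 u u (EuclideanSpace.single i (1 : ℝ))
        (EuclideanSpace.single j 1), alt4_swap_left psi0 u u (EuclideanSpace.single i (1 : ℝ))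
        (EuclideanSpace.single j 1)]
    have h3 : inner ℝ (cross u (EuclideanSpace.single i 1)) (cross u (EuclideanSpace.single j 1)) =
        ∑ k, X i k * X j k := hdot _ _
    have h4 : (X * X) i j = -∑ k, X i k * X j k := by
      rw [Matrix.mul_apply, ← Finset.sum_neg_distrib]
      refine Finset.sum_congr rfl fun k _ => ?_
      have := congrFun (congrFun hXskew j) k
      simp only [transpose_apply, Matrix.neg_apply] at this
      rw [this]; ring
    rw [h4, ← h3, h1, h2]
    rcases eq_or_ne i j with rfl | hij
    · simp [vecMulVec_apply, EuclideanSpace.inner_single_left, EuclideanSpace.inner_single_right]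
    · simp [vecMulVec_apply, EuclideanSpace.inner_single_left, EuclideanSpace.inner_single_right,
        hij, hij.symm, mul_comm]
  have hwx : wv ⬝ᵥ (fun k => u k) = 1 := by
    rw [← hw, hwe u, dotProduct]
    exact Finset.sum_congr rfl fun k _ => mul_comm _ _
  have key := det_skew_add_vecMulVec_sq hXskew hXu (hdot u u).symm hu0 hXX hwx
  rw [hN, hG, det_mul, det_mul, det_mul, det_transpose, mul_pow, mul_pow, key]
  ring

/-- The stabiliser of `φ₀` consists of isometries. -/
theorem inner_map_of_phi0_map (A : E7 ≃ₗ[ℝ] E7)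
    (hA : ∀ u v w, phi0 ![A u, A v, A w] = phi0 ![u, v, w]) (u v : E7) :
    inner ℝ (A u) (A v) = (inner ℝ u v : ℝ) := by
  set e : Fin 7 → E7 := fun i => EuclideanSpace.single i 1 with he
  set D : ℝ := (Matrix.of fun i j => (inner ℝ (A (e i)) (A (e j)) : ℝ)).det with hD
  have hI : (Matrix.of fun i j => (inner ℝ (e i) (e j) : ℝ)) = 1 := by
    ext i j
    rcases eq_or_ne i j with rfl | hij
    · simp [he, EuclideanSpace.inner_single_left]
    · simp [he, EuclideanSpace.inner_single_left, hij]
  -- Applying `det_phi0_add_sq` to `u` and to `A u` gives `|u|⁸ = |A u|⁸ D²`, so `A` is conformal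
  -- with factor governed by `κ = √|D|`.
  set κ : ℝ := √|D| with hκ
  have hκ0 : 0 ≤ κ := Real.sqrt_nonneg _
  have hκD : κ ^ 4 = D ^ 2 := by
    rw [show κ ^ 4 = (κ ^ 2) ^ 2 by ring, hκ, Real.sq_sqrt (abs_nonneg D), sq_abs]
  have hself : ∀ u : E7, (inner ℝ u u : ℝ) = inner ℝ (A u) (A u) * κ := by
    intro u
    rcases eq_or_ne u 0 with rfl | hu
    · simp
    have hu0 : (inner ℝ u u : ℝ) ≠ 0 := inner_self_eq_zero.not.2 hu
    set w : E7 →ₗ[ℝ] ℝ := (inner ℝ u u : ℝ)⁻¹ • (innerₛₗ ℝ u) with hw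
    have hwu : w u = 1 := by
      simp only [hw, LinearMap.smul_apply, innerₛₗ_apply_apply, smul_eq_mul]
      exact inv_mul_cancel₀ hu0
    have h1 := det_phi0_add_sq u w hwu e
    have h2 := det_phi0_add_sq (A u) (w ∘ₗ A.symm.toLinearMap) (by simpa using hwu)
      (fun i => A (e i))
    simp only [hA, LinearMap.comp_apply, LinearEquiv.coe_coe, LinearEquiv.symm_apply_apply] at h2
    rw [h1, hI, Matrix.det_one, ← hD, ← hκD, ← mul_pow, one_pow, mul_one] at h2
    exact (pow_left_inj₀ real_inner_self_nonneg (mul_nonneg real_inner_self_nonneg hκ0)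
      four_ne_zero).1 h2
  have hpol : ∀ u v : E7, (inner ℝ u v : ℝ) = inner ℝ (A u) (A v) * κ := by
    intro u v
    have h1 := hself (u + v)
    simp only [map_add, inner_add_left, inner_add_right] at h1
    have h2 := real_inner_comm u v
    have h3 := real_inner_comm (A u) (A v)
    rw [h2, h3] at h1
    linarith [hself u, hself v]
  -- Taking determinants of the conformality relation gives `1 = κ⁷ D`. Squaring and using `κ⁴ = D²`
  -- gives `κ¹⁸ = 1`.
  have hκ1 : κ = 1 := by
    have h1 : (1 : Matrix (Fin 7) (Fin 7) ℝ) =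
        κ • (Matrix.of fun i j => (inner ℝ (A (e i)) (A (e j)) : ℝ)) := by
      rw [← hI]; ext i j
      simp only [Matrix.of_apply, Matrix.smul_apply, smul_eq_mul]
      rw [hpol]; ring
    have h2 := congrArg Matrix.det h1
    rw [Matrix.det_one, Matrix.det_smul, ← hD, Fintype.card_fin] at h2
    have h3 : κ ^ 18 = 1 := by
      calc κ ^ 18 = κ ^ 14 * κ ^ 4 := by ring
        _ = (κ ^ 7 * D) ^ 2 := by rw [hκD]; ring
        _ = 1 := by rw [← h2]; ring
    exact (pow_eq_one_iff_of_nonneg hκ0 (by norm_num)).1 h3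
  rw [hpol u v, hκ1, mul_one]

section Equivalence

variable {W : Type*} [AddCommGroup W] [Module ℝ W] [TopologicalSpace W]
  {W' : Type*} [AddCommGroup W'] [Module ℝ W'] [TopologicalSpace W']

theorem exists_adapted_coordinates {φ : W [⋀^Fin 3]→L[ℝ] ℝ}
    (h : ∃ L : E7 ≃L[ℝ] W, IsAdapted φ L) :
    ∃ K : W ≃L[ℝ] E7, (∀ u v w, φ ![u, v, w] = phi0 ![K u, K v, K w]) ∧
      (∀ u v, innerOf φ u v = inner ℝ (K u) (K v)) ∧
      ∀ u v w z, dualOf φ ![u, v, w, z] = psi0 ![K u, K v, K w, K z] := by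
  refine ⟨h.choose.symm, fun u v w => ?_, fun u v => ?_, fun u v w z => ?_⟩
  · rw [← h.choose_spec, ContinuousAlternatingMap.compContinuousLinearMap_apply]
    congr 1; ext i; fin_cases i <;> simp
  · rw [innerOf, dif_pos h]
  · rw [dualOf, dif_pos h, ContinuousAlternatingMap.compContinuousLinearMap_apply]
    congr 1; ext i; fin_cases i <;> simp

theorem psi0_eq_of_phi0_map (A : E7 ≃ₗ[ℝ] E7)
    (hA : ∀ u v w, phi0 ![A u, A v, A w] = phi0 ![u, v, w]) (u v w z : E7) :
    psi0 ![A u, A v, A w, A z] = psi0 ![u, v, w, z] := by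
  have hc : cross (A v) (A w) = A (cross v w) := by
    refine ext_inner_right ℝ fun y => ?_
    obtain ⟨y, rfl⟩ := A.surjective y
    rw [inner_cross, hA, inner_map_of_phi0_map A hA, inner_cross]
  simp only [psi0_apply, hc, hA, inner_map_of_phi0_map A hA]

/-- An isomorphism which identifies two `G₂`-forms identifies the inner products and the dual
`4`-forms. -/
theorem innerOf_dualOf_map {φ : W [⋀^Fin 3]→L[ℝ] ℝ} {φ' : W' [⋀^Fin 3]→L[ℝ] ℝ}
    (h : ∃ L : E7 ≃L[ℝ] W, IsAdapted φ L) (h' : ∃ L : E7 ≃L[ℝ] W', IsAdapted φ' L)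
    (T : W →ₗ[ℝ] W') (hT : Function.Bijective T)
    (hφ : ∀ u v w, φ' ![T u, T v, T w] = φ ![u, v, w]) :
    (∀ u v, innerOf φ' (T u) (T v) = innerOf φ u v) ∧
      ∀ u v w z, dualOf φ' ![T u, T v, T w, T z] = dualOf φ ![u, v, w, z] := by
  obtain ⟨K, h1, h2, h3⟩ := exists_adapted_coordinates h
  obtain ⟨K', h1', h2', h3'⟩ := exists_adapted_coordinates h'
  let A : E7 ≃ₗ[ℝ] E7 := K.symm.toLinearEquiv.trans
    ((LinearEquiv.ofBijective T hT).trans K'.toLinearEquiv)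
  have hAK : ∀ u, A (K u) = K' (T u) := by intro u; simp [A]
  have hA : ∀ u v w, phi0 ![A u, A v, A w] = phi0 ![u, v, w] := by
    intro u v w
    obtain ⟨u, rfl⟩ := K.surjective u
    obtain ⟨v, rfl⟩ := K.surjective v
    obtain ⟨w, rfl⟩ := K.surjective w
    rw [hAK, hAK, hAK, ← h1', hφ, h1]
  refine ⟨fun u v => ?_, fun u v w z => ?_⟩
  · rw [h2', h2, ← hAK, ← hAK, inner_map_of_phi0_map A hA]
  · rw [h3', h3, ← hAK, ← hAK, ← hAK, ← hAK, psi0_eq_of_phi0_map A hA]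

end Equivalence

section Continuity

variable {X : Type*} [TopologicalSpace X]

theorem innerOf_self_pos {W : Type*} [AddCommGroup W] [Module ℝ W] [TopologicalSpace W]
    {φ : W [⋀^Fin 3]→L[ℝ] ℝ} (h : ∃ L : E7 ≃L[ℝ] W, IsAdapted φ L) {u : W} (hu : u ≠ 0) :
    0 < innerOf φ u u := by
  obtain ⟨K, -, h2, -⟩ := exists_adapted_coordinates h
  rw [h2]
  exact real_inner_self_pos.2 (by simpa using hu)

/-- The adapted bases are chosen pointwise without any continuity. By `det_phi0_add_sq` the metric
times the unknown volume factor `κ = √(det g)` is nevertheless a fourth root of a polynomial in the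
coefficients of `Φ`. Polarisation passes from squares to inner products. -/
theorem continuousOn_innerOf {Φ : X → E7 [⋀^Fin 3]→L[ℝ] ℝ} {s : Set X} (hΦ : ContinuousOn Φ s)
    (h : ∀ x ∈ s, ∃ L : E7 ≃L[ℝ] E7, IsAdapted (Φ x) L) (u v : E7) :
    ContinuousOn (fun x => innerOf (Φ x) u v) s := by
  set e : Fin 7 → E7 := fun i => EuclideanSpace.single i 1 with he
  set D : X → ℝ := fun x => (Matrix.of fun i j => innerOf (Φ x) (e i) (e j)).det with hD
  have hlin : ∀ x ∈ s, ∃ K : E7 ≃L[ℝ] E7,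
      (∀ u v w, Φ x ![u, v, w] = phi0 ![K u, K v, K w]) ∧
      ∀ u v, innerOf (Φ x) u v = inner ℝ (K u) (K v) := fun x hx => by
    obtain ⟨K, h1, h2, -⟩ := exists_adapted_coordinates (h x hx)
    exact ⟨K, h1, h2⟩
  have hDpos : ∀ x ∈ s, 0 < D x := by
    intro x hx
    obtain ⟨K, -, h2⟩ := hlin x hx
    have hli : LinearIndependent ℝ (fun i => K (e i)) := by
      have hb : LinearIndependent ℝ e := by
        have h0 := (EuclideanSpace.basisFun (Fin 7) ℝ).toBasis.linearIndependent
        have h1 : ⇑(EuclideanSpace.basisFun (Fin 7) ℝ).toBasis = e := by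
          funext i; simp [he]
        rw [h1] at h0
        exact h0
      exact hb.map' K.toLinearEquiv.toLinearMap K.toLinearEquiv.ker
    have h3 : Matrix.of (fun i j => innerOf (Φ x) (e i) (e j)) =
        Matrix.gram ℝ (fun i => K (e i)) := by
      ext i j; simp [Matrix.gram, h2]
    have := (Matrix.posDef_gram_of_linearIndependent hli).det_pos
    rw [← h3] at this
    exact this
  set κ : X → ℝ := fun x => √(D x) with hκ
  have hκpos : ∀ x ∈ s, 0 < κ x := fun x hx => Real.sqrt_pos.2 (hDpos x hx)
  have hself : ∀ u : E7, ContinuousOn (fun x => innerOf (Φ x) u u * κ x) s := by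
    intro u
    rcases eq_or_ne u 0 with rfl | hu
    · refine (continuousOn_const (c := (0 : ℝ))).congr fun x hx => ?_
      obtain ⟨K, -, h2⟩ := hlin x hx
      simp [h2]
    set w : E7 →ₗ[ℝ] ℝ := (inner ℝ u u : ℝ)⁻¹ • (innerₛₗ ℝ u) with hw
    have hwu : w u = 1 := by
      simp only [hw, LinearMap.smul_apply, innerₛₗ_apply_apply, smul_eq_mul]
      exact inv_mul_cancel₀ (inner_self_eq_zero.not.2 hu)
    have hF : ContinuousOn (fun x =>
        (Matrix.of fun i j => Φ x ![u, e i, e j] + w (e i) * w (e j)).det ^ 2) s := by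
      have hev : ∀ y : Fin 3 → E7, ContinuousOn (fun x => Φ x y) s := fun y =>
        (ContinuousAlternatingMap.apply ℝ E7 ℝ y).continuous.comp_continuousOn hΦ
      refine ContinuousOn.pow ?_ 2
      simp only [Matrix.det_apply]
      refine continuousOn_finsetSum _ fun σ _ => ContinuousOn.const_smul ?_ _
      refine continuousOn_finsetProd _ fun i _ => ?_
      exact (hev _).add continuousOn_const
    refine (hF.sqrt.sqrt).congr fun x hx => ?_
    obtain ⟨K, h1, h2⟩ := hlin x hx
    have h3 := det_phi0_add_sq (K u) (w ∘ₗ K.symm.toLinearEquiv.toLinearMap) (by simpa using hwu)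
      (fun i => K (e i))
    simp only [LinearMap.comp_apply, LinearEquiv.coe_coe, ContinuousLinearEquiv.coe_toLinearEquiv,
      ContinuousLinearEquiv.symm_apply_apply, ← h1, ← h2] at h3
    have h4 : 0 ≤ innerOf (Φ x) u u * κ x :=
      mul_nonneg (by rw [h2]; exact real_inner_self_nonneg) (hκpos x hx).le
    have h5 : κ x ^ 4 = D x ^ 2 := by
      rw [show κ x ^ 4 = (κ x ^ 2) ^ 2 by ring, hκ, Real.sq_sqrt (hDpos x hx).le]
    change _ = √√((Matrix.of fun i j => Φ x ![u, e i, e j] + w (e i) * w (e j)).det ^ 2)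
    rw [h3]
    change _ = √√(innerOf (Φ x) u u ^ 4 * D x ^ 2)
    rw [← h5, ← mul_pow, show ∀ r : ℝ, r ^ 4 = (r ^ 2) ^ 2 from fun r => by ring,
      Real.sqrt_sq (sq_nonneg _), Real.sqrt_sq h4]
  have hpol : ∀ u v : E7, ContinuousOn (fun x => innerOf (Φ x) u v * κ x) s := by
    intro u v
    refine ((((hself (u + v)).sub (hself u)).sub (hself v)).div_const 2).congr fun x hx => ?_
    obtain ⟨K, -, h2⟩ := hlin x hx
    simp only [Pi.sub_apply, h2, map_add, inner_add_left, inner_add_right,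
      real_inner_comm (K u) (K v)]
    ring
  -- The determinant of `κ g` is `κ⁷ det g = κ⁹`, and its ninth root isolates `κ`.
  have hκc : ContinuousOn κ s := by
    have h1 : ContinuousOn (fun x =>
        (Matrix.of fun i j => innerOf (Φ x) (e i) (e j) * κ x).det) s := by
      simp only [Matrix.det_apply]
      refine continuousOn_finsetSum _ fun σ _ => ContinuousOn.const_smul ?_ _
      exact continuousOn_finsetProd _ fun i _ => hpol _ _
    refine (h1.rpow_const (p := 1 / 9) fun x _ => Or.inr (by norm_num)).congr fun x hx => ?_
    have h2 : (Matrix.of fun i j => innerOf (Φ x) (e i) (e j) * κ x) =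
        κ x • (Matrix.of fun i j => innerOf (Φ x) (e i) (e j)) := by
      ext i j; simp [mul_comm]
    have h3 : κ x ^ 2 = D x := Real.sq_sqrt (hDpos x hx).le
    have h4 : (Matrix.of fun i j => innerOf (Φ x) (e i) (e j) * κ x).det = κ x ^ 9 := by
      rw [h2, Matrix.det_smul, Fintype.card_fin]
      change κ x ^ 7 * D x = _
      rw [← h3]; ring
    change _ = (Matrix.of fun i j => innerOf (Φ x) (e i) (e j) * κ x).det ^ (1 / 9 : ℝ)
    rw [h4, ← Real.rpow_natCast, ← Real.rpow_mul (hκpos x hx).le]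
    norm_num
  refine ((hpol u v).div hκc fun x hx => (hκpos x hx).ne').congr fun x hx => ?_
  change _ = innerOf (Φ x) u v * κ x / κ x
  rw [mul_div_cancel_right₀ _ (hκpos x hx).ne']

end Continuity

/-! ### Pullbacks of closed forms under parametrizations. -/

section Pullback

variable {M : Type*} [TopologicalSpace M] [ChartedSpace E7 M]

/-- The pullback of a field of alternating forms under a parametrization. -/
def pull {k : ℕ} (η : ∀ p : M, TangentSpace (𝓡 7) p [⋀^Fin k]→L[ℝ] ℝ) (Ψ : E7 → M) (x : E7) :
    E7 [⋀^Fin k]→L[ℝ] ℝ :=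
  (η (Ψ x)).compContinuousLinearMap (mfderiv 𝓘(ℝ, E7) (𝓡 7) Ψ x)

theorem pull_apply {k : ℕ} (η : ∀ p : M, TangentSpace (𝓡 7) p [⋀^Fin k]→L[ℝ] ℝ) (Ψ : E7 → M)
    (x : E7) (v : Fin k → E7) :
    pull η Ψ x v = η (Ψ x) (fun i => mfderiv 𝓘(ℝ, E7) (𝓡 7) Ψ x (v i)) := rfl

theorem contDiffAt_compContinuousLinearMap_apply {k : ℕ} {η : E7 → E7 [⋀^Fin k]→L[ℝ] ℝ}
    {A : E7 → E7 →L[ℝ] E7} {x : E7} (hη : ContDiffAt ℝ ∞ η x) (hA : ContDiffAt ℝ ∞ A x)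
    (v : Fin k → E7) :
    ContDiffAt ℝ ∞ (fun y => (η y).compContinuousLinearMap (A y) v) x := by
  have h1 : ContDiffAt ℝ ∞ (fun y => ContinuousMultilinearMap.compContinuousLinearMapContinuousMultilinear
      ℝ (fun _ : Fin k => E7) (fun _ : Fin k => E7) ℝ (fun _ => A y)) x :=
    (ContinuousMultilinearMap.contDiff _).contDiffAt.comp x (contDiffAt_pi.2 fun _ => hA)
  have h2 : ContDiffAt ℝ ∞ (fun y => (η y).toContinuousMultilinearMap) x :=
    (ContinuousAlternatingMap.toContinuousMultilinearMapLI (𝕜 := ℝ) (E := E7) (F := ℝ)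
      (ι := Fin k)).contDiff.contDiffAt.comp x hη
  exact ((ContinuousMultilinearMap.apply ℝ (fun _ : Fin k => E7) ℝ v).contDiff.contDiffAt).comp x
    (h1.clm_apply h2)

variable [IsManifold (𝓡 7) ∞ M]

/-- Factoring `Ψ` through a chart turns `pull` into a pullback between open subsets of `ℝ⁷`, where
naturality of the exterior derivative can be used (`pull_closed`). -/
theorem eventually_pull_eq {k : ℕ} (η : ∀ p : M, TangentSpace (𝓡 7) p [⋀^Fin k]→L[ℝ] ℝ)
    {Ψ : E7 → M} {x : E7} (hΨ : ContMDiffAt 𝓘(ℝ, E7) (𝓡 7) ∞ Ψ x) (x₀ : M)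
    (hx₀ : Ψ x ∈ (chartAt E7 x₀).source) :
    ∀ᶠ y in 𝓝 x, pull η Ψ y = (formInChart η x₀ (extChartAt (𝓡 7) x₀ (Ψ y))).compContinuousLinearMap
      (fderiv ℝ (fun z => extChartAt (𝓡 7) x₀ (Ψ z)) y) := by
  have hsrc : (extChartAt (𝓡 7) x₀).source ∈ 𝓝 (Ψ x) :=
    (isOpen_extChartAt_source x₀).mem_nhds (by rwa [extChartAt_source])
  filter_upwards [contMDiffAt_iff_contMDiffAt_nhds (by simp) |>.1 (hΨ.of_le (m := 1) (by simp)),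
    (hΨ.continuousAt.eventually hsrc).eventually_nhds] with y hy1 hy2
  have hd : MDifferentiableAt 𝓘(ℝ, E7) (𝓡 7) Ψ y := hy1.mdifferentiableAt one_ne_zero
  have hys : Ψ y ∈ (extChartAt (𝓡 7) x₀).source := hy2.self_of_nhds
  have hyt := (extChartAt (𝓡 7) x₀).map_source hys
  have hc : MDifferentiableAt (𝓡 7) 𝓘(ℝ, E7) (extChartAt (𝓡 7) x₀) (Ψ y) :=
    mdifferentiableAt_extChartAt (by rwa [extChartAt_source] at hys)
  have hf : MDifferentiableAt 𝓘(ℝ, E7) 𝓘(ℝ, E7) (fun z => extChartAt (𝓡 7) x₀ (Ψ z)) y :=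
    hc.comp y hd
  have hι : MDifferentiableAt 𝓘(ℝ, E7) (𝓡 7) (extChartAt (𝓡 7) x₀).symm
      (extChartAt (𝓡 7) x₀ (Ψ y)) := by
    have := mdifferentiableWithinAt_extChartAt_symm (I := 𝓡 7) hyt
    simpa [mdifferentiableWithinAt_univ] using this
  have heq : Ψ =ᶠ[𝓝 y] (extChartAt (𝓡 7) x₀).symm ∘ (fun z => extChartAt (𝓡 7) x₀ (Ψ z)) := by
    filter_upwards [hy2] with z hz
    exact ((extChartAt (𝓡 7) x₀).left_inv hz).symm
  have hpt : (extChartAt (𝓡 7) x₀).symm (extChartAt (𝓡 7) x₀ (Ψ y)) = Ψ y :=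
    (extChartAt (𝓡 7) x₀).left_inv hys
  have hder : mfderiv 𝓘(ℝ, E7) (𝓡 7) Ψ y = (mfderiv 𝓘(ℝ, E7) (𝓡 7) (extChartAt (𝓡 7) x₀).symm
      (extChartAt (𝓡 7) x₀ (Ψ y))).comp (fderiv ℝ (fun z => extChartAt (𝓡 7) x₀ (Ψ z)) y) := by
    rw [heq.mfderiv_eq, mfderiv_comp y hι hf, mfderiv_eq_fderiv]
    rfl
  ext v
  rw [pull_apply, hder]
  simp only [formInChart, ContinuousAlternatingMap.compContinuousLinearMap_apply]
  rw [hpt]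
  rfl

theorem pull_closed {k : ℕ} {η : ∀ p : M, TangentSpace (𝓡 7) p [⋀^Fin k]→L[ℝ] ℝ}
    (hη : IsClosedForm η) {Ψ : E7 → M} {x : E7} (hΨ : ContMDiffAt 𝓘(ℝ, E7) (𝓡 7) ∞ Ψ x) :
    DifferentiableAt ℝ (pull η Ψ) x ∧ extDeriv (pull η Ψ) x = 0 ∧
      ∀ v, ContDiffAt ℝ ∞ (fun y => pull η Ψ y v) x := by
  set x₀ := Ψ x with hx₀
  set f : E7 → E7 := fun z => extChartAt (𝓡 7) x₀ (Ψ z) with hf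
  have heq : pull η Ψ =ᶠ[𝓝 x] fun y => (formInChart η x₀ (f y)).compContinuousLinearMap
    (fderiv ℝ f y) := eventually_pull_eq η hΨ x₀ (mem_chart_source E7 x₀)
  have hfs : ContDiffAt ℝ ∞ f x :=
    ((contMDiffAt_extChartAt (I := 𝓡 7) (x := x₀) (n := ∞)).comp x hΨ).contDiffAt
  have hft : f x ∈ (extChartAt (𝓡 7) x₀).target := mem_extChartAt_target x₀
  have hω : ContDiffAt ℝ ∞ (formInChart η x₀) (f x) :=
    (hη x₀).1.contDiffAt ((isOpen_extChartAt_target x₀).mem_nhds hft)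
  have hωd : DifferentiableAt ℝ (formInChart η x₀) (f x) := hω.differentiableAt (by simp)
  have hf' : ContDiffAt ℝ ∞ (fderiv ℝ f) x := hfs.fderiv_right (by simp)
  have hcomp : ContDiffAt ℝ ∞ (fun y => formInChart η x₀ (f y)) x := hω.comp x hfs
  refine ⟨?_, ?_, fun v => ?_⟩
  · refine DifferentiableAt.congr_of_eventuallyEq ?_ heq
    exact (hcomp.differentiableAt (by simp)).continuousAlternatingMapCompContinuousLinearMap
      (hf'.differentiableAt (by simp))
  · rw [heq.extDeriv_eq, extDeriv_pullback hωd hfs (by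
      simpa using (mod_cast le_top : ((2 : ℕ∞) : WithTop ℕ∞) ≤ ∞)), (hη x₀).2 _ hft]
    ext v; rfl
  · refine (contDiffAt_compContinuousLinearMap_apply hcomp hf' v).congr_of_eventuallyEq ?_
    filter_upwards [heq] with y hy
    rw [hy]

end Pullback

/-! ### The structure equations in toric coordinates and affinity of `V`. -/

section Coordinates

/-- The coordinate vector fields of `ℝ⁷`. -/
abbrev bv (a : Fin 7) : E7 := EuclideanSpace.single a 1

theorem pderiv_congr {f g : E7 → ℝ} {O : Set E7} (hO : IsOpen O) {x : E7} (hx : x ∈ O)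
    (h : ∀ y ∈ O, f y = g y) (a : Fin 7) : pderiv a f x = pderiv a g x := by
  have : f =ᶠ[𝓝 x] g := by
    filter_upwards [hO.mem_nhds hx] with y hy using h y hy
  rw [pderiv, pderiv, this.fderiv_eq]

theorem pderiv_add {f g : E7 → ℝ} {x : E7} (hf : DifferentiableAt ℝ f x)
    (hg : DifferentiableAt ℝ g x) (a : Fin 7) :
    pderiv a (fun y => f y + g y) x = pderiv a f x + pderiv a g x := by
  simp only [pderiv]; rw [fderiv_fun_add hf hg]; rfl

theorem pderiv_sub {f g : E7 → ℝ} {x : E7} (hf : DifferentiableAt ℝ f x)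
    (hg : DifferentiableAt ℝ g x) (a : Fin 7) :
    pderiv a (fun y => f y - g y) x = pderiv a f x - pderiv a g x := by
  simp only [pderiv]; rw [fderiv_fun_sub hf hg]; rfl

theorem pderiv_neg {f : E7 → ℝ} {x : E7} (a : Fin 7) :
    pderiv a (fun y => -f y) x = -pderiv a f x := by
  simp only [pderiv]; rw [fderiv_fun_neg]; rfl

theorem pderiv_const (c : ℝ) (x : E7) (a : Fin 7) : pderiv a (fun _ => c) x = 0 := by
  simp [pderiv]

theorem contDiffAt_pderiv {f : E7 → ℝ} {x : E7} (hf : ContDiffAt ℝ ∞ f x) (a : Fin 7) :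
    ContDiffAt ℝ ∞ (pderiv a f) x := by
  have h : ContDiffAt ℝ ∞ (fderiv ℝ f) x := hf.fderiv_right (by simp)
  exact h.clm_apply contDiffAt_const

theorem pderiv_comm {f : E7 → ℝ} {x : E7} (hf : ContDiffAt ℝ ∞ f x) (a b : Fin 7) :
    pderiv a (pderiv b f) x = pderiv b (pderiv a f) x := by
  have h : DifferentiableAt ℝ (fderiv ℝ f) x :=
    (hf.fderiv_right (m := ∞) (by simp)).differentiableAt (by simp)
  have key : ∀ a b, pderiv a (pderiv b f) x = fderiv ℝ (fderiv ℝ f) x (bv a) (bv b) := by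
    intro a b
    change fderiv ℝ (fun y => fderiv ℝ f y (bv b)) x (bv a) = _
    rw [fderiv_clm_apply h (differentiableAt_const _)]
    simp
  rw [key, key]
  exact (hf.isSymmSndFDerivAt (by
    simpa using (mod_cast le_top : ((2 : ℕ∞) : WithTop ℕ∞) ≤ ∞))).eq _ _

theorem eq_const_of_pderiv_eq_zero {f : E7 → ℝ} {O : Set E7} (hO : IsOpen O) (hc : Convex ℝ O)
    (hf : ∀ x ∈ O, DifferentiableAt ℝ f x) (h : ∀ x ∈ O, ∀ a, pderiv a f x = 0) :
    ∃ c, ∀ x ∈ O, f x = c := by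
  refine hO.exists_is_const_of_fderiv_eq_zero hc.isPreconnected
    (fun x hx => (hf x hx).differentiableWithinAt) fun x hx => ?_
  refine (EuclideanSpace.basisFun (Fin 7) ℝ).toBasis.ext (f₁ := (fderiv ℝ f x).toLinearMap)
    (f₂ := (0 : E7 →ₗ[ℝ] ℝ)) (fun a => ?_) |> fun h => ContinuousLinearMap.coe_injective h
  simpa [pderiv] using h x hx a

theorem extDeriv_three {Φ : E7 → E7 [⋀^Fin 3]→L[ℝ] ℝ} {x : E7} (hΦ : DifferentiableAt ℝ Φ x)
    (a b c d : Fin 7) : extDeriv Φ x ![bv a, bv b, bv c, bv d] =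
      pderiv a (fun y => Φ y ![bv b, bv c, bv d]) x - pderiv b (fun y => Φ y ![bv a, bv c, bv d]) x
      + pderiv c (fun y => Φ y ![bv a, bv b, bv d]) x
      - pderiv d (fun y => Φ y ![bv a, bv b, bv c]) x := by
  rw [extDeriv_apply hΦ, Fin.sum_univ_four]
  have e0 : (0 : Fin 4).removeNth ![bv a, bv b, bv c, bv d] = ![bv b, bv c, bv d] := by
    ext i; fin_cases i <;> rfl
  have e1 : (1 : Fin 4).removeNth ![bv a, bv b, bv c, bv d] = ![bv a, bv c, bv d] := by
    ext i; fin_cases i <;> rfl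
  have e2 : (2 : Fin 4).removeNth ![bv a, bv b, bv c, bv d] = ![bv a, bv b, bv d] := by
    ext i; fin_cases i <;> rfl
  have e3 : (3 : Fin 4).removeNth ![bv a, bv b, bv c, bv d] = ![bv a, bv b, bv c] := by
    ext i; fin_cases i <;> rfl
  rw [e0, e1, e2, e3]
  simp [pderiv]
  ring

theorem extDeriv_four {Φ : E7 → E7 [⋀^Fin 4]→L[ℝ] ℝ} {x : E7} (hΦ : DifferentiableAt ℝ Φ x)
    (a b c d e : Fin 7) : extDeriv Φ x ![bv a, bv b, bv c, bv d, bv e] =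
      pderiv a (fun y => Φ y ![bv b, bv c, bv d, bv e]) x
      - pderiv b (fun y => Φ y ![bv a, bv c, bv d, bv e]) x
      + pderiv c (fun y => Φ y ![bv a, bv b, bv d, bv e]) x
      - pderiv d (fun y => Φ y ![bv a, bv b, bv c, bv e]) x
      + pderiv e (fun y => Φ y ![bv a, bv b, bv c, bv d]) x := by
  rw [extDeriv_apply hΦ, Fin.sum_univ_five]
  have e0 : (0 : Fin 5).removeNth ![bv a, bv b, bv c, bv d, bv e] =
      ![bv b, bv c, bv d, bv e] := by ext i; fin_cases i <;> rfl
  have e1 : (1 : Fin 5).removeNth ![bv a, bv b, bv c, bv d, bv e] =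
      ![bv a, bv c, bv d, bv e] := by ext i; fin_cases i <;> rfl
  have e2 : (2 : Fin 5).removeNth ![bv a, bv b, bv c, bv d, bv e] =
      ![bv a, bv b, bv d, bv e] := by ext i; fin_cases i <;> rfl
  have e3 : (3 : Fin 5).removeNth ![bv a, bv b, bv c, bv d, bv e] =
      ![bv a, bv b, bv c, bv e] := by ext i; fin_cases i <;> rfl
  have e4 : (4 : Fin 5).removeNth ![bv a, bv b, bv c, bv d, bv e] =
      ![bv a, bv b, bv c, bv d] := by ext i; fin_cases i <;> rfl
  rw [e0, e1, e2, e3, e4]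
  simp [pderiv]
  ring

/-- The indices of the coordinates along the torus orbits. -/
def si : Fin 3 → Fin 7 := ![0, 1, 2]

/-- The indices of the coordinates `ν`. -/
def ni : Fin 3 → Fin 7 := ![3, 4, 5]

/-- The coefficients `Φ`, `Θ` of `φ`, `*φ` in coordinates in which the first three coordinate
vector fields generate the torus action, the other coordinates are the multi-moment maps, and `V`
depends only on the last one. The functions `t i a` are the coefficients of the connection
forms. -/
structure ToricCoordinates (O : Set E7) (Φ : E7 → E7 [⋀^Fin 3]→L[ℝ] ℝ)
    (Θ : E7 → E7 [⋀^Fin 4]→L[ℝ] ℝ) (t : Fin 3 → Fin 7 → E7 → ℝ)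
    (V W : Fin 3 → Fin 3 → E7 → ℝ) : Prop where
  isOpen : IsOpen O
  convex : Convex ℝ O
  differentiable_phi : ∀ x ∈ O, DifferentiableAt ℝ Φ x
  closed_phi : ∀ x ∈ O, extDeriv Φ x = 0
  smooth_phi : ∀ x ∈ O, ∀ v, ContDiffAt ℝ ∞ (fun y => Φ y v) x
  invariant_phi : ∀ x ∈ O, ∀ i v, pderiv (si i) (fun y => Φ y v) x = 0
  differentiable_psi : ∀ x ∈ O, DifferentiableAt ℝ Θ x
  closed_psi : ∀ x ∈ O, extDeriv Θ x = 0
  smooth_psi : ∀ x ∈ O, ∀ v, ContDiffAt ℝ ∞ (fun y => Θ y v) x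
  invariant_psi : ∀ x ∈ O, ∀ i v, pderiv (si i) (fun y => Θ y v) x = 0
  smooth_W : ∀ x ∈ O, ∀ i j, ContDiffAt ℝ ∞ (W i j) x
  pderiv_V : ∀ x ∈ O, ∀ i j a, a ≠ 6 → pderiv a (V i j) x = 0
  pderiv_W : ∀ x ∈ O, ∀ i j a, a ≠ 6 → pderiv a (W i j) x = 0
  t_si : ∀ x ∈ O, ∀ i j, t i (si j) x = if i = j then 1 else 0
  phi_mu : ∀ x ∈ O, ∀ i l, Φ x ![bv (si i), bv 6, bv (ni l)] =
    t (i + 1) 6 x * (if i + 2 = l then 1 else 0) - t (i + 2) 6 x * (if i + 1 = l then 1 else 0)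
      + W i l x
  phi_nu : ∀ x ∈ O, ∀ i l m, Φ x ![bv (si i), bv (ni l), bv (ni m)] =
    t (i + 1) (ni l) x * (if i + 2 = m then 1 else 0)
      - t (i + 1) (ni m) x * (if i + 2 = l then 1 else 0)
      - (t (i + 2) (ni l) x * (if i + 1 = m then 1 else 0)
      - t (i + 2) (ni m) x * (if i + 1 = l then 1 else 0))
  psi_mu : ∀ x ∈ O, ∀ i l, Θ x ![bv (si (i + 1)), bv (si (i + 2)), bv (ni l), bv 6] =
    t i (ni l) x
  psi_nu : ∀ x ∈ O, ∀ i m, Θ x ![bv (si (i + 1)), bv (si (i + 2)), bv (ni (m + 1)),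
    bv (ni (m + 2))] = -V i m x

namespace ToricCoordinates

variable {O : Set E7} {Φ : E7 → E7 [⋀^Fin 3]→L[ℝ] ℝ} {Θ : E7 → E7 [⋀^Fin 4]→L[ℝ] ℝ}
  {t : Fin 3 → Fin 7 → E7 → ℝ} {V W : Fin 3 → Fin 3 → E7 → ℝ}

theorem smooth_V (h : ToricCoordinates O Φ Θ t V W) {x : E7} (hx : x ∈ O) (i j : Fin 3) :
    ContDiffAt ℝ ∞ (V i j) x := by
  refine (h.smooth_psi x hx ![bv (si (i + 1)), bv (si (i + 2)), bv (ni (j + 1)),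
    bv (ni (j + 2))]).neg.congr_of_eventuallyEq ?_
  filter_upwards [h.isOpen.mem_nhds hx] with y hy
  rw [h.psi_nu y hy, neg_neg]

theorem smooth_t_nu (h : ToricCoordinates O Φ Θ t V W) {x : E7} (hx : x ∈ O) (i l : Fin 3) :
    ContDiffAt ℝ ∞ (t i (ni l)) x := by
  refine (h.smooth_psi x hx ![bv (si (i + 1)), bv (si (i + 2)), bv (ni l),
    bv 6]).congr_of_eventuallyEq ?_
  filter_upwards [h.isOpen.mem_nhds hx] with y hy
  rw [h.psi_mu y hy]

/-- The components of `Θ` in `psi_mu` only contain the `ν`-coefficients of the connection. The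
`μ`-coefficient has to be extracted from `Φ`, and these indices leave a single `t` in `phi_mu`. -/
theorem t_mu (h : ToricCoordinates O Φ Θ t V W) {x : E7} (hx : x ∈ O) (i : Fin 3) :
    t i 6 x = Φ x ![bv (si (i + 2)), bv 6, bv (ni (i + 1))] - W (i + 2) (i + 1) x := by
  rw [h.phi_mu x hx]
  fin_cases i <;> simp

theorem smooth_t_mu (h : ToricCoordinates O Φ Θ t V W) {x : E7} (hx : x ∈ O) (i : Fin 3) :
    ContDiffAt ℝ ∞ (t i 6) x := by
  refine ((h.smooth_phi x hx ![bv (si (i + 2)), bv 6, bv (ni (i + 1))]).sub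
    (h.smooth_W x hx (i + 2) (i + 1))).congr_of_eventuallyEq ?_
  filter_upwards [h.isOpen.mem_nhds hx] with y hy
  exact h.t_mu hy i

theorem pderiv_si_t_nu (h : ToricCoordinates O Φ Θ t V W) {x : E7} (hx : x ∈ O) (i j l : Fin 3) :
    pderiv (si j) (t i (ni l)) x = 0 := by
  rw [← pderiv_congr h.isOpen hx (fun y hy => h.psi_mu y hy i l)]
  exact h.invariant_psi x hx _ _

theorem pderiv_si_t_mu (h : ToricCoordinates O Φ Θ t V W) {x : E7} (hx : x ∈ O) (i j : Fin 3) :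
    pderiv (si j) (t i 6) x = 0 := by
  rw [pderiv_congr h.isOpen hx (fun y hy => h.t_mu hy i),
    pderiv_sub ((h.smooth_phi x hx _).differentiableAt (by simp))
      ((h.smooth_W x hx _ _).differentiableAt (by simp)), h.invariant_phi x hx,
    h.pderiv_W x hx _ _ _ (by fin_cases j <;> decide), sub_zero]

/-- The `ν`-components of the curvature of the connection forms. -/
theorem curvature_nu (h : ToricCoordinates O Φ Θ t V W) {x : E7} (hx : x ∈ O) (i r : Fin 3) :
    pderiv (ni (r + 1)) (t i (ni (r + 2))) x - pderiv (ni (r + 2)) (t i (ni (r + 1))) x =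
      pderiv 6 (V i r) x := by
  -- In `dΘ = 0` on two torus directions, two `ν`-directions and `μ`, the torus derivatives vanish
  -- by invariance; the other three terms are the two curvature terms and `∂V/∂μ`.
  have h1 := extDeriv_four (h.differentiable_psi x hx) (si (i + 1)) (si (i + 2)) (ni (r + 1))
    (ni (r + 2)) 6
  rw [h.closed_psi x hx, h.invariant_psi x hx, h.invariant_psi x hx,
    pderiv_congr h.isOpen hx (fun y hy => h.psi_mu y hy _ _),
    pderiv_congr h.isOpen hx (fun y hy => h.psi_mu y hy _ _),
    pderiv_congr h.isOpen hx (fun y hy => h.psi_nu y hy _ _), pderiv_neg] at h1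
  change (0 : ℝ) = _ at h1
  linarith

/-- Here the dependence on `μ` alone enters: the summand `W = adj V` of this component of `Φ` has no
`ν`-derivatives. -/
theorem pderiv_phi_mu (h : ToricCoordinates O Φ Θ t V W) {x : E7} (hx : x ∈ O) (i l m : Fin 3) :
    pderiv (ni m) (fun y => Φ y ![bv (si i), bv 6, bv (ni l)]) x =
      pderiv (ni m) (t (i + 1) 6) x * (if i + 2 = l then 1 else 0)
        - pderiv (ni m) (t (i + 2) 6) x * (if i + 1 = l then 1 else 0) := by
  have d1 := (h.smooth_t_mu hx (i + 1)).differentiableAt (by simp)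
  have d2 := (h.smooth_t_mu hx (i + 2)).differentiableAt (by simp)
  have d3 := (h.smooth_W x hx i l).differentiableAt (by simp)
  have e : ∀ j, DifferentiableAt ℝ (t j 6) x → ∀ c : ℝ,
      pderiv (ni m) (fun y => t j 6 y * c) x = pderiv (ni m) (t j 6) x * c := by
    intro j hj c
    simp only [pderiv]; rw [fderiv_mul_const hj]; simp [mul_comm]
  rw [pderiv_congr h.isOpen hx (fun y hy => h.phi_mu y hy i l),
    pderiv_add ((d1.mul_const _).fun_sub (d2.mul_const _)) d3,
    pderiv_sub (d1.mul_const _) (d2.mul_const _), e _ d1, e _ d2,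
    h.pderiv_W x hx _ _ _ (by fin_cases m <;> decide), add_zero]

/-- The mixed components of the curvature of the connection forms vanish. -/
theorem curvature_mu (h : ToricCoordinates O Φ Θ t V W) {x : E7} (hx : x ∈ O) (i l : Fin 3) :
    pderiv (ni l) (t i 6) x = pderiv 6 (t i (ni l)) x := by
  -- The equation `dΦ = 0` on one torus direction, two `ν`-directions and `μ`. The cases in which
  -- `i` is one of `l`, `m` yield the off-diagonal identities `A1` and `A2`.
  have E : ∀ i l m, -pderiv (ni l) (fun y => Φ y ![bv (si i), bv 6, bv (ni m)]) x
      + pderiv (ni m) (fun y => Φ y ![bv (si i), bv 6, bv (ni l)]) x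
      + pderiv 6 (fun y => Φ y ![bv (si i), bv (ni l), bv (ni m)]) x = 0 := by
    intro i l m
    have h1 := extDeriv_three (h.differentiable_phi x hx) (si i) (ni l) (ni m) 6
    rw [h.closed_phi x hx, h.invariant_phi x hx,
      pderiv_congr h.isOpen hx (fun y _ => alt3_swap (Φ y) (bv (si i)) (bv 6) (bv (ni m))),
      pderiv_congr h.isOpen hx (fun y _ => alt3_swap (Φ y) (bv (si i)) (bv 6) (bv (ni l))),
      pderiv_neg, pderiv_neg] at h1
    change (0 : ℝ) = _ at h1
    linarith
  have T1 : ∀ i, pderiv 6 (fun y => Φ y ![bv (si i), bv (ni i), bv (ni (i + 1))]) x =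
      -pderiv 6 (t (i + 2) (ni i)) x := by
    intro i
    rw [← pderiv_neg]
    refine pderiv_congr h.isOpen hx (fun y hy => ?_) 6
    rw [h.phi_nu y hy]; fin_cases i <;> simp
  have T2 : ∀ i, pderiv 6 (fun y => Φ y ![bv (si i), bv (ni i), bv (ni (i + 2))]) x =
      pderiv 6 (t (i + 1) (ni i)) x := by
    intro i
    refine pderiv_congr h.isOpen hx (fun y hy => ?_) 6
    rw [h.phi_nu y hy]; fin_cases i <;> simp
  have T3 : ∀ i, pderiv 6 (fun y => Φ y ![bv (si i), bv (ni (i + 1)), bv (ni (i + 2))]) x =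
      pderiv 6 (t (i + 1) (ni (i + 1))) x + pderiv 6 (t (i + 2) (ni (i + 2))) x := by
    intro i
    rw [← pderiv_add ((h.smooth_t_nu hx _ _).differentiableAt (by simp))
      ((h.smooth_t_nu hx _ _).differentiableAt (by simp))]
    refine pderiv_congr h.isOpen hx (fun y hy => ?_) 6
    rw [h.phi_nu y hy]; fin_cases i <;> simp
  have A1 : ∀ i, pderiv (ni i) (t (i + 2) 6) x = pderiv 6 (t (i + 2) (ni i)) x := by
    intro i
    have := E i i (i + 1)
    rw [T1, h.pderiv_phi_mu hx, h.pderiv_phi_mu hx] at this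
    fin_cases i <;> simp at this ⊢ <;> linarith
  have A2 : ∀ i, pderiv (ni i) (t (i + 1) 6) x = pderiv 6 (t (i + 1) (ni i)) x := by
    intro i
    have := E i i (i + 2)
    rw [T2, h.pderiv_phi_mu hx, h.pderiv_phi_mu hx] at this
    fin_cases i <;> simp at this ⊢ <;> linarith
  have A3 : ∀ i, pderiv (ni (i + 1)) (t (i + 1) 6) x + pderiv (ni (i + 2)) (t (i + 2) 6) x =
      pderiv 6 (t (i + 1) (ni (i + 1))) x + pderiv 6 (t (i + 2) (ni (i + 2))) x := by
    intro i
    have := E i (i + 1) (i + 2)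
    rw [T3, h.pderiv_phi_mu hx, h.pderiv_phi_mu hx] at this
    fin_cases i <;> simp at this ⊢ <;> linarith
  -- For the diagonal identities only the pairwise sums are known. Three quantities whose pairwise
  -- sums vanish are zero.
  have h0 := A3 0
  have h1 := A3 1
  have h2 := A3 2
  simp only [show (1 : Fin 3) + 1 = 2 from rfl, show (1 : Fin 3) + 2 = 0 from rfl,
    show (2 : Fin 3) + 1 = 0 from rfl, show (2 : Fin 3) + 2 = 1 from rfl, zero_add] at h0 h1 h2
  fin_cases i <;> fin_cases l
  · simp; linarith
  · exact A1 1
  · exact A2 2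
  · exact A2 0
  · simp; linarith
  · exact A1 2
  · exact A1 0
  · exact A2 1
  · simp; linarith

/-- This is `d(dθ_i) = 0`. Differentiate `curvature_nu` in `μ` and exchange `∂_μ t_ν` for `∂_ν t_μ`
by `curvature_mu`; the two remaining mixed second derivatives of `t i 6` cancel. -/
theorem pderiv_pderiv_V (h : ToricCoordinates O Φ Θ t V W) {x : E7} (hx : x ∈ O) (i r : Fin 3) :
    pderiv 6 (pderiv 6 (V i r)) x = 0 := by
  have d : ∀ a b : Fin 3, DifferentiableAt ℝ (pderiv (ni a) (t i (ni b))) x := fun a b =>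
    (contDiffAt_pderiv (h.smooth_t_nu hx i b) _).differentiableAt (by simp)
  have e : ∀ a b : Fin 3, pderiv 6 (pderiv (ni a) (t i (ni b))) x =
      pderiv (ni a) (pderiv (ni b) (t i 6)) x := by
    intro a b
    rw [pderiv_comm (h.smooth_t_nu hx i b)]
    exact (pderiv_congr h.isOpen hx (fun y hy => h.curvature_mu hy i b) _).symm
  rw [← pderiv_congr h.isOpen hx (fun y hy => h.curvature_nu hy i r), pderiv_sub (d _ _) (d _ _),
    e, e, pderiv_comm (h.smooth_t_mu hx i), sub_self]

/-- `V` is an affine function of `μ`. -/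
theorem exists_affine (h : ToricCoordinates O Φ Θ t V W) :
    ∃ A C : Matrix (Fin 3) (Fin 3) ℝ, ∀ x ∈ O, ∀ i j,
      V i j x = A i j + x 6 * C i j ∧ pderiv 6 (V i j) x = C i j := by
  have h1 : ∀ i j, ∃ c, ∀ x ∈ O, pderiv 6 (V i j) x = c := by
    intro i j
    refine eq_const_of_pderiv_eq_zero h.isOpen h.convex
      (fun x hx => (contDiffAt_pderiv (h.smooth_V hx i j) _).differentiableAt (by simp))
      fun x hx a => ?_
    rcases eq_or_ne a 6 with rfl | ha
    · exact h.pderiv_pderiv_V hx i j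
    · rw [pderiv_comm (h.smooth_V hx i j),
        pderiv_congr h.isOpen hx (fun y hy => h.pderiv_V y hy i j a ha), pderiv_const]
  choose C hC using h1
  have h2 : ∀ i j, ∃ c, ∀ x ∈ O, V i j x - x 6 * C i j = c := by
    intro i j
    have hx6 : ∀ (x : E7) (a : Fin 7), pderiv a (fun y => y 6 * C i j) x =
        (if a = 6 then 1 else 0) * C i j := by
      intro x a
      have : HasFDerivAt (fun y : E7 => y 6 * C i j)
          (C i j • (EuclideanSpace.proj (6 : Fin 7) : E7 →L[ℝ] ℝ)) x :=
        ((EuclideanSpace.proj (6 : Fin 7) : E7 →L[ℝ] ℝ).hasFDerivAt).mul_const _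
      rw [pderiv, this.fderiv]
      rcases eq_or_ne a 6 with rfl | ha
      · simp
      · simp [ha, ha.symm]
    have hd : ∀ x : E7, DifferentiableAt ℝ (fun y : E7 => y 6 * C i j) x := by
      intro x
      exact ((EuclideanSpace.proj (6 : Fin 7) : E7 →L[ℝ] ℝ).differentiableAt).mul_const _
    refine eq_const_of_pderiv_eq_zero h.isOpen h.convex
      (fun x hx => ((h.smooth_V hx i j).differentiableAt (by simp)).sub (hd x)) fun x hx a => ?_
    rw [pderiv_sub ((h.smooth_V hx i j).differentiableAt (by simp)) (hd x), hx6]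
    rcases eq_or_ne a 6 with rfl | ha
    · simp [hC i j x hx]
    · simp [ha, h.pderiv_V x hx i j a ha]
  choose A hA using h2
  exact ⟨A, C, fun x hx i j => ⟨by linarith [hA i j x hx], hC i j x hx⟩⟩

theorem smooth_t (h : ToricCoordinates O Φ Θ t V W) {x : E7} (hx : x ∈ O) (i : Fin 3)
    (a : Fin 7) : ContDiffAt ℝ ∞ (t i a) x := by
  have hs : ∀ j, ContDiffAt ℝ ∞ (t i (si j)) x := fun j => by
    refine (contDiffAt_const (c := if i = j then (1 : ℝ) else 0)).congr_of_eventuallyEq ?_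
    filter_upwards [h.isOpen.mem_nhds hx] with y hy using h.t_si y hy i j
  fin_cases a
  exacts [hs 0, hs 1, hs 2, h.smooth_t_nu hx i 0, h.smooth_t_nu hx i 1, h.smooth_t_nu hx i 2,
    h.smooth_t_mu hx i]

/-- If `V` is constant, then the connection forms are closed. -/
theorem pderiv_t_symm (h : ToricCoordinates O Φ Θ t V W)
    (hV : ∀ x ∈ O, ∀ i j, pderiv 6 (V i j) x = 0) {x : E7} (hx : x ∈ O) (i : Fin 3)
    (a b : Fin 7) : pderiv a (t i b) x = pderiv b (t i a) x := by
  have hs : ∀ j a, pderiv a (t i (si j)) x = 0 := fun j a => by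
    rw [pderiv_congr h.isOpen hx (fun y hy => h.t_si y hy i j), pderiv_const]
  have hn : ∀ r, pderiv (ni (r + 1)) (t i (ni (r + 2))) x =
      pderiv (ni (r + 2)) (t i (ni (r + 1))) x := fun r => by
    linarith [h.curvature_nu hx i r, hV x hx i r]
  have hsn := h.pderiv_si_t_nu hx i
  have hsm := h.pderiv_si_t_mu hx i
  have hm := h.curvature_mu hx i
  have key : ∀ a b : Fin 7, a < b → pderiv a (t i b) x = pderiv b (t i a) x := by
    intro a b hab
    have s0 := hs 0 b
    have s1 := hs 1 b
    have s2 := hs 2 b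
    have s3 := hs 0 a
    have s4 := hs 1 a
    have s5 := hs 2 a
    have n0 := hn 0
    have n1 := hn 1
    have n2 := hn 2
    have m0 := hm 0
    have m1 := hm 1
    have m2 := hm 2
    have p0 := fun j => hsn 0 j
    have p1 := fun j => hsn 1 j
    have p2 := fun j => hsn 2 j
    have q0 := hsm 0
    have q1 := hsm 1
    have q2 := hsm 2
    rw [Fin.forall_fin_succ, Fin.forall_fin_succ, Fin.forall_fin_succ] at p0 p1 p2
    simp only [si, ni] at *
    fin_cases a <;> fin_cases b <;> simp at hab s0 s1 s2 s3 s4 s5 n0 n1 n2 m0 m1 m2 p0 p1 p2 q0 q1 q2 ⊢ <;>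
      simp_all
  rcases lt_trichotomy a b with hab | rfl | hab
  · exact key a b hab
  · rfl
  · exact (key b a hab).symm

end ToricCoordinates

end Coordinates

/-! ### The metric in parametrizations. -/

section Pullback

variable {M : Type*} [TopologicalSpace M] [ChartedSpace E7 M]
  {φ : ∀ p : M, TangentSpace (𝓡 7) p [⋀^Fin 3]→L[ℝ] ℝ}

theorem pull_three (φ : ∀ p : M, TangentSpace (𝓡 7) p [⋀^Fin 3]→L[ℝ] ℝ) (Ψ : E7 → M)
    (x u v w : E7) : pull φ Ψ x ![u, v, w] = φ (Ψ x) ![mfderiv 𝓘(ℝ, E7) (𝓡 7) Ψ x u,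
      mfderiv 𝓘(ℝ, E7) (𝓡 7) Ψ x v, mfderiv 𝓘(ℝ, E7) (𝓡 7) Ψ x w] := by
  rw [pull_apply]; congr 1; ext i; fin_cases i <;> rfl

theorem pull_four (η : ∀ p : M, TangentSpace (𝓡 7) p [⋀^Fin 4]→L[ℝ] ℝ) (Ψ : E7 → M)
    (x u v w z : E7) : pull η Ψ x ![u, v, w, z] = η (Ψ x) ![mfderiv 𝓘(ℝ, E7) (𝓡 7) Ψ x u,
      mfderiv 𝓘(ℝ, E7) (𝓡 7) Ψ x v, mfderiv 𝓘(ℝ, E7) (𝓡 7) Ψ x w,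
      mfderiv 𝓘(ℝ, E7) (𝓡 7) Ψ x z] := by
  rw [pull_apply]; congr 1; ext i; fin_cases i <;> rfl

theorem exists_adapted_pull (hφ : ∀ p, ∃ L : E7 ≃L[ℝ] TangentSpace (𝓡 7) p, IsAdapted (φ p) L)
    {Ψ : E7 → M} {x : E7} (hb : Function.Bijective (mfderiv 𝓘(ℝ, E7) (𝓡 7) Ψ x)) :
    ∃ L : E7 ≃L[ℝ] E7, IsAdapted (pull φ Ψ x) L := by
  obtain ⟨L, hL⟩ := hφ (Ψ x)
  let D : E7 →L[ℝ] E7 := mfderiv 𝓘(ℝ, E7) (𝓡 7) Ψ x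
  let A : E7 ≃L[ℝ] E7 := (LinearEquiv.ofBijective D.toLinearMap hb).toContinuousLinearEquiv
  let L' : E7 ≃L[ℝ] E7 := L
  refine ⟨L'.trans A.symm, ?_⟩
  rw [IsAdapted, ← hL]
  ext v
  simp only [ContinuousAlternatingMap.compContinuousLinearMap_apply, pull_apply]
  congr 1
  ext i : 1
  simp only [Function.comp_apply]
  exact A.apply_symm_apply (L (v i))

theorem innerOf_pull (hφ : ∀ p, ∃ L : E7 ≃L[ℝ] TangentSpace (𝓡 7) p, IsAdapted (φ p) L)
    {Ψ : E7 → M} {x : E7} (hb : Function.Bijective (mfderiv 𝓘(ℝ, E7) (𝓡 7) Ψ x)) (u v : E7) :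
    innerOf (pull φ Ψ x) u v = metric φ (Ψ x) (mfderiv 𝓘(ℝ, E7) (𝓡 7) Ψ x u)
      (mfderiv 𝓘(ℝ, E7) (𝓡 7) Ψ x v) :=
  ((innerOf_dualOf_map (exists_adapted_pull hφ hb) (hφ (Ψ x))
    (mfderiv 𝓘(ℝ, E7) (𝓡 7) Ψ x).toLinearMap hb
    fun u v w => (pull_three φ Ψ x u v w).symm).1 u v).symm

theorem exists_adapted_coordinates_at
    (hφ : ∀ p, ∃ L : E7 ≃L[ℝ] TangentSpace (𝓡 7) p, IsAdapted (φ p) L) (p : M) :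
    ∃ K : TangentSpace (𝓡 7) p ≃L[ℝ] E7, (∀ u v w, φ p ![u, v, w] = phi0 ![K u, K v, K w]) ∧
      (∀ u v, metric φ p u v = inner ℝ (K u) (K v)) ∧
      ∀ u v w z, dual φ p ![u, v, w, z] = psi0 ![K u, K v, K w, K z] :=
  exists_adapted_coordinates (hφ p)

theorem continuousOn_innerOf_fields {X : Type*} [TopologicalSpace X]
    {Φ : X → E7 [⋀^Fin 3]→L[ℝ] ℝ} {s : Set X} (hΦ : ContinuousOn Φ s)
    (h : ∀ x ∈ s, ∃ L : E7 ≃L[ℝ] E7, IsAdapted (Φ x) L) {u v : X → E7} (hu : ContinuousOn u s)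
    (hv : ContinuousOn v s) : ContinuousOn (fun x => innerOf (Φ x) (u x) (v x)) s := by
  have key : ContinuousOn (fun x => ∑ a, ∑ b, u x a * v x b * innerOf (Φ x) (bv a) (bv b)) s := by
    refine continuousOn_finsetSum _ fun a _ => continuousOn_finsetSum _ fun b _ => ?_
    have hc : ∀ c : Fin 7, Continuous fun z : E7 => z c := fun c =>
      (EuclideanSpace.proj c : E7 →L[ℝ] ℝ).continuous
    exact (((hc a).comp_continuousOn hu).mul ((hc b).comp_continuousOn hv)).mul
      (continuousOn_innerOf hΦ h _ _)
  refine key.congr fun x hx => ?_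
  obtain ⟨K, -, h2, -⟩ := exists_adapted_coordinates (h x hx)
  have hexp : ∀ z : E7, z = ∑ k, z k • bv k := by
    intro z; ext j; simp [Pi.single_apply]
  simp only [h2]
  conv_lhs => rw [hexp (u x), hexp (v x)]
  simp only [map_sum, sum_inner, inner_sum, map_smul, inner_smul_left, inner_smul_right]
  simp only [Finset.mul_sum]
  rw [Finset.sum_comm]
  refine Finset.sum_congr rfl fun a _ => Finset.sum_congr rfl fun b _ => ?_
  simp only [RCLike.conj_to_real]; ring

variable [IsManifold (𝓡 7) ∞ M]

theorem contMDiffAt_extChartAt_symm (x₀ : M) {y : E7} (hy : y ∈ (extChartAt (𝓡 7) x₀).target) :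
    ContMDiffAt 𝓘(ℝ, E7) (𝓡 7) ∞ (extChartAt (𝓡 7) x₀).symm y :=
  (contMDiffOn_extChartAt_symm x₀).contMDiffAt ((isOpen_extChartAt_target x₀).mem_nhds hy)

theorem mfderiv_extChartAt_symm_bijective (x₀ : M) {y : E7}
    (hy : y ∈ (extChartAt (𝓡 7) x₀).target) :
    Function.Bijective (mfderiv 𝓘(ℝ, E7) (𝓡 7) (extChartAt (𝓡 7) x₀).symm y) := by
  have h := isInvertible_mfderivWithin_extChartAt_symm (I := 𝓡 7) (x := x₀) hy
  rw [ModelWithCorners.range_eq_univ, mfderivWithin_univ] at h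
  obtain ⟨e, he⟩ := h
  rw [← he]
  exact e.bijective

theorem mfderiv_extChartAt_bijective (x₀ : M) {q : M}
    (hq : q ∈ (extChartAt (𝓡 7) x₀).source) :
    Function.Bijective (mfderiv (𝓡 7) 𝓘(ℝ, E7) (extChartAt (𝓡 7) x₀) q) := by
  obtain ⟨e, he⟩ := isInvertible_mfderiv_extChartAt (I := 𝓡 7) (x := x₀) hq
  rw [← he]
  exact e.bijective

end Pullback

/-- The universal covering `ℝ³ → T³`. -/
def expT (s : Fin 3 → ℝ) : T3 := fun j => Circle.exp (s j)

theorem expT_add (s s' : Fin 3 → ℝ) : expT (s + s') = expT s * expT s' := by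
  ext j; simp [expT, Circle.exp_add]

theorem expT_zero : expT 0 = 1 := by
  ext j; simp [expT]

theorem expT_single (i : Fin 3) (t : ℝ) :
    (Pi.mulSingle i (Circle.exp t) : T3) = expT (t • Pi.single i 1) := by
  ext j
  rcases eq_or_ne j i with rfl | hj
  · simp [expT]
  · simp [expT, hj]

theorem expT_surjective : Function.Surjective expT := fun t =>
  ⟨fun j => Complex.arg (t j), funext fun j => Circle.exp_arg (t j)⟩

/-! ### Generators of the torus action, the matrix `B` and the regular set. -/

section Action

variable {M : Type*} [TopologicalSpace M] [ChartedSpace E7 M]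
  [MulAction T3 M] {φ : ∀ p : M, TangentSpace (𝓡 7) p [⋀^Fin 3]→L[ℝ] ℝ}
  {ν : M → Fin 3 → ℝ} {μ : M → ℝ}

namespace IsToricG2Manifold

theorem contMDiffAt_expT_smul (h : IsToricG2Manifold φ ν μ) {E : Type*} [NormedAddCommGroup E]
    [NormedSpace ℝ E] {f : E → Fin 3 → ℝ} {Ψ : E → M} {z : E} (hf : ContDiffAt ℝ ∞ f z)
    (hΨ : ContMDiffAt 𝓘(ℝ, E) (𝓡 7) ∞ Ψ z) :
    ContMDiffAt 𝓘(ℝ, E) (𝓡 7) ∞ (fun y => expT (f y) • Ψ y) z :=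
  (h.smooth_action.contMDiffAt (x := (f z, Ψ z))).comp z (hf.contMDiffAt.prodMk hΨ)

theorem contMDiff_smul (h : IsToricG2Manifold φ ν μ) (t : T3) :
    ContMDiff (𝓡 7) (𝓡 7) ∞ (fun q : M => t • q) := by
  obtain ⟨s, rfl⟩ := expT_surjective t
  exact h.smooth_action.comp ((contMDiff_const (c := s)).prodMk contMDiff_id)

theorem mdifferentiableAt_smul (h : IsToricG2Manifold φ ν μ) (t : T3) (q : M) :
    MDifferentiableAt (𝓡 7) (𝓡 7) (fun q : M => t • q) q :=
  (h.contMDiff_smul t q).mdifferentiableAt (by simp)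

/-- The fundamental vector fields are the velocities of curves `exp(f(τ)) • p`. -/
theorem hasMFDerivAt_orbit (h : IsToricG2Manifold φ ν μ) (i : Fin 3) (p : M) :
    HasMFDerivAt 𝓘(ℝ, ℝ) (𝓡 7) (fun τ : ℝ => expT (τ • Pi.single i 1) • p) 0
      (mfderiv 𝓘(ℝ, ℝ) (𝓡 7) (fun τ : ℝ => expT (τ • Pi.single i 1) • p) 0) := by
  have : ContMDiffAt 𝓘(ℝ, ℝ) (𝓡 7) ∞ (fun τ : ℝ => expT (τ • Pi.single i 1) • p) 0 :=
    h.contMDiffAt_expT_smul (by fun_prop) contMDiffAt_const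
  exact (this.mdifferentiableAt (by simp)).hasMFDerivAt

theorem _root_.ToricG2.gen_eq (i : Fin 3) (p : M) : gen i p =
    mfderiv 𝓘(ℝ, ℝ) (𝓡 7) (fun τ : ℝ => expT (τ • Pi.single i 1) • p) 0 (1 : ℝ) := by
  have h : (fun t : ℝ => (Pi.mulSingle i (Circle.exp t) : T3) • p) =
      fun τ : ℝ => expT (τ • Pi.single i 1) • p := funext fun t => by rw [expT_single]
  exact congrArg (fun f : ℝ → M => (mfderiv 𝓘(ℝ, ℝ) (𝓡 7) f 0 (1 : ℝ) : E7)) h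

theorem mfderiv_gen_eq_zero (h : IsToricG2Manifold φ ν μ) {f : M → ℝ}
    (hf : ContMDiff (𝓡 7) 𝓘(ℝ, ℝ) ∞ f) (hinv : ∀ (t : T3) p, f (t • p) = f p) (i : Fin 3) (p : M) :
    (mfderiv (𝓡 7) 𝓘(ℝ, ℝ) f p (gen i p) : ℝ) = 0 := by
  have h0 : expT ((0 : ℝ) • Pi.single i 1) • p = p := by rw [zero_smul, expT_zero, one_smul]
  have h1 := h.hasMFDerivAt_orbit i p
  have h2 : HasMFDerivAt (𝓡 7) 𝓘(ℝ, ℝ) f (expT ((0 : ℝ) • Pi.single i 1) • p)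
      (mfderiv (𝓡 7) 𝓘(ℝ, ℝ) f (expT ((0 : ℝ) • Pi.single i 1) • p)) :=
    ((hf _).mdifferentiableAt (by simp)).hasMFDerivAt
  have h3 := (h2.comp (0 : ℝ) h1).mfderiv
  have h4 : f ∘ (fun τ : ℝ => expT (τ • Pi.single i 1) • p) = fun _ => f p := by
    ext τ; exact hinv _ _
  rw [h4, mfderiv_const, h0] at h3
  have h5 := DFunLike.congr_fun h3 (1 : ℝ)
  rw [gen_eq]
  exact h5.symm

/-- The value is a derivative of an invariant function along an orbit: `dν_2(U_2) = 0`, with indices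
counted from zero. -/
theorem phi_gen_eq_zero (h : IsToricG2Manifold φ ν μ) (p : M) :
    φ p ![gen 0 p, gen 1 p, gen 2 p] = 0 := by
  have := h.deriv_nu 2 p (gen 2 p)
  rw [h.mfderiv_gen_eq_zero (h.smooth_nu 2) (fun t p => by rw [h.invariant_nu])] at this
  exact this.symm

/-- A frame at `p` in which the `G₂`-structure is standard, together with the description of the
generators and the differentials of the multi-moment maps in it. -/
theorem exists_adapted_frame (h : IsToricG2Manifold φ ν μ) (p : M) :
    ∃ K : TangentSpace (𝓡 7) p ≃L[ℝ] E7, (∀ u v w, φ p ![u, v, w] = phi0 ![K u, K v, K w]) ∧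
      (∀ u v, metric φ p u v = inner ℝ (K u) (K v)) ∧
      (∀ u v w z, dual φ p ![u, v, w, z] = psi0 ![K u, K v, K w, K z]) ∧
      IsIsotropicTriple (K (gen 0 p)) (K (gen 1 p)) (K (gen 2 p)) ∧
      (∀ i v, (mfderiv (𝓡 7) 𝓘(ℝ, ℝ) (fun q => ν q i) p v : ℝ) =
        inner ℝ (cross (K (gen (i + 1) p)) (K (gen (i + 2) p))) (K v)) ∧
      ∀ v, (mfderiv (𝓡 7) 𝓘(ℝ, ℝ) μ p v : ℝ) =
        inner ℝ (chi (K (gen 0 p)) (K (gen 1 p)) (K (gen 2 p))) (K v) := by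
  obtain ⟨K, h1, h2, h3⟩ := exists_adapted_coordinates_at h.adapted p
  refine ⟨K, h1, h2, h3, ⟨by rw [← h1, h.phi_gen_eq_zero]⟩, fun i v => ?_, fun v => ?_⟩
  · rw [h.deriv_nu, h1, inner_cross]
  · rw [h.deriv_mu, h3, inner_chi]

theorem matB_eq_gram {p : M} {K : TangentSpace (𝓡 7) p ≃L[ℝ] E7}
    (hK : ∀ u v, metric φ p u v = inner ℝ (K u) (K v)) :
    matB φ p = Matrix.gram ℝ fun i : Fin 3 => K (gen i p) := by
  ext i j; simp [matB, hK, Matrix.gram]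

theorem det_matB {p : M} {K : TangentSpace (𝓡 7) p ≃L[ℝ] E7}
    (hK : ∀ u v, metric φ p u v = inner ℝ (K u) (K v)) :
    (matB φ p).det = gram3 (K (gen 0 p)) (K (gen 1 p)) (K (gen 2 p)) := by
  rw [matB_eq_gram hK, Matrix.det_fin_three, gram3]
  simp only [Matrix.gram_apply, real_inner_comm (K (gen 0 p)), real_inner_comm (K (gen 2 p)) (K (gen 1 p))]
  ring

theorem linearIndependent_comp {p : M} (K : TangentSpace (𝓡 7) p ≃L[ℝ] E7) :
    LinearIndependent ℝ (fun i : Fin 3 => K (gen i p)) ↔ p ∈ regularSet M :=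
  LinearMap.linearIndependent_iff (K : TangentSpace (𝓡 7) p →ₗ[ℝ] E7)
    (LinearMap.ker_eq_bot.2 K.injective)

theorem posDef_matB (h : IsToricG2Manifold φ ν μ) {p : M} (hp : p ∈ regularSet M) :
    (matB φ p).PosDef := by
  obtain ⟨K, -, hK, -⟩ := h.exists_adapted_frame p
  rw [matB_eq_gram hK]
  exact Matrix.posDef_gram_of_linearIndependent ((linearIndependent_comp K).2 hp)

theorem posDef_matV (h : IsToricG2Manifold φ ν μ) {p : M} (hp : p ∈ regularSet M) :
    (matV φ p).PosDef :=
  (h.posDef_matB hp).inv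

theorem mem_regularSet_iff (h : IsToricG2Manifold φ ν μ) {p : M} :
    p ∈ regularSet M ↔ (matB φ p).det ≠ 0 := by
  refine ⟨fun hp => (h.posDef_matB hp).det_pos.ne', fun hp => ?_⟩
  obtain ⟨K, -, hK, -⟩ := h.exists_adapted_frame p
  rw [matB_eq_gram hK] at hp
  exact (linearIndependent_comp K).1 (Matrix.linearIndependent_of_det_gram_ne_zero hp)

variable [IsManifold (𝓡 7) ∞ M]

/-- The generators in a chart are continuous vector fields. -/
theorem exists_coord_gen (h : IsToricG2Manifold φ ν μ) (x₀ : M) (i : Fin 3) :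
    ∃ X : E7 → E7, ContinuousOn X (extChartAt (𝓡 7) x₀).target ∧
      ∀ y ∈ (extChartAt (𝓡 7) x₀).target,
        mfderiv 𝓘(ℝ, E7) (𝓡 7) (extChartAt (𝓡 7) x₀).symm y (X y) =
          gen i ((extChartAt (𝓡 7) x₀).symm y) := by
  set c := extChartAt (𝓡 7) x₀ with hc
  -- `P` is the circle action read from a chart and `G` its coordinate expression. The required
  -- field is the time derivative of `G` at time zero.
  set P : ℝ × E7 → M := fun z => expT (z.1 • Pi.single i 1) • c.symm z.2 with hP
  set G : ℝ × E7 → E7 := fun z => c (P z) with hG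
  have hP0 : ∀ y, P (0, y) = c.symm y := fun y => by
    simp only [hP, zero_smul, expT_zero, one_smul]
  have hPs : ∀ y ∈ c.target, ContMDiffAt 𝓘(ℝ, ℝ × E7) (𝓡 7) ∞ P (0, y) := fun y hy =>
    h.contMDiffAt_expT_smul (f := fun z : ℝ × E7 => z.1 • Pi.single i 1)
      (Ψ := fun z => c.symm z.2) (by fun_prop)
      (ContMDiffAt.comp (0, y) (contMDiffAt_extChartAt_symm x₀ hy)
        (contDiff_snd.contDiffAt.contMDiffAt))
  have hGs : ∀ y ∈ c.target, ContDiffAt ℝ ∞ G (0, y) := fun y hy => by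
    have hsrc : P (0, y) ∈ (chartAt E7 x₀).source := by
      rw [hP0, ← extChartAt_source (𝓡 7)]; exact c.map_target hy
    exact (ContMDiffAt.comp (0, y) (contMDiffAt_extChartAt' hsrc) (hPs y hy)).contDiffAt
  refine ⟨fun y => fderiv ℝ G (0, y) (1, 0), fun y hy => ?_, fun y hy => ?_⟩
  · have h1 : ContinuousAt (fderiv ℝ G) (0, y) :=
      ((hGs y hy).fderiv_right (m := ∞) (by simp)).continuousAt
    have h2 : ContinuousAt (fun y : E7 => ((0 : ℝ), y)) y := by fun_prop
    exact ((ContinuousAt.comp (f := fun y : E7 => ((0 : ℝ), y)) h1 h2).clm_apply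
      continuousAt_const).continuousWithinAt
  · have h1 : HasFDerivAt (fun τ : ℝ => G (τ, y))
        ((fderiv ℝ G (0, y)).comp (ContinuousLinearMap.inl ℝ ℝ E7)) 0 :=
      HasFDerivAt.comp (f := fun τ : ℝ => (τ, y)) (0 : ℝ) (((hGs y hy).differentiableAt (by simp)).hasFDerivAt)
        (hasFDerivAt_prodMk_left (𝕜 := ℝ) (0 : ℝ) y)
    have hG0 : G (0, y) = y := by simp only [hG, hP0]; exact c.right_inv hy
    have h2 : HasMFDerivAt 𝓘(ℝ, E7) (𝓡 7) c.symm (G (0, y))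
        (mfderiv 𝓘(ℝ, E7) (𝓡 7) c.symm (G (0, y))) := by
      rw [hG0]
      exact ((contMDiffAt_extChartAt_symm x₀ hy).mdifferentiableAt (by simp)).hasMFDerivAt
    have h3 := HasMFDerivAt.comp (0 : ℝ) (f := fun τ : ℝ => G (τ, y)) h2 h1.hasMFDerivAt
    have h4 : (c.symm ∘ fun τ : ℝ => G (τ, y)) =ᶠ[𝓝 0]
        fun τ : ℝ => expT (τ • Pi.single i 1) • c.symm y := by
      have h5 : ContinuousAt (fun τ : ℝ => P (τ, y)) 0 :=
        ContinuousAt.comp (f := fun τ : ℝ => (τ, y)) (hPs y hy).continuousAt (by fun_prop)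
      have h6 : c.source ∈ 𝓝 (P (0, y)) := by
        rw [hP0]; exact (isOpen_extChartAt_source x₀).mem_nhds (c.map_target hy)
      filter_upwards [h5 h6] with τ hτ
      exact c.left_inv hτ
    have h5 := h3.mfderiv
    rw [h4.mfderiv_eq, hG0] at h5
    rw [gen_eq]
    have h6 := DFunLike.congr_fun h5 (1 : ℝ)
    exact h6.symm

theorem continuous_matB (h : IsToricG2Manifold φ ν μ) (i j : Fin 3) :
    Continuous fun p => matB φ p i j := by
  refine continuous_iff_continuousAt.2 fun x₀ => ?_
  obtain ⟨X, hX, hX'⟩ := h.exists_coord_gen x₀ i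
  obtain ⟨Y, hY, hY'⟩ := h.exists_coord_gen x₀ j
  have h1 : ContinuousOn (fun y => innerOf (pull φ (extChartAt (𝓡 7) x₀).symm y) (X y) (Y y))
      (extChartAt (𝓡 7) x₀).target :=
    continuousOn_innerOf_fields (h.closed x₀).1.continuousOn
      (fun y hy => exists_adapted_pull h.adapted (mfderiv_extChartAt_symm_bijective x₀ hy)) hX hY
  have h2 := (h1.continuousAt ((isOpen_extChartAt_target x₀).mem_nhds
    (mem_extChartAt_target x₀))).comp (continuousAt_extChartAt (I := 𝓡 7) x₀)
  refine h2.congr ?_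
  filter_upwards [(isOpen_extChartAt_source (I := 𝓡 7) x₀).mem_nhds (mem_extChartAt_source x₀)]
    with q hq
  have hq' := (extChartAt (𝓡 7) x₀).map_source hq
  simp only [Function.comp_apply]
  rw [innerOf_pull h.adapted (mfderiv_extChartAt_symm_bijective x₀ hq'), hX' _ hq', hY' _ hq',
    (extChartAt (𝓡 7) x₀).left_inv hq]
  rfl

theorem continuous_det_matB (h : IsToricG2Manifold φ ν μ) :
    Continuous fun p => (matB φ p).det :=
  Continuous.matrix_det (continuous_matrix fun i j => h.continuous_matB i j)

theorem isOpen_regularSet (h : IsToricG2Manifold φ ν μ) : IsOpen (regularSet M) := by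
  have : regularSet M = {p | (matB φ p).det ≠ 0} := by ext p; exact h.mem_regularSet_iff
  rw [this]
  exact isOpen_ne_fun h.continuous_det_matB continuous_const

end IsToricG2Manifold

end Action

/-- The inverse function theorem for `C^∞` maps: a map with invertible derivative at a point is a
local diffeomorphism there. -/
theorem exists_smooth_openPartialHomeomorph {E F : Type*} [NormedAddCommGroup E] [NormedSpace ℝ E]
    [FiniteDimensional ℝ E] [NormedAddCommGroup F] [NormedSpace ℝ F] {f : E → F} {a : E}
    (hf : ∀ᶠ x in 𝓝 a, ContDiffAt ℝ ∞ f x) (hb : Function.Bijective (fderiv ℝ f a)) :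
    ∃ e : OpenPartialHomeomorph E F, a ∈ e.source ∧ (∀ x, e x = f x) ∧
      (∀ x ∈ e.source, ContDiffAt ℝ ∞ f x) ∧ ∀ y ∈ e.target, ContDiffAt ℝ ∞ e.symm y := by
  have : CompleteSpace E := FiniteDimensional.complete ℝ E
  let A : E ≃L[ℝ] F := (LinearEquiv.ofBijective (fderiv ℝ f a).toLinearMap hb).toContinuousLinearEquiv
  have hA : (A : E →L[ℝ] F) = fderiv ℝ f a := by ext v; rfl
  have hfa := hf.self_of_nhds
  have hd : HasFDerivAt f (A : E →L[ℝ] F) a := by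
    rw [hA]; exact (hfa.differentiableAt (by simp)).hasFDerivAt
  let e₀ := hfa.toOpenPartialHomeomorph f hd (by simp)
  -- Invertibility is an open condition; restricting to where it holds makes the inverse smooth on
  -- its whole domain and not just at one point.
  have hinv : ∀ᶠ x in 𝓝 a, ∃ B : E ≃L[ℝ] F, (B : E →L[ℝ] F) = fderiv ℝ f x := by
    have h1 : ContinuousAt (fderiv ℝ f) a := (hfa.fderiv_right (m := ∞) (by simp)).continuousAt
    exact h1 (by rw [← hA]; exact A.nhds)
  obtain ⟨U, hU, hUo, haU⟩ := eventually_nhds_iff.1 (hf.and hinv)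
  refine ⟨e₀.restrOpen U hUo, ⟨hfa.mem_toOpenPartialHomeomorph_source hd (by simp), haU⟩,
    fun x => rfl, fun x hx => (hU x hx.2).1, fun y hy => ?_⟩
  have hy' := (e₀.restrOpen U hUo).map_target hy
  obtain ⟨h1, B, hB⟩ := hU _ hy'.2
  refine (e₀.restrOpen U hUo).contDiffAt_symm (f₀' := B) hy ?_ h1
  rw [hB]
  exact (h1.differentiableAt (by simp)).hasFDerivAt

/-! ### Local sections of submersions and coordinates `(s, ν, μ)`. -/

section Section

variable {M : Type*} [TopologicalSpace M] [ChartedSpace E7 M] [IsManifold (𝓡 7) ∞ M]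

theorem mfderiv_comp_extChartAt_symm {F : Type*} [NormedAddCommGroup F] [NormedSpace ℝ F]
    {f : M → F} {x₀ : M} {y : E7} (hy : y ∈ (extChartAt (𝓡 7) x₀).target)
    (hf : MDifferentiableAt (𝓡 7) 𝓘(ℝ, F) f ((extChartAt (𝓡 7) x₀).symm y)) (v : E7) :
    fderiv ℝ (fun z => f ((extChartAt (𝓡 7) x₀).symm z)) y v =
      (mfderiv (𝓡 7) 𝓘(ℝ, F) f ((extChartAt (𝓡 7) x₀).symm y)
        (mfderiv 𝓘(ℝ, E7) (𝓡 7) (extChartAt (𝓡 7) x₀).symm y v) : F) := by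
  have h1 := mfderiv_comp y hf ((contMDiffAt_extChartAt_symm x₀ hy).mdifferentiableAt (by simp))
  rw [← mfderiv_eq_fderiv]
  exact DFunLike.congr_fun h1 v

theorem exists_smooth_section {F : Type*} [NormedAddCommGroup F] [NormedSpace ℝ F]
    [FiniteDimensional ℝ F] {f : M → F} {p : M} (hf : ContMDiff (𝓡 7) 𝓘(ℝ, F) ∞ f)
    (hs : Function.Surjective (mfderiv (𝓡 7) 𝓘(ℝ, F) f p)) :
    ∃ σ : F → M, σ (f p) = p ∧
      ∀ᶠ n in 𝓝 (f p), ContMDiffAt 𝓘(ℝ, F) (𝓡 7) ∞ σ n ∧ f (σ n) = n := by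
  have : CompleteSpace F := FiniteDimensional.complete ℝ F
  set c := extChartAt (𝓡 7) p with hc
  have hp : c p ∈ c.target := mem_extChartAt_target p
  have hcp : c.symm (c p) = p := extChartAt_to_inv p
  set g : E7 → F := fun y => f (c.symm y) with hg
  have hgs : ∀ y ∈ c.target, ContDiffAt ℝ ∞ g y := fun y hy =>
    (ContMDiffAt.comp y hf.contMDiffAt (contMDiffAt_extChartAt_symm p hy)).contDiffAt
  have hsurj : Function.Surjective (fderiv ℝ g (c p)) := by
    have hs' : Function.Surjective (mfderiv (𝓡 7) 𝓘(ℝ, F) f (c.symm (c p))) := by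
      rw [hcp]; exact hs
    intro w
    obtain ⟨v, hv⟩ := hs' w
    obtain ⟨u, hu⟩ := (mfderiv_extChartAt_symm_bijective p hp).2 v
    refine ⟨u, (mfderiv_comp_extChartAt_symm hp
      (hf.contMDiffAt.mdifferentiableAt (by simp)) u).trans ?_⟩
    rw [hu]; exact hv
  obtain ⟨Λ, hΛ⟩ := (fderiv ℝ g (c p)).exists_rightInverse_of_surjective
    (LinearMap.range_eq_top.2 hsurj)
  -- Restricting `g` to the affine slice through `c p` in the direction of a right inverse `Λ` of
  -- its derivative gives a map with derivative the identity. Its local inverse parametrizes the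
  -- section.
  set k : F → F := fun z => g (c p + Λ z) with hk
  have hmem : ∀ᶠ z in 𝓝 (0 : F), c p + Λ z ∈ c.target := by
    have : ContinuousAt (fun z => c p + Λ z) (0 : F) := by fun_prop
    exact this (by simpa [hc] using (isOpen_extChartAt_target p).mem_nhds hp)
  have hks : ∀ᶠ z in 𝓝 (0 : F), ContDiffAt ℝ ∞ k z := by
    filter_upwards [hmem] with z hz
    exact ContDiffAt.comp z (g := g) (hgs _ hz) (by fun_prop)
  have hkd : fderiv ℝ k 0 = ContinuousLinearMap.id ℝ F := by
    have h1 : HasFDerivAt (fun z => c p + Λ z) Λ (0 : F) := Λ.hasFDerivAt.const_add _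
    have h2 : HasFDerivAt g (fderiv ℝ g (c p)) (c p + Λ 0) := by
      simpa using ((hgs _ hp).differentiableAt (by simp)).hasFDerivAt
    have h3 := HasFDerivAt.comp (0 : F) h2 h1
    rw [hΛ] at h3
    exact h3.fderiv
  have hk0 : k 0 = f p := by simp only [hk, hg, map_zero, add_zero, hcp]
  obtain ⟨e, he0, hef, -, hes⟩ := exists_smooth_openPartialHomeomorph hks
    (by rw [hkd]; exact Function.bijective_id)
  have heq : e 0 = f p := (hef 0).trans hk0
  have hζ0 : e.symm (f p) = 0 := by rw [← heq]; exact e.left_inv he0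
  have hmt : e.target ∈ 𝓝 (f p) := e.open_target.mem_nhds (heq ▸ e.map_source he0)
  have hζc : ContinuousAt e.symm (f p) := (hes _ (mem_of_mem_nhds hmt)).continuousAt
  refine ⟨fun n => c.symm (c p + Λ (e.symm n)), by simp only [hζ0, map_zero, add_zero, hcp], ?_⟩
  filter_upwards [hmt, hζc (by rw [hζ0]; exact hmem)] with n hn hn'
  refine ⟨ContMDiffAt.comp n (f := fun n => c p + Λ (e.symm n)) (contMDiffAt_extChartAt_symm p hn') ?_, ?_⟩
  · exact (contDiffAt_const.add (Λ.contDiff.contDiffAt.comp _ (hes n hn))).contMDiffAt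
  · exact (hef _).symm.trans (e.right_inv hn)

end Section

section Action

variable {M : Type*} [TopologicalSpace M] [ChartedSpace E7 M]
  [MulAction T3 M] {φ : ∀ p : M, TangentSpace (𝓡 7) p [⋀^Fin 3]→L[ℝ] ℝ}
  {ν : M → Fin 3 → ℝ} {μ : M → ℝ}

/-- Local coordinates `(s, ν, μ)` with values in a set `N`, in which the action is by translations
of `s`. -/
structure IsActionChart (ν : M → Fin 3 → ℝ) (μ : M → ℝ) (Ψ : E7 → M) (O : Set E7) : Prop where
  isOpen : IsOpen O
  convex : Convex ℝ O
  smooth : ∀ x ∈ O, ContMDiffAt 𝓘(ℝ, E7) (𝓡 7) ∞ Ψ x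
  map_add : ∀ x i (τ : ℝ), Ψ (x + τ • bv (si i)) = expT (τ • Pi.single i 1) • Ψ x
  nu_eq : ∀ x ∈ O, ∀ i, ν (Ψ x) i = x (ni i)
  mu_eq : ∀ x ∈ O, μ (Ψ x) = x 6
  mem_regularSet : ∀ x ∈ O, Ψ x ∈ regularSet M

/-- The multi-moment maps as one map. -/
def momentMap (ν : M → Fin 3 → ℝ) (μ : M → ℝ) (q : M) : (Fin 3 → ℝ) × ℝ := (ν q, μ q)

namespace IsToricG2Manifold

theorem contMDiff_momentMap (h : IsToricG2Manifold φ ν μ) :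
    ContMDiff (𝓡 7) 𝓘(ℝ, (Fin 3 → ℝ) × ℝ) ∞ (momentMap ν μ) :=
  (contMDiff_pi_space.2 h.smooth_nu).prodMk_space h.smooth_mu

theorem mfderiv_momentMap (h : IsToricG2Manifold φ ν μ) (p : M) (v : TangentSpace (𝓡 7) p) :
    (∀ i, (mfderiv (𝓡 7) 𝓘(ℝ, (Fin 3 → ℝ) × ℝ) (momentMap ν μ) p v : (Fin 3 → ℝ) × ℝ).1 i =
      (mfderiv (𝓡 7) 𝓘(ℝ, ℝ) (fun q => ν q i) p v : ℝ)) ∧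
    (mfderiv (𝓡 7) 𝓘(ℝ, (Fin 3 → ℝ) × ℝ) (momentMap ν μ) p v : (Fin 3 → ℝ) × ℝ).2 =
      (mfderiv (𝓡 7) 𝓘(ℝ, ℝ) μ p v : ℝ) := by
  have h1 := (h.contMDiff_momentMap.contMDiffAt (x := p)).mdifferentiableAt (by simp)
  have key : ∀ L : (Fin 3 → ℝ) × ℝ →L[ℝ] ℝ,
      (mfderiv (𝓡 7) 𝓘(ℝ, ℝ) (fun q => L (momentMap ν μ q)) p v : ℝ) =
        L (mfderiv (𝓡 7) 𝓘(ℝ, (Fin 3 → ℝ) × ℝ) (momentMap ν μ) p v) := by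
    intro L
    have h2 := (L.hasMFDerivAt (x := momentMap ν μ p)).comp p h1.hasMFDerivAt
    exact DFunLike.congr_fun h2.mfderiv v
  refine ⟨fun i => ?_, ?_⟩
  · exact (key ((ContinuousLinearMap.proj i).comp (ContinuousLinearMap.fst ℝ _ _))).symm
  · exact (key (ContinuousLinearMap.snd ℝ _ _)).symm

theorem mfderiv_momentMap_surjective (h : IsToricG2Manifold φ ν μ) {p : M}
    (hp : p ∈ regularSet M) :
    Function.Surjective (mfderiv (𝓡 7) 𝓘(ℝ, (Fin 3 → ℝ) × ℝ) (momentMap ν μ) p) := by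
  obtain ⟨K, -, hK, -, hU, hν, hμ⟩ := h.exists_adapted_frame p
  have hD := h.mem_regularSet_iff.1 hp
  rw [det_matB hK] at hD
  set a := K (gen 0 p)
  set b := K (gen 1 p)
  set c := K (gen 2 p)
  rintro ⟨α, β⟩
  set D := gram3 a b c with hDdef
  -- The differentials pair with the cross products through the adjugate of the Gram matrix, so a
  -- preimage of `α` has coefficients (Gram matrix) `· α / D`. Since `|chi a b c|² = D`, the last
  -- coefficient is `β / D`.
  set y₁ := (inner ℝ a a * α 0 + inner ℝ a b * α 1 + inner ℝ a c * α 2) / D with hy₁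
  set y₂ := (inner ℝ a b * α 0 + inner ℝ b b * α 1 + inner ℝ b c * α 2) / D with hy₂
  set y₃ := (inner ℝ a c * α 0 + inner ℝ b c * α 1 + inner ℝ c c * α 2) / D with hy₃
  set u : E7 := (0 : ℝ) • a + (0 : ℝ) • b + (0 : ℝ) • c +
    (y₁ • cross b c + y₂ • cross c a + y₃ • cross a b) + (β / D) • chi a b c with hu
  obtain ⟨-, ⟨h0, h1, h2⟩, h3⟩ := hU.inner_tables _ _ _ _ _ _ _ hu
  obtain ⟨m1, m2⟩ := h.mfderiv_momentMap p (K.symm u)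
  refine ⟨K.symm u, Prod.ext (funext fun i => ?_) ?_⟩
  · rw [m1, hν, K.apply_symm_apply]
    fin_cases i
    · refine Eq.trans h0 ?_
      rw [hy₁, hy₂, hy₃]; field_simp; rw [hDdef, gram3]; simp; ring
    · refine Eq.trans h1 ?_
      rw [hy₁, hy₂, hy₃]; field_simp; rw [hDdef, gram3]; simp; ring
    · refine Eq.trans h2 ?_
      rw [hy₁, hy₂, hy₃]; field_simp; rw [hDdef, gram3]; simp; ring
  · rw [m2, hμ, K.apply_symm_apply, h3]
    rw [← hDdef]; field_simp

variable [IsManifold (𝓡 7) ∞ M]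

/-- Move a local section `σ` of the moment map by the torus: `Ψ(s, ν, μ) = exp(s) • σ(ν, μ)`.
Invariance of the moment maps makes `ν`, `μ` coordinates. -/
theorem exists_isActionChart (h : IsToricG2Manifold φ ν μ) {p : M} (hp : p ∈ regularSet M)
    {N : Set M} (hN : N ∈ 𝓝 p) : ∃ Ψ O x, IsActionChart ν μ Ψ O ∧ x ∈ O ∧ Ψ x = p ∧
      ∀ y ∈ O, Ψ y ∈ N := by
  obtain ⟨σ, hσp, hσ⟩ := exists_smooth_section (f := momentMap ν μ) (p := p)
    h.contMDiff_momentMap (h.mfderiv_momentMap_surjective hp)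
  let S : E7 →L[ℝ] Fin 3 → ℝ := ContinuousLinearMap.pi fun i => EuclideanSpace.proj (si i)
  let n : E7 →L[ℝ] (Fin 3 → ℝ) × ℝ :=
    (ContinuousLinearMap.pi fun i => EuclideanSpace.proj (ni i)).prod (EuclideanSpace.proj 6)
  let x₀ : E7 := WithLp.toLp 2 ![0, 0, 0, ν p 0, ν p 1, ν p 2, μ p]
  have hS : S x₀ = 0 := by ext i; fin_cases i <;> rfl
  have hn : n x₀ = momentMap ν μ p := by
    refine Prod.ext (funext fun i => ?_) rfl
    fin_cases i <;> rfl
  set Ψ : E7 → M := fun x => expT (S x) • σ (n x) with hΨ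
  have hΨ0 : Ψ x₀ = p := by simp only [hΨ]; rw [hS, hn, expT_zero, one_smul, hσp]
  have ev3 : ∀ᶠ x in 𝓝 x₀, ContMDiffAt 𝓘(ℝ, (Fin 3 → ℝ) × ℝ) (𝓡 7) ∞ σ (n x) ∧
      momentMap ν μ (σ (n x)) = n x := by
    have : Tendsto n (𝓝 x₀) (𝓝 (momentMap ν μ p)) := by rw [← hn]; exact n.continuous.continuousAt
    exact this.eventually hσ
  have ev1 : ∀ᶠ x in 𝓝 x₀, ContMDiffAt 𝓘(ℝ, E7) (𝓡 7) ∞ Ψ x := by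
    filter_upwards [ev3] with x hx
    exact h.contMDiffAt_expT_smul S.contDiff.contDiffAt
      (ContMDiffAt.comp x hx.1 n.contDiff.contDiffAt.contMDiffAt)
  have hΨs := ev1.self_of_nhds
  have ev2 : ∀ᶠ x in 𝓝 x₀, Ψ x ∈ N ∩ regularSet M :=
    hΨs.continuousAt (by rw [hΨ0]; exact inter_mem hN (h.isOpen_regularSet.mem_nhds hp))
  obtain ⟨r, hr, hball⟩ := Metric.eventually_nhds_iff_ball.1 (ev1.and (ev2.and ev3))
  have hinv : ∀ x, momentMap ν μ (Ψ x) = momentMap ν μ (σ (n x)) := fun x => by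
    simp only [hΨ, momentMap, h.invariant_nu, h.invariant_mu]
  refine ⟨Ψ, Metric.ball x₀ r, x₀, ⟨Metric.isOpen_ball, convex_ball _ _,
    fun x hx => (hball x hx).1, fun x i τ => ?_, fun x hx i => ?_, fun x hx => ?_,
    fun x hx => (hball x hx).2.1.2⟩, Metric.mem_ball_self hr, hΨ0, fun y hy => (hball y hy).2.1.1⟩
  · have e1 : S (x + τ • bv (si i)) = τ • Pi.single i 1 + S x := by
      ext j
      fin_cases i <;> fin_cases j <;> simp [S, si, add_comm]
    have e2 : n (x + τ • bv (si i)) = n x := by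
      refine Prod.ext (funext fun j => ?_) ?_
      · fin_cases i <;> fin_cases j <;> simp [n, si, ni]
      · fin_cases i <;> simp [n, si]
    simp only [hΨ]
    rw [e1, e2, expT_add, mul_smul]
  · exact congrArg (fun z : (Fin 3 → ℝ) × ℝ => z.1 i) ((hinv x).trans (hball x hx).2.2.2)
  · exact congrArg (fun z : (Fin 3 → ℝ) × ℝ => z.2) ((hinv x).trans (hball x hx).2.2.2)

end IsToricG2Manifold

end Action

/-- No differentiability is needed, since `fderiv` is zero where it does not exist. -/
theorem pderiv_eq_zero_of_eventually_eq {f : E7 → ℝ} {x : E7} {a : Fin 7}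
    (h : ∀ᶠ τ : ℝ in 𝓝 0, f (x + τ • bv a) = f x) : pderiv a f x = 0 := by
  by_cases hf : DifferentiableAt ℝ f x
  · have h1 : HasDerivAt (fun τ : ℝ => f (x + τ • bv a)) (fderiv ℝ f x (bv a)) 0 := by
      have h2 : HasFDerivAt f (fderiv ℝ f x) (x + (0 : ℝ) • bv a) := by
        simpa using hf.hasFDerivAt
      have h3 : HasDerivAt (fun τ : ℝ => x + τ • bv a) (bv a) 0 := by
        simpa using ((hasDerivAt_id (0 : ℝ)).smul_const (bv a)).const_add x
      exact h2.comp_hasDerivAt (0 : ℝ) h3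
    have h4 : HasDerivAt (fun τ : ℝ => f (x + τ • bv a)) 0 0 :=
      (hasDerivAt_const (0 : ℝ) (f x)).congr_of_eventuallyEq h
    exact h1.unique h4
  · simp [pderiv, fderiv_zero_of_not_differentiableAt hf]

/-- With its analogues for `chi` and `theta`, this converts formulas for an ordered triple into
matrix formulas treating the three generators uniformly under cyclic shifts. -/
theorem gram3_eq_det (u : Fin 3 → E7) (i : Fin 3) :
    gram3 (u i) (u (i + 1)) (u (i + 2)) = (Matrix.gram ℝ u).det := by
  have h : gram3 (u 0) (u 1) (u 2) = (Matrix.gram ℝ u).det := by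
    rw [Matrix.det_fin_three, gram3]
    simp only [Matrix.gram_apply, real_inner_comm (u 0), real_inner_comm (u 2) (u 1)]
    ring
  rw [← h]
  fin_cases i
  exacts [rfl, IsIsotropicTriple.gram3_rotate,
    IsIsotropicTriple.gram3_rotate.trans IsIsotropicTriple.gram3_rotate]

theorem chi_eq_chi (u : Fin 3 → E7) (i : Fin 3) :
    chi (u i) (u (i + 1)) (u (i + 2)) = chi (u 0) (u 1) (u 2) := by
  fin_cases i
  exacts [rfl, IsIsotropicTriple.chi_rotate,
    IsIsotropicTriple.chi_rotate.trans IsIsotropicTriple.chi_rotate]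

theorem theta_eq_sum (u : Fin 3 → E7) (i : Fin 3) (v : E7) :
    IsIsotropicTriple.theta (u i) (u (i + 1)) (u (i + 2)) v =
      ∑ j, (Matrix.gram ℝ u)⁻¹ i j * inner ℝ (u j) v := by
  have hs : ∀ i j, inner ℝ (u i) (u j) = Matrix.gram ℝ u i j := fun i j => rfl
  have hsym : ∀ i j, Matrix.gram ℝ u i j = Matrix.gram ℝ u j i := fun i j => by
    rw [Matrix.gram_apply, real_inner_comm, Matrix.gram_apply]
  rw [Fin.sum_univ_three, Matrix.inv_def, Ring.inverse_eq_inv', Matrix.adjugate_fin_three,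
    IsIsotropicTriple.theta, gram3_eq_det]
  generalize (Matrix.gram ℝ u).det = D
  simp only [hs]
  generalize Matrix.gram ℝ u = B at hsym
  fin_cases i
  · simp [hsym 1 0, hsym 2 0, hsym 2 1]; ring
  · simp [hsym 1 0, hsym 2 0, hsym 2 1]; ring
  · simp [hsym 1 0, hsym 2 0, hsym 2 1]; ring

section Action

variable {M : Type*} [TopologicalSpace M] [ChartedSpace E7 M]

theorem pull_comp_sub {k : ℕ} (η : ∀ p : M, TangentSpace (𝓡 7) p [⋀^Fin k]→L[ℝ] ℝ) {Ψ : E7 → M}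
    {x : E7} (hΨ : MDifferentiableAt 𝓘(ℝ, E7) (𝓡 7) Ψ x) (w : E7) :
    pull η (fun y => Ψ (y - w)) (x + w) = pull η Ψ x := by
  have h1 : HasMFDerivAt 𝓘(ℝ, E7) (𝓡 7) Ψ (x + w - w) (mfderiv 𝓘(ℝ, E7) (𝓡 7) Ψ (x + w - w)) := by
    rw [add_sub_cancel_right]; exact hΨ.hasMFDerivAt
  have h2 : HasFDerivAt (fun y : E7 => y - w) (ContinuousLinearMap.id ℝ E7) (x + w) :=
    (hasFDerivAt_id _).sub_const w
  have h3 := (HasMFDerivAt.comp (x + w) (f := fun y : E7 => y - w) h1 h2.hasMFDerivAt).mfderiv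
  have h4 : pull η (fun y => Ψ (y - w)) (x + w) = pull η Ψ (x + w - w) := by
    ext v
    simp only [pull_apply]
    change η (Ψ (x + w - w)) (fun i => mfderiv 𝓘(ℝ, E7) (𝓡 7) (Ψ ∘ fun y => y - w) (x + w) (v i)) = _
    rw [h3]
    rfl
  rw [h4, add_sub_cancel_right]

variable [MulAction T3 M] {φ : ∀ p : M, TangentSpace (𝓡 7) p [⋀^Fin 3]→L[ℝ] ℝ}
  {ν : M → Fin 3 → ℝ} {μ : M → ℝ}

/-- The connection forms `θ_i = ∑ⱼ Vᵢⱼ g(U_j, ·)`. -/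
def conn (φ : ∀ p : M, TangentSpace (𝓡 7) p [⋀^Fin 3]→L[ℝ] ℝ) (p : M) (i : Fin 3)
    (u : TangentSpace (𝓡 7) p) : ℝ := ∑ j, matV φ p i j * metric φ p (gen j p) u

namespace IsToricG2Manifold

theorem mfderiv_smul_bijective (h : IsToricG2Manifold φ ν μ) (t : T3) (p : M) :
    Function.Bijective (mfderiv (𝓡 7) (𝓡 7) (fun q : M => t • q) p) := by
  have key : ∀ (t : T3) (p : M), Function.Injective (mfderiv (𝓡 7) (𝓡 7) (fun q : M => t • q) p) := by
    intro t p
    have h1 := (h.mdifferentiableAt_smul t⁻¹ (t • p)).hasMFDerivAt.comp p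
      (h.mdifferentiableAt_smul t p).hasMFDerivAt
    have h2 : (fun q : M => t⁻¹ • q) ∘ (fun q : M => t • q) = id := by ext q; simp
    rw [h2] at h1
    have h3 := h1.mfderiv
    rw [mfderiv_id] at h3
    intro u v huv
    have h4 : ∀ u, mfderiv (𝓡 7) (𝓡 7) (fun q : M => t⁻¹ • q) (t • p)
      (mfderiv (𝓡 7) (𝓡 7) (fun q : M => t • q) p u) = u := fun u => (DFunLike.congr_fun h3 u).symm
    rw [← h4 u, huv, h4]
  let D : E7 →L[ℝ] E7 := mfderiv (𝓡 7) (𝓡 7) (fun q : M => t • q) p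
  exact ⟨key t p, (LinearMap.injective_iff_surjective (f := D.toLinearMap)).1 (key t p)⟩

/-- Only `φ` is assumed invariant. Linear isomorphisms matching the 3-forms also match the dual
4-forms. -/
theorem dual_invariant (h : IsToricG2Manifold φ ν μ) (t : T3) (p : M)
    (u v w z : TangentSpace (𝓡 7) p) :
    dual φ (t • p) ![mfderiv (𝓡 7) (𝓡 7) (fun q : M => t • q) p u,
      mfderiv (𝓡 7) (𝓡 7) (fun q : M => t • q) p v, mfderiv (𝓡 7) (𝓡 7) (fun q : M => t • q) p w,
      mfderiv (𝓡 7) (𝓡 7) (fun q : M => t • q) p z] = dual φ p ![u, v, w, z] := by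
  refine (innerOf_dualOf_map (h.adapted p) (h.adapted (t • p))
    (mfderiv (𝓡 7) (𝓡 7) (fun q : M => t • q) p).toLinearMap (h.mfderiv_smul_bijective t p)
    fun u v w => ?_).2 u v w z
  rw [← h.invariant t p, ContinuousAlternatingMap.compContinuousLinearMap_apply]
  congr 1
  ext i; fin_cases i <;> rfl

theorem dual_invariant' (h : IsToricG2Manifold φ ν μ) (t : T3) (p : M) :
    (dual φ (t • p)).compContinuousLinearMap (mfderiv (𝓡 7) (𝓡 7) (fun q : M => t • q) p) =
      dual φ p := by
  ext v
  have e : v = ![v 0, v 1, v 2, v 3] := by ext i; fin_cases i <;> rfl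
  rw [e, ← h.dual_invariant t p]
  rw [ContinuousAlternatingMap.compContinuousLinearMap_apply]
  congr 1
  ext i; fin_cases i <;> rfl

/-- An adapted frame at a regular point, described so that the three generators play the same
role. -/
theorem exists_regular_frame (h : IsToricG2Manifold φ ν μ) (p : M) :
    ∃ K : TangentSpace (𝓡 7) p ≃L[ℝ] E7, (∀ u v w, φ p ![u, v, w] = phi0 ![K u, K v, K w]) ∧
      (∀ u v, metric φ p u v = inner ℝ (K u) (K v)) ∧
      (∀ u v w z, dual φ p ![u, v, w, z] = psi0 ![K u, K v, K w, K z]) ∧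
      (∀ i, IsIsotropicTriple (K (gen i p)) (K (gen (i + 1) p)) (K (gen (i + 2) p)) ∧
        gram3 (K (gen i p)) (K (gen (i + 1) p)) (K (gen (i + 2) p)) = (matB φ p).det ∧
        (∀ v, inner ℝ (cross (K (gen (i + 1) p)) (K (gen (i + 2) p))) (K v) =
          (mfderiv (𝓡 7) 𝓘(ℝ, ℝ) (fun q => ν q i) p v : ℝ)) ∧
        (∀ v, inner ℝ (chi (K (gen i p)) (K (gen (i + 1) p)) (K (gen (i + 2) p))) (K v) =
          (mfderiv (𝓡 7) 𝓘(ℝ, ℝ) μ p v : ℝ)) ∧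
        ∀ v, IsIsotropicTriple.theta (K (gen i p)) (K (gen (i + 1) p)) (K (gen (i + 2) p)) (K v) =
          conn φ p i v) := by
  obtain ⟨K, h1, h2, h3, hU, hν, hμ⟩ := h.exists_adapted_frame p
  refine ⟨K, h1, h2, h3, fun i => ⟨?_, ?_, fun v => (hν i v).symm, fun v => ?_, fun v => ?_⟩⟩
  · fin_cases i
    exacts [hU, hU.rotate, hU.rotate.rotate]
  · rw [matB_eq_gram h2]
    exact gram3_eq_det (fun i => K (gen i p)) i
  · rw [hμ]
    rw [chi_eq_chi (fun i => K (gen i p)) i]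
  · rw [theta_eq_sum (fun i => K (gen i p)), ← matB_eq_gram h2]
    simp only [conn, h2]
    rfl

end IsToricG2Manifold

end Action

/-! ### The forms in action charts. -/

section Action

variable {M : Type*} [TopologicalSpace M] [ChartedSpace E7 M]
  [MulAction T3 M] {φ : ∀ p : M, TangentSpace (𝓡 7) p [⋀^Fin 3]→L[ℝ] ℝ}
  {ν : M → Fin 3 → ℝ} {μ : M → ℝ} {Ψ : E7 → M} {O : Set E7} {x : E7}

namespace IsActionChart

theorem mdifferentiableAt (H : IsActionChart ν μ Ψ O) (hx : x ∈ O) :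
    MDifferentiableAt 𝓘(ℝ, E7) (𝓡 7) Ψ x := (H.smooth x hx).mdifferentiableAt (by simp)

theorem mfderiv_si (H : IsActionChart ν μ Ψ O) (hx : x ∈ O) (i : Fin 3) :
    mfderiv 𝓘(ℝ, E7) (𝓡 7) Ψ x (bv (si i)) = gen i (Ψ x) := by
  have h1 : HasMFDerivAt 𝓘(ℝ, E7) (𝓡 7) Ψ (x + (0 : ℝ) • bv (si i))
      (mfderiv 𝓘(ℝ, E7) (𝓡 7) Ψ (x + (0 : ℝ) • bv (si i))) := by
    rw [zero_smul, add_zero]; exact (H.mdifferentiableAt hx).hasMFDerivAt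
  have h2 : HasFDerivAt (fun τ : ℝ => x + τ • bv (si i))
      ((ContinuousLinearMap.id ℝ ℝ).smulRight (bv (si i))) 0 :=
    ((hasFDerivAt_id (0 : ℝ)).smul_const (bv (si i))).const_add x
  have h3 := (HasMFDerivAt.comp (0 : ℝ) (f := fun τ : ℝ => x + τ • bv (si i)) h1
    h2.hasMFDerivAt).mfderiv
  have h4 : (Ψ ∘ fun τ : ℝ => x + τ • bv (si i)) = fun τ : ℝ => expT (τ • Pi.single i 1) • Ψ x :=
    funext fun τ => H.map_add x i τ
  rw [h4] at h3
  have h5 := DFunLike.congr_fun h3 (1 : ℝ)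
  rw [gen_eq]
  refine Eq.trans ?_ h5.symm
  have h6 : x + (0 : ℝ) • bv (si i) = x := by rw [zero_smul, add_zero]
  have h7 : (mfderiv 𝓘(ℝ, E7) (𝓡 7) Ψ (x + (0 : ℝ) • bv (si i)) (bv (si i)) : E7) =
      mfderiv 𝓘(ℝ, E7) (𝓡 7) Ψ x (bv (si i)) :=
    congrArg (fun y : E7 => (mfderiv 𝓘(ℝ, E7) (𝓡 7) Ψ y (bv (si i)) : E7)) h6
  refine h7.symm.trans ?_
  change (_ : E7) = mfderiv 𝓘(ℝ, E7) (𝓡 7) Ψ (x + (0 : ℝ) • bv (si i)) ((1 : ℝ) • bv (si i))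
  rw [one_smul]

theorem mfderiv_comp_eq (H : IsActionChart ν μ Ψ O) (hx : x ∈ O) {f : M → ℝ} {L : E7 →L[ℝ] ℝ}
    (hf : MDifferentiableAt (𝓡 7) 𝓘(ℝ, ℝ) f (Ψ x)) (hL : ∀ y ∈ O, f (Ψ y) = L y) (v : E7) :
    (mfderiv (𝓡 7) 𝓘(ℝ, ℝ) f (Ψ x) (mfderiv 𝓘(ℝ, E7) (𝓡 7) Ψ x v) : ℝ) = L v := by
  have h1 := (hf.hasMFDerivAt.comp x (H.mdifferentiableAt hx).hasMFDerivAt).mfderiv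
  have h2 : f ∘ Ψ =ᶠ[𝓝 x] L := by
    filter_upwards [H.isOpen.mem_nhds hx] with y hy using hL y hy
  rw [h2.mfderiv_eq, mfderiv_eq_fderiv, L.fderiv] at h1
  exact (DFunLike.congr_fun h1 v).symm

theorem mfderiv_nu (H : IsActionChart ν μ Ψ O) (h : IsToricG2Manifold φ ν μ) (hx : x ∈ O)
    (i : Fin 3) (v : E7) :
    (mfderiv (𝓡 7) 𝓘(ℝ, ℝ) (fun q => ν q i) (Ψ x) (mfderiv 𝓘(ℝ, E7) (𝓡 7) Ψ x v) : ℝ) =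
      v (ni i) :=
  H.mfderiv_comp_eq hx (L := EuclideanSpace.proj (ni i))
    ((h.smooth_nu i).contMDiffAt.mdifferentiableAt (by simp)) (fun y hy => H.nu_eq y hy i) v

theorem mfderiv_mu (H : IsActionChart ν μ Ψ O) (h : IsToricG2Manifold φ ν μ) (hx : x ∈ O)
    (v : E7) :
    (mfderiv (𝓡 7) 𝓘(ℝ, ℝ) μ (Ψ x) (mfderiv 𝓘(ℝ, E7) (𝓡 7) Ψ x v) : ℝ) = v 6 :=
  H.mfderiv_comp_eq hx (L := EuclideanSpace.proj 6)
    (h.smooth_mu.contMDiffAt.mdifferentiableAt (by simp)) (fun y hy => H.mu_eq y hy) v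

/-- A kernel vector has no `ν`- and `μ`-components, so it is a combination of torus directions, and
these map to independent generators. -/
theorem mfderiv_bijective (H : IsActionChart ν μ Ψ O) (h : IsToricG2Manifold φ ν μ)
    (hx : x ∈ O) : Function.Bijective (mfderiv 𝓘(ℝ, E7) (𝓡 7) Ψ x) := by
  let D : E7 →L[ℝ] E7 := mfderiv 𝓘(ℝ, E7) (𝓡 7) Ψ x
  have hinj : Function.Injective D.toLinearMap := by
    refine (injective_iff_map_eq_zero _).2 fun v hv => ?_
    have hv' : mfderiv 𝓘(ℝ, E7) (𝓡 7) Ψ x v = 0 := hv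
    have h1 : ∀ i, v (ni i) = 0 := fun i => by
      rw [← H.mfderiv_nu h hx i v, hv']; exact map_zero _
    have h2 : v 6 = 0 := by rw [← H.mfderiv_mu h hx v, hv']; exact map_zero _
    have h3 : v = ∑ i, v (si i) • bv (si i) := by
      have e0 := h1 0
      have e1 := h1 1
      have e2 := h1 2
      simp only [ni, Matrix.cons_val] at e0 e1 e2
      ext j
      fin_cases j <;> simp [Fin.sum_univ_three, si, e0, e1, e2, h2]
    have h4 : ∑ i, v (si i) • gen i (Ψ x) = 0 := by
      have h5 : D v = ∑ i, v (si i) • D (bv (si i)) := by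
        conv_lhs => rw [h3]
        rw [map_sum]
        exact Finset.sum_congr rfl fun i _ => map_smul _ _ _
      rw [← hv', ← (show D v = mfderiv 𝓘(ℝ, E7) (𝓡 7) Ψ x v from rfl), h5]
      exact Finset.sum_congr rfl fun i _ => by rw [← H.mfderiv_si hx i]; rfl
    have h5 := Fintype.linearIndependent_iff.1 (H.mem_regularSet x hx) _ h4
    rw [h3]
    exact Finset.sum_eq_zero fun i _ => by rw [h5 i, zero_smul]
  exact ⟨hinj, (LinearMap.injective_iff_surjective (f := D.toLinearMap)).1 hinj⟩

/-- Translating a torus coordinate in `Ψ` is acting by a group element, which preserves `η`. The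
translated point may leave `O`, where no smoothness is known, so differentiability is used only at
`x`. -/
theorem pull_add (H : IsActionChart ν μ Ψ O) (h : IsToricG2Manifold φ ν μ) (hx : x ∈ O) {k : ℕ}
    {η : ∀ p : M, TangentSpace (𝓡 7) p [⋀^Fin k]→L[ℝ] ℝ} (hη : ∀ (t : T3) (p : M),
      (η (t • p)).compContinuousLinearMap (mfderiv (𝓡 7) (𝓡 7) (fun q : M => t • q) p) = η p)
    (i : Fin 3) (τ : ℝ) : pull η Ψ (x + τ • bv (si i)) = pull η Ψ x := by
  set t := expT (τ • Pi.single i 1) with ht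
  set w := τ • bv (si i) with hw
  have h1 : Ψ = fun y => t • Ψ (y - w) := funext fun y => by
    rw [ht, ← H.map_add, ← hw, sub_add_cancel]
  have h2 : ∀ y, MDifferentiableAt 𝓘(ℝ, E7) (𝓡 7) Ψ y →
      pull η (fun y => t • Ψ y) y = pull η Ψ y := fun y hy => by
    have h3 := ((h.mdifferentiableAt_smul t (Ψ y)).hasMFDerivAt.comp y hy.hasMFDerivAt).mfderiv
    ext v
    simp only [pull_apply]
    change η (t • Ψ y) (fun i => mfderiv 𝓘(ℝ, E7) (𝓡 7) ((fun q => t • q) ∘ Ψ) y (v i)) = _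
    rw [h3, ← hη t (Ψ y)]
    rfl
  have h4 : MDifferentiableAt 𝓘(ℝ, E7) (𝓡 7) (fun y => t • Ψ y) x :=
    (h.mdifferentiableAt_smul t (Ψ x)).comp x (H.mdifferentiableAt hx)
  rw [← h2 x (H.mdifferentiableAt hx), ← pull_comp_sub η h4 w]
  exact congrArg (fun f => pull η f (x + w)) h1

theorem pderiv_pull (H : IsActionChart ν μ Ψ O) (h : IsToricG2Manifold φ ν μ) (hx : x ∈ O) {k : ℕ}
    {η : ∀ p : M, TangentSpace (𝓡 7) p [⋀^Fin k]→L[ℝ] ℝ} (hη : ∀ (t : T3) (p : M),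
      (η (t • p)).compContinuousLinearMap (mfderiv (𝓡 7) (𝓡 7) (fun q : M => t • q) p) = η p)
    (i : Fin 3) (v : Fin k → E7) : pderiv (si i) (fun y => pull η Ψ y v) x = 0 :=
  pderiv_eq_zero_of_eventually_eq (.of_forall fun τ => by rw [H.pull_add h hx hη])

end IsActionChart

end Action

section Action

variable {M : Type*} [TopologicalSpace M] [ChartedSpace E7 M]
  [MulAction T3 M] {φ : ∀ p : M, TangentSpace (𝓡 7) p [⋀^Fin 3]→L[ℝ] ℝ}
  {ν : M → Fin 3 → ℝ} {μ : M → ℝ} {Ψ : E7 → M} {O : Set E7} {x : E7}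

theorem matV_eq_smul_adjugate (p : M) :
    matV φ p = (matB φ p).det⁻¹ • (matB φ p).adjugate := by
  rw [matV, Matrix.inv_def, Ring.inverse_eq_inv']

namespace IsToricG2Manifold

theorem isUnit_det_matB (h : IsToricG2Manifold φ ν μ) {p : M} (hp : p ∈ regularSet M) :
    IsUnit (matB φ p).det := isUnit_iff_ne_zero.2 (h.mem_regularSet_iff.1 hp)

theorem matB_isSymm (h : IsToricG2Manifold φ ν μ) (p : M) (i j : Fin 3) :
    matB φ p i j = matB φ p j i := by
  obtain ⟨K, -, hK, -⟩ := h.exists_adapted_frame p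
  rw [matB_eq_gram hK, Matrix.gram_apply, real_inner_comm, Matrix.gram_apply]

theorem adjugate_matV (h : IsToricG2Manifold φ ν μ) {p : M} (hp : p ∈ regularSet M) :
    (matV φ p).adjugate = (matB φ p).det⁻¹ • matB φ p := by
  have hu := h.isUnit_det_matB hp
  have h1 : (matV φ p).adjugate * (matV φ p * matB φ p) =
      ((matV φ p).det • (1 : Matrix (Fin 3) (Fin 3) ℝ)) * matB φ p := by
    rw [← mul_assoc, Matrix.adjugate_mul]
  rw [matV, Matrix.nonsing_inv_mul _ hu, mul_one, Matrix.det_nonsing_inv, Ring.inverse_eq_inv',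
    Matrix.smul_mul, one_mul] at h1
  exact h1

theorem conn_gen (h : IsToricG2Manifold φ ν μ) {p : M} (hp : p ∈ regularSet M) (i j : Fin 3) :
    conn φ p i (gen j p) = if i = j then 1 else 0 := by
  have h1 := congrFun (congrFun (Matrix.nonsing_inv_mul _ (h.isUnit_det_matB hp)) i) j
  rw [Matrix.one_apply, Matrix.mul_apply] at h1
  exact h1

/-- The components of `φ` along a generator. -/
theorem phi_gen (h : IsToricG2Manifold φ ν μ) {p : M} (hp : p ∈ regularSet M) (i : Fin 3)
    {y z : Fin 3 → ℝ} {r s : ℝ} {u v : TangentSpace (𝓡 7) p}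
    (hy : ∀ j, (mfderiv (𝓡 7) 𝓘(ℝ, ℝ) (fun q => ν q j) p u : ℝ) = y j)
    (hz : ∀ j, (mfderiv (𝓡 7) 𝓘(ℝ, ℝ) (fun q => ν q j) p v : ℝ) = z j)
    (hr : (mfderiv (𝓡 7) 𝓘(ℝ, ℝ) μ p u : ℝ) = r) (hs : (mfderiv (𝓡 7) 𝓘(ℝ, ℝ) μ p v : ℝ) = s) :
    φ p ![gen i p, u, v] =
      conn φ p (i + 1) u * z (i + 2) - conn φ p (i + 1) v * y (i + 2)
      - (conn φ p (i + 2) u * z (i + 1) - conn φ p (i + 2) v * y (i + 1))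
      + (r * ∑ j, (matV φ p).adjugate i j * z j - s * ∑ j, (matV φ p).adjugate i j * y j) := by
  obtain ⟨K, h1, h2, h3, hK⟩ := h.exists_regular_frame p
  have hD := h.mem_regularSet_iff.1 hp
  have e11 : i + 1 + 1 = i + 2 := by fin_cases i <;> rfl
  have e12 : i + 1 + 2 = i := by fin_cases i <;> rfl
  have e21 : i + 2 + 1 = i := by fin_cases i <;> rfl
  have e22 : i + 2 + 2 = i + 1 := by fin_cases i <;> rfl
  obtain ⟨a1, a2, a3, a4, a5⟩ := hK i
  obtain ⟨b1, b2, b3, b4, b5⟩ := hK (i + 1)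
  obtain ⟨c1, c2, c3, c4, c5⟩ := hK (i + 2)
  rw [e11, e12] at b1 b2 b3 b4 b5
  rw [e21, e22] at c1 c2 c3 c4 c5
  have hB : ∀ i j, inner ℝ (K (gen i p)) (K (gen j p)) = matB φ p i j := fun i j => (h2 _ _).symm
  rw [h1, a1.phi_fst (by rw [a2]; exact hD), h.adjugate_matV hp, a2]
  simp only [a3, a4, b3, b5, c3, c5, hy, hz, hr, hs, hB, Matrix.smul_apply, smul_eq_mul,
    Fin.sum_univ_three]
  fin_cases i <;> simp <;> field_simp <;> ring

/-- The components of `*φ` along two generators. -/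
theorem dual_gen (h : IsToricG2Manifold φ ν μ) {p : M} (hp : p ∈ regularSet M) (i : Fin 3)
    {y z : Fin 3 → ℝ} {r s : ℝ} {u v : TangentSpace (𝓡 7) p}
    (hy : ∀ j, (mfderiv (𝓡 7) 𝓘(ℝ, ℝ) (fun q => ν q j) p u : ℝ) = y j)
    (hz : ∀ j, (mfderiv (𝓡 7) 𝓘(ℝ, ℝ) (fun q => ν q j) p v : ℝ) = z j)
    (hr : (mfderiv (𝓡 7) 𝓘(ℝ, ℝ) μ p u : ℝ) = r) (hs : (mfderiv (𝓡 7) 𝓘(ℝ, ℝ) μ p v : ℝ) = s) :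
    dual φ p ![gen (i + 1) p, gen (i + 2) p, u, v] =
      conn φ p i u * s - conn φ p i v * r
      - ∑ j, matV φ p i j * (y (j + 1) * z (j + 2) - z (j + 1) * y (j + 2)) := by
  obtain ⟨K, h1, h2, h3, hK⟩ := h.exists_regular_frame p
  have hD := h.mem_regularSet_iff.1 hp
  have e11 : i + 1 + 1 = i + 2 := by fin_cases i <;> rfl
  have e12 : i + 1 + 2 = i := by fin_cases i <;> rfl
  have e21 : i + 2 + 1 = i := by fin_cases i <;> rfl
  have e22 : i + 2 + 2 = i + 1 := by fin_cases i <;> rfl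
  obtain ⟨a1, a2, a3, a4, a5⟩ := hK i
  obtain ⟨b1, b2, b3, b4, b5⟩ := hK (i + 1)
  obtain ⟨c1, c2, c3, c4, c5⟩ := hK (i + 2)
  rw [e11, e12] at b1 b2 b3 b4 b5
  rw [e21, e22] at c1 c2 c3 c4 c5
  have hB : ∀ i j, inner ℝ (K (gen i p)) (K (gen j p)) = matB φ p i j := fun i j => (h2 _ _).symm
  have hsym := h.matB_isSymm p
  rw [h3, a1.psi_snd (by rw [a2]; exact hD), matV_eq_smul_adjugate, a2, Matrix.adjugate_fin_three]
  simp only [a3, a4, a5, b3, c3, hy, hz, hr, hs, hB, Matrix.smul_apply, smul_eq_mul,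
    Fin.sum_univ_three]
  clear a1 a2 a3 a4 a5 b1 b2 b3 b4 b5 c1 c2 c3 c4 c5
  generalize (matB φ p).det = D at hD
  fin_cases i <;> simp [hsym 1 0, hsym 2 0, hsym 2 1] <;> field_simp <;> ring

-- In the second sum `adj V = B / det B`, by `adjugate_matV`. So for constant `V` all coefficients
-- in `θ`, `dν`, `dμ` are constant, and flatness only requires the `θ_i` to be closed.
set_option maxHeartbeats 1000000 in
theorem metric_eq (h : IsToricG2Manifold φ ν μ) {p : M} (hp : p ∈ regularSet M)
    {y z : Fin 3 → ℝ} {r s : ℝ} {u v : TangentSpace (𝓡 7) p}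
    (hy : ∀ j, (mfderiv (𝓡 7) 𝓘(ℝ, ℝ) (fun q => ν q j) p u : ℝ) = y j)
    (hz : ∀ j, (mfderiv (𝓡 7) 𝓘(ℝ, ℝ) (fun q => ν q j) p v : ℝ) = z j)
    (hr : (mfderiv (𝓡 7) 𝓘(ℝ, ℝ) μ p u : ℝ) = r) (hs : (mfderiv (𝓡 7) 𝓘(ℝ, ℝ) μ p v : ℝ) = s) :
    metric φ p u v = ∑ i, ∑ j, matB φ p i j * conn φ p i u * conn φ p j v
      + ∑ i, ∑ j, (matV φ p).adjugate i j * y i * z j + (matB φ p).det⁻¹ * r * s := by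
  obtain ⟨K, h1, h2, h3, hK⟩ := h.exists_regular_frame p
  have hD := h.mem_regularSet_iff.1 hp
  obtain ⟨a1, a2, a3, a4, a5⟩ := hK 0
  obtain ⟨b1, b2, b3, b4, b5⟩ := hK 1
  obtain ⟨c1, c2, c3, c4, c5⟩ := hK 2
  have e1 : (1 : Fin 3) + 1 = 2 := rfl
  have e2 : (1 : Fin 3) + 2 = 0 := rfl
  have e3 : (2 : Fin 3) + 1 = 0 := rfl
  have e4 : (2 : Fin 3) + 2 = 1 := rfl
  rw [e1, e2] at b1 b2 b3 b4 b5
  rw [e3, e4] at c1 c2 c3 c4 c5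
  rw [zero_add, zero_add] at a1 a2 a3 a4 a5
  have hB : ∀ i j, inner ℝ (K (gen i p)) (K (gen j p)) = matB φ p i j := fun i j => (h2 _ _).symm
  have hsym := h.matB_isSymm p
  rw [h2, a1.inner_eq (by rw [a2]; exact hD), h.adjugate_matV hp, a2]
  simp only [a3, a4, a5, b3, b5, c3, c5, hy, hz, hr, hs, hB, Matrix.smul_apply, smul_eq_mul,
    Fin.sum_univ_three]
  clear a1 a2 a3 a4 a5 b1 b2 b3 b4 b5 c1 c2 c3 c4 c5
  generalize (matB φ p).det = D at hD
  rw [hsym 1 0, hsym 2 0, hsym 2 1]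
  field_simp
  ring

end IsToricG2Manifold

theorem contDiffAt_adjugate {V : E7 → Matrix (Fin 3) (Fin 3) ℝ}
    (hV : ∀ i j, ContDiffAt ℝ ∞ (fun y => V y i j) x) (i j : Fin 3) :
    ContDiffAt ℝ ∞ (fun y => (V y).adjugate i j) x := by
  simp only [Matrix.adjugate_fin_three]
  have key : ∀ a b c d e f g k : Fin 3, ContDiffAt ℝ ∞
      (fun y => V y a b * V y c d - V y e f * V y g k) x := fun a b c d e f g k =>
    ((hV a b).mul (hV c d)).sub ((hV e f).mul (hV g k))
  have key' : ∀ a b c d e f g k : Fin 3, ContDiffAt ℝ ∞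
      (fun y => -(V y a b * V y c d) + V y e f * V y g k) x := fun a b c d e f g k =>
    ((hV a b).mul (hV c d)).neg.add ((hV e f).mul (hV g k))
  fin_cases i <;> fin_cases j <;> first | exact key _ _ _ _ _ _ _ _ | exact key' _ _ _ _ _ _ _ _

namespace IsActionChart

theorem dual_ni (H : IsActionChart ν μ Ψ O) (h : IsToricG2Manifold φ ν μ) (hx : x ∈ O)
    (i m : Fin 3) : pull (dual φ) Ψ x ![bv (si (i + 1)), bv (si (i + 2)), bv (ni (m + 1)),
      bv (ni (m + 2))] = -matV φ (Ψ x) i m := by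
  rw [pull_four, H.mfderiv_si hx, H.mfderiv_si hx, h.dual_gen (H.mem_regularSet x hx) i
    (H.mfderiv_nu h hx · _) (H.mfderiv_nu h hx · _) (H.mfderiv_mu h hx _) (H.mfderiv_mu h hx _)]
  fin_cases m <;> simp [ni, Fin.sum_univ_three]

variable [IsManifold (𝓡 7) ∞ M]

theorem toricCoordinates (H : IsActionChart ν μ Ψ O) (h : IsToricG2Manifold φ ν μ)
    {F : ℝ → Matrix (Fin 3) (Fin 3) ℝ} (hF : ∀ y ∈ O, matV φ (Ψ y) = F (y 6)) :
    ToricCoordinates O (pull φ Ψ) (pull (dual φ) Ψ)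
      (fun i a y => conn φ (Ψ y) i (mfderiv 𝓘(ℝ, E7) (𝓡 7) Ψ y (bv a)))
      (fun i j y => matV φ (Ψ y) i j) (fun i j y => (matV φ (Ψ y)).adjugate i j) := by
  have hc : ∀ x ∈ O, ∀ a : Fin 7, a ≠ 6 → ∀ᶠ τ : ℝ in 𝓝 0, matV φ (Ψ (x + τ • bv a)) =
      matV φ (Ψ x) := by
    intro x hx a ha
    have h1 : ContinuousAt (fun τ : ℝ => x + τ • bv a) 0 := by fun_prop
    filter_upwards [h1 (by simpa using H.isOpen.mem_nhds hx)] with τ hτ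
    rw [hF _ hτ, hF x hx]
    congr 1
    simp [ha.symm]
  exact
  { isOpen := H.isOpen
    convex := H.convex
    differentiable_phi := fun x hx => (pull_closed h.closed (H.smooth x hx)).1
    closed_phi := fun x hx => (pull_closed h.closed (H.smooth x hx)).2.1
    smooth_phi := fun x hx => (pull_closed h.closed (H.smooth x hx)).2.2
    invariant_phi := fun x hx => H.pderiv_pull h hx h.invariant
    differentiable_psi := fun x hx => (pull_closed h.coclosed (H.smooth x hx)).1
    closed_psi := fun x hx => (pull_closed h.coclosed (H.smooth x hx)).2.1
    smooth_psi := fun x hx => (pull_closed h.coclosed (H.smooth x hx)).2.2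
    invariant_psi := fun x hx => H.pderiv_pull h hx h.dual_invariant'
    -- The metric is only known to be continuous, so the smoothness of `V` is read off from
    -- components of the smooth form `*φ`.
    smooth_W := fun x hx => contDiffAt_adjugate fun i j => by
      refine ((pull_closed h.coclosed (H.smooth x hx)).2.2 ![bv (si (i + 1)), bv (si (i + 2)),
        bv (ni (j + 1)), bv (ni (j + 2))]).neg.congr_of_eventuallyEq ?_
      filter_upwards [H.isOpen.mem_nhds hx] with y hy
      rw [H.dual_ni h hy, neg_neg]
    pderiv_V := fun x hx i j a ha => pderiv_eq_zero_of_eventually_eq <| by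
      filter_upwards [hc x hx a ha] with τ hτ
      rw [hτ]
    pderiv_W := fun x hx i j a ha => pderiv_eq_zero_of_eventually_eq <| by
      filter_upwards [hc x hx a ha] with τ hτ
      rw [hτ]
    t_si := fun x hx i j => by
      simp only [H.mfderiv_si hx]; exact h.conn_gen (H.mem_regularSet x hx) i j
    phi_mu := fun x hx i l => by
      rw [pull_three, H.mfderiv_si hx, h.phi_gen (H.mem_regularSet x hx) i
        (H.mfderiv_nu h hx · _) (H.mfderiv_nu h hx · _) (H.mfderiv_mu h hx _) (H.mfderiv_mu h hx _)]
      fin_cases i <;> fin_cases l <;> simp [ni, Fin.sum_univ_three]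
    phi_nu := fun x hx i l m => by
      rw [pull_three, H.mfderiv_si hx, h.phi_gen (H.mem_regularSet x hx) i
        (H.mfderiv_nu h hx · _) (H.mfderiv_nu h hx · _) (H.mfderiv_mu h hx _) (H.mfderiv_mu h hx _)]
      fin_cases i <;> fin_cases l <;> fin_cases m <;> simp [ni]
    psi_mu := fun x hx i l => by
      rw [pull_four, H.mfderiv_si hx, H.mfderiv_si hx, h.dual_gen (H.mem_regularSet x hx) i
        (H.mfderiv_nu h hx · _) (H.mfderiv_nu h hx · _) (H.mfderiv_mu h hx _) (H.mfderiv_mu h hx _)]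
      fin_cases l <;> simp [ni, Fin.sum_univ_three]
    psi_nu := fun x hx i m => H.dual_ni h hx i m }

end IsActionChart

end Action

/-! ### Parametrizations as charts, and the local form `V = A + μ C`. -/

section Chart

theorem mem_contDiffGroupoid {g : OpenPartialHomeomorph E7 E7}
    (h1 : ∀ x ∈ g.source, ContDiffAt ℝ ∞ g x) (h2 : ∀ x ∈ g.target, ContDiffAt ℝ ∞ g.symm x) :
    g ∈ contDiffGroupoid ∞ (𝓡 7) := by
  rw [contDiffGroupoid, mem_groupoid_of_pregroupoid]
  constructor
  · intro x hx
    exact (h1 x hx.1).contDiffWithinAt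
  · intro x hx
    exact (h2 x hx.1).contDiffWithinAt

variable {M : Type*} [TopologicalSpace M] [ChartedSpace E7 M]

theorem trans_mem_maximalAtlas {e : OpenPartialHomeomorph M E7}
    (he : e ∈ IsManifold.maximalAtlas (𝓡 7) ∞ M) {g : OpenPartialHomeomorph E7 E7}
    (hg : g ∈ contDiffGroupoid ∞ (𝓡 7)) : e.trans g ∈ IsManifold.maximalAtlas (𝓡 7) ∞ M := by
  rw [IsManifold.maximalAtlas, mem_maximalAtlas_iff] at he ⊢
  intro e' he'
  refine ⟨?_, ?_⟩
  · rw [OpenPartialHomeomorph.trans_symm_eq_symm_trans_symm, OpenPartialHomeomorph.trans_assoc]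
    exact (contDiffGroupoid ∞ (𝓡 7)).trans ((contDiffGroupoid ∞ (𝓡 7)).symm hg) (he e' he').1
  · rw [← OpenPartialHomeomorph.trans_assoc]
    exact (contDiffGroupoid ∞ (𝓡 7)).trans (he e' he').2 hg

variable [IsManifold (𝓡 7) ∞ M]

/-- The inverse of a local parametrization of a manifold is a chart. -/
theorem exists_chart_symm_eq {Ψ : E7 → M} {x : E7} {N : Set E7} (hN : N ∈ 𝓝 x)
    (hΨ : ∀ y ∈ N, ContMDiffAt 𝓘(ℝ, E7) (𝓡 7) ∞ Ψ y)
    (hb : Function.Bijective (mfderiv 𝓘(ℝ, E7) (𝓡 7) Ψ x)) :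
    ∃ e ∈ IsManifold.maximalAtlas (𝓡 7) ∞ M, Ψ x ∈ e.source ∧ e (Ψ x) = x ∧ e.target ⊆ N ∧
      ∀ y ∈ e.target, e.symm y = Ψ y := by
  set c := chartAt E7 (Ψ x) with hc
  have hx := mem_of_mem_nhds hN
  have hΨx := mem_chart_source E7 (Ψ x)
  set f : E7 → E7 := fun y => c (Ψ y) with hf
  have hev : ∀ᶠ y in 𝓝 x, y ∈ N ∧ Ψ y ∈ c.source :=
    (show ∀ᶠ y in 𝓝 x, y ∈ N from hN).and ((hΨ x hx).continuousAt (c.open_source.mem_nhds hΨx))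
  obtain ⟨U, hU, hUo, hxU⟩ := eventually_nhds_iff.1 hev
  have hcm : ∀ q ∈ c.source, ContMDiffAt (𝓡 7) 𝓘(ℝ, E7) ∞ c q := fun q hq =>
    contMDiffAt_of_mem_maximalAtlas (IsManifold.chart_mem_maximalAtlas _) hq
  have hfs : ∀ y ∈ U, ContDiffAt ℝ ∞ f y := fun y hy =>
    (ContMDiffAt.comp y (hcm _ (hU y hy).2) (hΨ y (hU y hy).1)).contDiffAt
  have hfb : Function.Bijective (fderiv ℝ f x) := by
    have h1 := mfderiv_comp x ((hcm _ hΨx).mdifferentiableAt (by simp))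
      ((hΨ x hx).mdifferentiableAt (by simp))
    rw [← mfderiv_eq_fderiv]
    have h2 := mfderiv_extChartAt_bijective (Ψ x) (mem_extChartAt_source (I := 𝓡 7) (Ψ x))
    change Function.Bijective (mfderiv 𝓘(ℝ, E7) 𝓘(ℝ, E7) (c ∘ Ψ) x)
    rw [h1]
    exact h2.comp hb
  obtain ⟨L, hxL, hLf, hLs, hLs'⟩ := exists_smooth_openPartialHomeomorph
    (eventually_nhds_iff.2 ⟨U, hfs, hUo, hxU⟩) hfb
  set L' := L.restrOpen U hUo with hL'
  have hLf' : ∀ y, L' y = f y := hLf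
  have hg : L'.symm ∈ contDiffGroupoid ∞ (𝓡 7) :=
    (contDiffGroupoid ∞ (𝓡 7)).symm (mem_contDiffGroupoid (g := L')
      (fun y hy => (hLs y hy.1).congr_of_eventuallyEq (.of_forall hLf')) fun y hy => hLs' y hy.1)
  have hxL' : x ∈ L'.source := ⟨hxL, hxU⟩
  refine ⟨c.trans L'.symm, trans_mem_maximalAtlas (IsManifold.chart_mem_maximalAtlas _) hg,
    ⟨hΨx, ?_⟩, ?_, fun y hy => (hU y hy.1.2).1, fun y hy => ?_⟩
  · change f x ∈ L'.target
    rw [← hLf']; exact L'.map_source hxL'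
  · change L'.symm (f x) = x
    rw [← hLf']; exact L'.left_inv hxL'
  · change c.symm (L' y) = Ψ y
    rw [hLf']; exact c.left_inv (hU y hy.1.2).2

end Chart

section Action

variable {M : Type*} [TopologicalSpace M] [ChartedSpace E7 M] [IsManifold (𝓡 7) ∞ M]
  [MulAction T3 M] {φ : ∀ p : M, TangentSpace (𝓡 7) p [⋀^Fin 3]→L[ℝ] ℝ}
  {ν : M → Fin 3 → ℝ} {μ : M → ℝ}

/-- Near each regular point, `V` is an affine function of `μ`. -/
theorem IsToricG2Manifold.exists_local_affine (h : IsToricG2Manifold φ ν μ)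
    (hV : DependsOnlyOnMu φ μ) {p : M} (hp : p ∈ regularSet M) :
    ∃ A C : Matrix (Fin 3) (Fin 3) ℝ, ∀ᶠ q in 𝓝 p, matV φ q = A + μ q • C := by
  obtain ⟨F, hF⟩ := hV p hp
  obtain ⟨Ψ, O, x, H, hx, hΨx, hN⟩ := h.exists_isActionChart hp hF
  have hT := H.toricCoordinates h (F := F) fun y hy => by
    have : matV φ (Ψ y) = F (μ (Ψ y)) := hN y hy
    rw [this, H.mu_eq y hy]
  obtain ⟨A, C, hAC⟩ := hT.exists_affine
  refine ⟨A, C, ?_⟩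
  obtain ⟨e, -, hpe, -, he, hes⟩ := exists_chart_symm_eq (H.isOpen.mem_nhds hx) H.smooth
    (H.mfderiv_bijective h hx)
  rw [hΨx] at hpe
  filter_upwards [e.open_source.mem_nhds hpe] with q hq
  have h1 := e.map_source hq
  have h2 : q = Ψ (e q) := by rw [← hes _ h1, e.left_inv hq]
  ext i j
  have h3 := (hAC _ (he h1) i j).1
  rw [h2, H.mu_eq _ (he h1)]
  simpa using h3

end Action

open scoped MatrixOrder in
theorem exists_eq_transpose_mul_self {n : Type*} [Fintype n] [DecidableEq n] {B : Matrix n n ℝ}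
    (hB : B.PosSemidef) : ∃ R : Matrix n n ℝ, B = R.transpose * R := by
  refine ⟨CFC.sqrt B, ?_⟩
  have h1 := CFC.sqrt_mul_sqrt_self B hB.nonneg
  have h2 : (CFC.sqrt B).PosSemidef := Matrix.nonneg_iff_posSemidef.1 (CFC.sqrt_nonneg B)
  have h3 : (CFC.sqrt B).transpose = CFC.sqrt B := h2.1
  rw [h3, h1]

/-- A linear map to Euclidean space inducing the metric of a `G₂`-manifold with constant `B`. -/
theorem exists_linear_isometry {B : Matrix (Fin 3) (Fin 3) ℝ} (hB : B.PosSemidef) {k : ℝ}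
    (hk : 0 ≤ k) : ∃ T : (Fin 3 → ℝ) × E7 →L[ℝ] E7, ∀ a u b v, inner ℝ (T (a, u)) (T (b, v)) =
      ∑ i, ∑ j, B i j * a i * b j + k * (∑ i, ∑ j, B i j * u (ni i) * v (ni j) + u 6 * v 6) := by
  obtain ⟨R, rfl⟩ := exists_eq_transpose_mul_self hB
  obtain ⟨κ, rfl⟩ : ∃ κ : ℝ, k = κ * κ := ⟨Real.sqrt k, (Real.mul_self_sqrt hk).symm⟩
  -- With `B = Rᵀ R` and `k = κ²` the map is `(θ, ν, μ) ↦ (R θ, κ R ν, κ μ)`; the torus coordinates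
  -- of the second argument play no role.
  let g : (Fin 3 → ℝ) × E7 → Fin 7 → ℝ := fun z => ![R.mulVec z.1 0, R.mulVec z.1 1,
    R.mulVec z.1 2, κ * R.mulVec (fun j => z.2 (ni j)) 0, κ * R.mulVec (fun j => z.2 (ni j)) 1,
    κ * R.mulVec (fun j => z.2 (ni j)) 2, κ * z.2 6]
  let T₀ : (Fin 3 → ℝ) × E7 →ₗ[ℝ] E7 :=
  { toFun := fun z => WithLp.toLp 2 (g z)
    map_add' := fun x y => by
      ext i
      fin_cases i <;> simp [g, Matrix.mulVec, dotProduct, Fin.sum_univ_three] <;> ring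
    map_smul' := fun r x => by
      ext i
      fin_cases i <;> simp [g, Matrix.mulVec, dotProduct, Fin.sum_univ_three] <;> ring }
  refine ⟨LinearMap.toContinuousLinearMap T₀, fun a u b v => ?_⟩
  have hT : ∀ z i, T₀ z i = g z i := fun z i => rfl
  simp only [LinearMap.coe_toContinuousLinearMap', PiLp.inner_apply, hT]
  simp [g, Matrix.mulVec, dotProduct, Fin.sum_univ_succ, Matrix.mul_apply, ni]
  ring

/-! ### Closed connection forms and flat charts for constant `V`. -/

section Potential

variable {O : Set E7} {Φ : E7 → E7 [⋀^Fin 3]→L[ℝ] ℝ} {Θ : E7 → E7 [⋀^Fin 4]→L[ℝ] ℝ}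
  {t : Fin 3 → Fin 7 → E7 → ℝ} {V W : Fin 3 → Fin 3 → E7 → ℝ}

theorem E7_expand (v : E7) : v = ∑ k, v k • bv k := by
  ext j; simp [Pi.single_apply]

/-- Poincaré's lemma on the convex set `O`, applied to the connection form `∑ t_{ia} dx_a`. -/
theorem ToricCoordinates.exists_potential (h : ToricCoordinates O Φ Θ t V W)
    (hV : ∀ x ∈ O, ∀ i j, pderiv 6 (V i j) x = 0) (i : Fin 3) :
    ∃ f : E7 → ℝ, ∀ x ∈ O, ContDiffAt ℝ ∞ f x ∧
      HasFDerivAt f (∑ a, t i a x • (EuclideanSpace.proj a : E7 →L[ℝ] ℝ)) x := by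
  set w : E7 → E7 →L[ℝ] ℝ := fun x => ∑ a, t i a x • (EuclideanSpace.proj a : E7 →L[ℝ] ℝ) with hw
  have hws : ∀ x ∈ O, ContDiffAt ℝ ∞ w x := fun x hx =>
    ContDiffAt.sum fun a _ => (h.smooth_t hx i a).smul contDiffAt_const
  have hwd : ∀ x ∈ O, ∀ u v, fderiv ℝ w x u v = ∑ a, fderiv ℝ (t i a) x u * v a := by
    intro x hx u v
    have h1 : HasFDerivAt w (∑ a, (fderiv ℝ (t i a) x).smulRight
        (EuclideanSpace.proj a : E7 →L[ℝ] ℝ)) x :=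
      HasFDerivAt.fun_sum fun a _ =>
        HasFDerivAt.smul_const (F := E7 →L[ℝ] ℝ)
          ((h.smooth_t hx i a).differentiableAt (by simp)).hasFDerivAt _
    rw [h1.fderiv]
    simp
  have hsym : ∀ x ∈ O, ∀ u v, fderiv ℝ w x u v = fderiv ℝ w x v u := by
    have key : ∀ x ∈ O, ∀ u v, fderiv ℝ w x u v =
        ∑ b, ∑ a, pderiv b (t i a) x * u b * v a := by
      intro x hx u v
      have : ∀ a, fderiv ℝ (t i a) x u = ∑ b, u b * pderiv b (t i a) x := fun a => by
        conv_lhs => rw [E7_expand u, map_sum]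
        simp [pderiv]
      rw [hwd x hx, Finset.sum_comm]
      refine Finset.sum_congr rfl fun a _ => ?_
      rw [this, Finset.sum_mul]
      exact Finset.sum_congr rfl fun b _ => by ring
    intro x hx u v
    rw [key x hx, key x hx, Finset.sum_comm]
    refine Finset.sum_congr rfl fun a _ => Finset.sum_congr rfl fun b _ => ?_
    rw [h.pderiv_t_symm hV hx]; ring
  obtain ⟨f, hf⟩ := h.convex.exists_forall_hasFDerivAt_of_fderiv_symmetric h.isOpen
    (fun x hx => ((hws x hx).differentiableAt (by simp)).differentiableWithinAt) hsym
  refine ⟨f, fun x hx => ⟨?_, hf x hx⟩⟩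
  refine ContDiffOn.contDiffAt (s := O) ?_ (h.isOpen.mem_nhds hx)
  refine (contDiffOn_infty_iff_fderiv_of_isOpen h.isOpen).2
    ⟨fun y hy => (hf y hy).differentiableAt.differentiableWithinAt, ?_⟩
  exact ContDiffOn.congr (fun y hy => (hws y hy).contDiffWithinAt) fun y hy => (hf y hy).fderiv

end Potential

section Action

variable {M : Type*} [TopologicalSpace M] [ChartedSpace E7 M]
  [MulAction T3 M] {φ : ∀ p : M, TangentSpace (𝓡 7) p [⋀^Fin 3]→L[ℝ] ℝ}
  {ν : M → Fin 3 → ℝ} {μ : M → ℝ}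

theorem IsToricG2Manifold.conn_sum (h : IsToricG2Manifold φ ν μ) {p : M} (D : E7 →L[ℝ] TangentSpace (𝓡 7) p)
    (i : Fin 3) (v : E7) : conn φ p i (D v) = ∑ a, conn φ p i (D (bv a)) * v a := by
  obtain ⟨K, -, hK, -⟩ := h.exists_adapted_frame p
  simp only [conn, hK]
  conv_lhs => rw [E7_expand v]
  simp only [map_sum, map_smul, inner_sum, inner_smul_right, Finset.mul_sum, Finset.sum_mul]
  rw [Finset.sum_comm]
  exact Finset.sum_congr rfl fun a _ => Finset.sum_congr rfl fun j _ => by ring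

variable [IsManifold (𝓡 7) ∞ M]

/-- Where `V` is constant, the metric is flat. -/
theorem IsToricG2Manifold.exists_isometric_chart (h : IsToricG2Manifold φ ν μ) {p : M}
    (hp : p ∈ regularSet M) {A : Matrix (Fin 3) (Fin 3) ℝ} (hA : ∀ᶠ q in 𝓝 p, matV φ q = A) :
    ∃ f ∈ IsManifold.maximalAtlas (𝓡 7) ∞ M, p ∈ f.source ∧
      ∀ q ∈ f.source, ∀ u v : TangentSpace (𝓡 7) q,
      @inner ℝ E7 _ (mfderiv (𝓡 7) 𝓘(ℝ, E7) f q u) (mfderiv (𝓡 7) 𝓘(ℝ, E7) f q v)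
        = metric φ q u v := by
  obtain ⟨Ψ, O, x, H, hx, hΨx, hN⟩ := h.exists_isActionChart hp hA
  have hN' : ∀ y ∈ O, matV φ (Ψ y) = A := hN
  have hT := H.toricCoordinates h (F := fun _ => A) hN'
  have hC : ∀ y ∈ O, ∀ i j, pderiv 6 (fun y => matV φ (Ψ y) i j) y = 0 := fun y hy i j => by
    rw [pderiv_congr H.isOpen hy (fun z hz => by rw [hN' z hz]), pderiv_const]
  choose f hf using fun i => hT.exists_potential hC i
  set B : Matrix (Fin 3) (Fin 3) ℝ := matB φ (Ψ x) with hBdef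
  have hB : ∀ y ∈ O, matB φ (Ψ y) = B := by
    have h1 : ∀ y ∈ O, matB φ (Ψ y) = A⁻¹ := fun y hy => by
      rw [← hN' y hy, matV,
        Matrix.nonsing_inv_nonsing_inv _ (h.isUnit_det_matB (H.mem_regularSet y hy))]
    intro y hy
    rw [hBdef, h1 y hy, h1 x hx]
  have hBpos : B.PosDef := h.posDef_matB (H.mem_regularSet x hx)
  obtain ⟨T, hT'⟩ := exists_linear_isometry hBpos.posSemidef (inv_nonneg.2 hBpos.det_pos.le)
  -- As `df_i = θ_i`, the derivative of `F` is `T` applied to `(θ, dν, dμ)`. With `k = 1 / det B`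
  -- the pullback of the Euclidean metric is the expression in `metric_eq`.
  set F : E7 → E7 := fun y => T (fun i => f i y, y) with hF
  have hFs : ∀ y ∈ O, ContDiffAt ℝ ∞ F y := fun y hy =>
    T.contDiff.contDiffAt.comp y ((contDiffAt_pi.2 fun i => (hf i y hy).1).prodMk contDiffAt_id)
  have hFd : ∀ y ∈ O, ∀ v, fderiv ℝ F y v =
      T (fun i => conn φ (Ψ y) i (mfderiv 𝓘(ℝ, E7) (𝓡 7) Ψ y v), v) := by
    intro y hy v
    have h1 := (T.hasFDerivAt (x := (fun i => f i y, y))).comp y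
      (f := fun y => (fun i => f i y, y))
      ((hasFDerivAt_pi.2 fun i => (hf i y hy).2).prodMk (hasFDerivAt_id y))
    rw [show fderiv ℝ F y = _ from h1.fderiv]
    simp only [ContinuousLinearMap.comp_apply, ContinuousLinearMap.prod_apply,
      ContinuousLinearMap.id_apply]
    congr 2
    funext i
    refine Eq.trans ?_ (h.conn_sum (mfderiv 𝓘(ℝ, E7) (𝓡 7) Ψ y) i v).symm
    simp only [ContinuousLinearMap.pi_apply, _root_.sum_apply,
      _root_.smul_apply, smul_eq_mul, PiLp.proj_apply]
    rfl
  have hiso : ∀ y ∈ O, ∀ u v, inner ℝ (fderiv ℝ F y u) (fderiv ℝ F y v) =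
      metric φ (Ψ y) (mfderiv 𝓘(ℝ, E7) (𝓡 7) Ψ y u) (mfderiv 𝓘(ℝ, E7) (𝓡 7) Ψ y v) := by
    intro y hy u v
    have hy' := H.mem_regularSet y hy
    rw [hFd y hy, hFd y hy, hT', h.metric_eq hy' (H.mfderiv_nu h hy · _) (H.mfderiv_nu h hy · _)
      (H.mfderiv_mu h hy _) (H.mfderiv_mu h hy _), h.adjugate_matV hy', hB y hy]
    simp only [Matrix.smul_apply, smul_eq_mul, Fin.sum_univ_three]
    ring
  have hFb : ∀ y ∈ O, Function.Bijective (fderiv ℝ F y) := fun y hy => by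
    have hinj : Function.Injective (fderiv ℝ F y).toLinearMap := by
      refine (injective_iff_map_eq_zero _).2 fun v hv => ?_
      by_contra hv0
      have h1 : mfderiv 𝓘(ℝ, E7) (𝓡 7) Ψ y v ≠ 0 := fun h0 =>
        hv0 ((H.mfderiv_bijective h hy).1 (h0.trans (map_zero _).symm))
      have h2 := innerOf_self_pos (h.adapted (Ψ y)) h1
      have h3 := hiso y hy v v
      rw [show fderiv ℝ F y v = 0 from hv, inner_zero_left] at h3
      exact h2.ne h3
    exact ⟨hinj, LinearMap.injective_iff_surjective.1 hinj⟩
  obtain ⟨e, heM, hpe, hex, he, hes⟩ := exists_chart_symm_eq (H.isOpen.mem_nhds hx) H.smooth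
    (H.mfderiv_bijective h hx)
  have hO : ∀ᶠ y in 𝓝 x, ContDiffAt ℝ ∞ F y := by
    filter_upwards [H.isOpen.mem_nhds hx] with y hy using hFs y hy
  obtain ⟨L, hxL, hLF, hLs, hLs'⟩ := exists_smooth_openPartialHomeomorph hO (hFb x hx)
  refine ⟨e.trans L, trans_mem_maximalAtlas heM (mem_contDiffGroupoid
    (fun y hy => (hLs y hy).congr_of_eventuallyEq (.of_forall hLF)) hLs'), ?_, fun q hq u v => ?_⟩
  · rw [← hΨx]
    exact ⟨hpe, (congrArg (· ∈ L.source) hex).mpr hxL⟩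
  · have hqe : q ∈ e.source := hq.1
    have hy := he (e.map_source hqe)
    have he1 : MDifferentiableAt (𝓡 7) 𝓘(ℝ, E7) e q :=
      (contMDiffAt_of_mem_maximalAtlas heM hqe).mdifferentiableAt (by simp)
    have hq' : Ψ (e q) = q := by rw [← hes _ (e.map_source hqe), e.left_inv hqe]
    have h1 : ∀ u, mfderiv (𝓡 7) 𝓘(ℝ, E7) (e.trans L) q u =
        fderiv ℝ F (e q) (mfderiv (𝓡 7) 𝓘(ℝ, E7) e q u) := fun u => by
      have h2 : (e.trans L : M → E7) = F ∘ e := funext fun z => hLF _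
      have h3 : HasMFDerivAt 𝓘(ℝ, E7) 𝓘(ℝ, E7) F (e q) (fderiv ℝ F (e q)) :=
        ((hFs _ hy).differentiableAt (by simp)).hasFDerivAt.hasMFDerivAt
      rw [h2, (h3.comp q he1.hasMFDerivAt).mfderiv]
      rfl
    have h4 : ∀ u : E7, (mfderiv 𝓘(ℝ, E7) (𝓡 7) Ψ (e q) (mfderiv (𝓡 7) 𝓘(ℝ, E7) e q u) : E7) = u := by
      intro u
      have h5 : Ψ ∘ e =ᶠ[𝓝 q] id := by
        filter_upwards [e.open_source.mem_nhds hqe] with z hz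
        change Ψ (e z) = z
        rw [← hes _ (e.map_source hz), e.left_inv hz]
      have h6 := ((H.mdifferentiableAt hy).hasMFDerivAt.comp q he1.hasMFDerivAt).mfderiv
      rw [h5.mfderiv_eq, mfderiv_id] at h6
      exact (DFunLike.congr_fun h6 u).symm
    rw [h1, h1]
    refine (hiso _ hy _ _).trans ?_
    have h7 : ∀ z, z = q → ∀ u v u' v' : E7, u' = u → v' = v →
        metric φ z (u' : E7) (v' : E7) = metric φ q (u : E7) (v : E7) := by
      rintro z rfl u v u' v' rfl rfl; rfl
    exact h7 _ hq' _ _ _ _ (h4 u) (h4 v)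

end Action

/-! ### Vanishing curvature of a pulled-back Euclidean metric. -/

section FlatCoordinates

/-- The partial derivative `∂_a F` of a map of `ℝ⁷` to itself. -/
def vderiv (a : Fin 7) (F : E7 → E7) (y : E7) : E7 := fderiv ℝ F y (bv a)

theorem contDiffAt_vderiv {F : E7 → E7} {y : E7} (hF : ContDiffAt ℝ ∞ F y) (a : Fin 7) :
    ContDiffAt ℝ ∞ (vderiv a F) y := by
  have h : ContDiffAt ℝ ∞ (fderiv ℝ F) y := hF.fderiv_right (by simp)
  exact h.clm_apply contDiffAt_const

theorem vderiv_comm {F : E7 → E7} {y : E7} (hF : ContDiffAt ℝ ∞ F y) (a b : Fin 7) :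
    vderiv a (vderiv b F) y = vderiv b (vderiv a F) y := by
  have h : DifferentiableAt ℝ (fderiv ℝ F) y :=
    (hF.fderiv_right (m := ∞) (by simp)).differentiableAt (by simp)
  have key : ∀ a b, vderiv a (vderiv b F) y = fderiv ℝ (fderiv ℝ F) y (bv a) (bv b) := by
    intro a b
    change fderiv ℝ (fun y => fderiv ℝ F y (bv b)) y (bv a) = _
    rw [fderiv_clm_apply h (differentiableAt_const _)]
    simp
  rw [key, key]
  exact (hF.isSymmSndFDerivAt (by
    simpa using (mod_cast le_top : ((2 : ℕ∞) : WithTop ℕ∞) ≤ ∞))).eq _ _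

theorem pderiv_inner {u v : E7 → E7} {y : E7} (hu : DifferentiableAt ℝ u y)
    (hv : DifferentiableAt ℝ v y) (a : Fin 7) :
    pderiv a (fun z => inner ℝ (u z) (v z)) y =
      inner ℝ (u y) (vderiv a v y) + inner ℝ (vderiv a u y) (v y) :=
  fderiv_inner_apply ℝ hu hv (bv a)

/-- The coefficients of the pullback of the Euclidean metric. -/
def pullbackMetric (F : E7 → E7) (y : E7) : Matrix (Fin 7) (Fin 7) ℝ :=
  Matrix.of fun i j => inner ℝ (vderiv i F y) (vderiv j F y)

variable {F : E7 → E7} {U : Set E7} {y : E7}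

theorem linearIndependent_vderiv (hb : Function.Bijective (fderiv ℝ F y)) :
    LinearIndependent ℝ fun a => vderiv a F y := by
  have h1 : LinearIndependent ℝ (bv : Fin 7 → E7) := by
    have e : (bv : Fin 7 → E7) = (EuclideanSpace.basisFun (Fin 7) ℝ).toBasis := by
      ext a : 1
      simp
    rw [e]
    exact (EuclideanSpace.basisFun (Fin 7) ℝ).toBasis.linearIndependent
  exact h1.map' (fderiv ℝ F y).toLinearMap (LinearMap.ker_eq_bot.2 hb.1)

/-- For `g_{ij} = ⟨∂_i F, ∂_j F⟩` the Christoffel combination of derivatives collapses to `2 ⟨∂_i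
∂_j F, ∂_m F⟩`. So the symbols are the coefficients of `∂_i ∂_j F` in the frame `∂_k F`. -/
theorem christoffel_pullbackMetric (hF : ContDiffAt ℝ ∞ F y) (hb : Function.Bijective (fderiv ℝ F y))
    {c : Fin 7 → ℝ} {i j : Fin 7} (hc : vderiv i (vderiv j F) y = ∑ k, c k • vderiv k F y)
    (l : Fin 7) : christoffel (pullbackMetric F) l i j y = c l := by
  have hd : ∀ a, DifferentiableAt ℝ (vderiv a F) y := fun a =>
    (contDiffAt_vderiv hF a).differentiableAt (by simp)
  have h1 : ∀ m, (pderiv i (fun z => pullbackMetric F z j m) y +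
      pderiv j (fun z => pullbackMetric F z i m) y - pderiv m (fun z => pullbackMetric F z i j) y) =
      2 * ∑ k, c k * pullbackMetric F y k m := by
    intro m
    simp only [pullbackMetric, Matrix.of_apply]
    have e : ∑ k, c k * inner ℝ (vderiv k F y) (vderiv m F y) =
        inner ℝ (vderiv i (vderiv j F) y) (vderiv m F y) := by
      rw [hc, sum_inner]
      simp only [real_inner_smul_left]
    rw [e, pderiv_inner (hd j) (hd m), pderiv_inner (hd i) (hd m), pderiv_inner (hd i) (hd j),
      vderiv_comm hF m i, vderiv_comm hF m j, vderiv_comm hF j i,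
      real_inner_comm (vderiv i (vderiv m F) y) (vderiv j F y)]
    ring
  have hdet : IsUnit (pullbackMetric F y).det := by
    rw [isUnit_iff_ne_zero]
    exact (Matrix.posDef_gram_of_linearIndependent (linearIndependent_vderiv hb)).det_pos.ne'
  have hsymm : ∀ k m, pullbackMetric F y k m = pullbackMetric F y m k := fun k m => by
    simp only [pullbackMetric, Matrix.of_apply, real_inner_comm (vderiv k F y)]
  simp only [christoffel, h1]
  have h2 : ∀ m, (pullbackMetric F y)⁻¹ l m * (2 * ∑ k, c k * pullbackMetric F y k m) / 2 =
      ∑ k, (pullbackMetric F y)⁻¹ l m * pullbackMetric F y m k * c k := fun m => by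
    have e : ∀ a b : ℝ, a * (2 * b) / 2 = a * b := fun a b => by ring
    rw [e, Finset.mul_sum]
    exact Finset.sum_congr rfl fun k _ => by rw [hsymm]; ring
  simp only [h2]
  rw [Finset.sum_comm]
  simp only [← Finset.sum_mul, ← Matrix.mul_apply, Matrix.nonsing_inv_mul _ hdet]
  simp [Matrix.one_apply]

/-- Expand `∂_i ∂_j ∂_k F` in the frame `∂_l F`: the curvature coefficients are exactly the
difference of the expansions for the orders `ij` and `ji`, which agree. -/
theorem curvature_pullbackMetric (hU : IsOpen U) (hy : y ∈ U) (hF : ∀ z ∈ U, ContDiffAt ℝ ∞ F z)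
    (hb : ∀ z ∈ U, Function.Bijective (fderiv ℝ F z)) (l k i j : Fin 7) :
    curvature (pullbackMetric F) l k i j y = 0 := by
  set Γ := christoffel (pullbackMetric F) with hΓ
  have hexp : ∀ z ∈ U, ∀ i j, vderiv i (vderiv j F) z = ∑ k, Γ k i j z • vderiv k F z ∧
      ∀ k, Γ k i j z = (ContinuousLinearMap.inverse (fderiv ℝ F z) (vderiv i (vderiv j F) z)) k := by
    intro z hz i j
    let A : E7 ≃L[ℝ] E7 :=
      (LinearEquiv.ofBijective (fderiv ℝ F z).toLinearMap (hb z hz)).toContinuousLinearEquiv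
    have hA : (A : E7 →L[ℝ] E7) = fderiv ℝ F z := by ext v; rfl
    set w := A.symm (vderiv i (vderiv j F) z) with hw
    have h1 : vderiv i (vderiv j F) z = ∑ k, w k • vderiv k F z := by
      have h2 : vderiv i (vderiv j F) z = A w := (A.apply_symm_apply _).symm
      conv_lhs => rw [h2, E7_expand w, map_sum]
      exact Finset.sum_congr rfl fun k _ => map_smul _ _ _
    have h3 : ∀ k, Γ k i j z = w k := christoffel_pullbackMetric (hF z hz) (hb z hz) h1
    refine ⟨by simp only [h3]; exact h1, fun k => ?_⟩
    rw [h3, ← hA, ContinuousLinearMap.inverse_equiv]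
    rfl
  -- Writing the symbols as components of `(DF)⁻¹ ∂_i ∂_j F` gives their differentiability from
  -- smoothness of operator inversion.
  have hdΓ : ∀ k i j, DifferentiableAt ℝ (Γ k i j) y := by
    intro k i j
    have h1 : ContDiffAt ℝ ∞ (fun z => (ContinuousLinearMap.inverse (fderiv ℝ F z)
        (vderiv i (vderiv j F) z)) k) y := by
      let A : E7 ≃L[ℝ] E7 :=
        (LinearEquiv.ofBijective (fderiv ℝ F y).toLinearMap (hb y hy)).toContinuousLinearEquiv
      have hA : (A : E7 →L[ℝ] E7) = fderiv ℝ F y := by ext v; rfl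
      have h2 : ContDiffAt ℝ ∞ (fun z => ContinuousLinearMap.inverse (fderiv ℝ F z)) y := by
        refine ContDiffAt.comp y (g := ContinuousLinearMap.inverse) ?_
          ((hF y hy).fderiv_right (m := ∞) (by simp))
        rw [← hA]
        exact contDiffAt_map_inverse A
      exact (EuclideanSpace.proj k : E7 →L[ℝ] ℝ).contDiff.contDiffAt.comp y
        (h2.clm_apply (contDiffAt_vderiv (contDiffAt_vderiv (hF y hy) j) i))
    refine (h1.differentiableAt (by simp)).congr_of_eventuallyEq ?_
    filter_upwards [hU.mem_nhds hy] with z hz using (hexp z hz i j).2 k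
  have hd : ∀ a, DifferentiableAt ℝ (vderiv a F) y := fun a =>
    (contDiffAt_vderiv (hF y hy) a).differentiableAt (by simp)
  have h3 : ∀ i j k, vderiv i (vderiv j (vderiv k F)) y =
      ∑ l, (pderiv i (Γ l j k) y + ∑ m, Γ l i m y * Γ m j k y) • vderiv l F y := by
    intro i j k
    have h4 : HasFDerivAt (vderiv j (vderiv k F)) (∑ l, (Γ l j k y • fderiv ℝ (vderiv l F) y +
        (fderiv ℝ (Γ l j k) y).smulRight (vderiv l F y))) y := by
      refine (HasFDerivAt.fun_sum fun l _ => (hdΓ l j k).hasFDerivAt.smul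
        (hd l).hasFDerivAt).congr_of_eventuallyEq ?_
      filter_upwards [hU.mem_nhds hy] with z hz using (hexp z hz j k).1
    rw [vderiv, h4.fderiv]
    simp only [_root_.sum_apply, _root_.add_apply, _root_.smul_apply,
      ContinuousLinearMap.smulRight_apply, add_smul, Finset.sum_add_distrib]
    rw [add_comm]
    congr 1
    have h5 : ∀ l, fderiv ℝ (vderiv l F) y (bv i) = ∑ m, Γ m i l y • vderiv m F y := fun l =>
      (hexp y hy i l).1
    simp only [h5, Finset.smul_sum, Finset.sum_smul, smul_smul]
    rw [Finset.sum_comm]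
    exact Finset.sum_congr rfl fun l _ => Finset.sum_congr rfl fun m _ => by rw [mul_comm]
  have h6 := vderiv_comm (contDiffAt_vderiv (hF y hy) k) i j
  rw [h3, h3, ← sub_eq_zero, ← Finset.sum_sub_distrib] at h6
  simp only [← sub_smul] at h6
  have h7 := Fintype.linearIndependent_iff.1 (linearIndependent_vderiv (hb y hy)) _ h6 l
  rw [curvature, Finset.sum_sub_distrib]
  linarith

end FlatCoordinates

section Flat

theorem christoffel_congr {G G' : E7 → Matrix (Fin 7) (Fin 7) ℝ} {U : Set E7} (hU : IsOpen U)
    (h : ∀ z ∈ U, G z = G' z) {y : E7} (hy : y ∈ U) (l i j : Fin 7) :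
    christoffel G l i j y = christoffel G' l i j y := by
  have h1 : ∀ a i j, pderiv a (fun z => G z i j) y = pderiv a (fun z => G' z i j) y :=
    fun a i j => pderiv_congr hU hy (fun z hz => by rw [h z hz]) a
  simp only [christoffel, h1, h y hy]

theorem curvature_congr {G G' : E7 → Matrix (Fin 7) (Fin 7) ℝ} {U : Set E7} (hU : IsOpen U)
    (h : ∀ z ∈ U, G z = G' z) {y : E7} (hy : y ∈ U) (l k i j : Fin 7) :
    curvature G l k i j y = curvature G' l k i j y := by
  have h1 : ∀ l i j, ∀ z ∈ U, christoffel G l i j z = christoffel G' l i j z :=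
    fun l i j z hz => christoffel_congr hU h hz l i j
  have h2 : ∀ a l i j, pderiv a (christoffel G l i j) y = pderiv a (christoffel G' l i j) y :=
    fun a l i j => pderiv_congr hU hy (h1 l i j) a
  simp only [curvature, h2, h1 _ _ _ y hy]

variable {M : Type*} [TopologicalSpace M] [ChartedSpace E7 M] [IsManifold (𝓡 7) ∞ M]
  {φ : ∀ p : M, TangentSpace (𝓡 7) p [⋀^Fin 3]→L[ℝ] ℝ}

theorem IsLocallyIsometricToE7.isFlat (h : IsLocallyIsometricToE7 φ)
    (hφ : ∀ p, ∃ L : E7 ≃L[ℝ] TangentSpace (𝓡 7) p, IsAdapted (φ p) L) : IsFlat φ := by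
  intro x₀ y hy l k i j
  set c := extChartAt (𝓡 7) x₀ with hc
  obtain ⟨f, hfM, hyf, hf⟩ := h (c.symm y)
  set U := c.target ∩ c.symm ⁻¹' f.source with hU
  have hUo : IsOpen U :=
    (continuousOn_extChartAt_symm x₀).isOpen_inter_preimage (isOpen_extChartAt_target x₀)
      f.open_source
  set F : E7 → E7 := fun z => f (c.symm z) with hF
  have hfs : ∀ z ∈ U, ContMDiffAt (𝓡 7) 𝓘(ℝ, E7) ∞ f (c.symm z) := fun z hz =>
    contMDiffAt_of_mem_maximalAtlas hfM hz.2
  have hFs : ∀ z ∈ U, ContDiffAt ℝ ∞ F z := fun z hz =>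
    (ContMDiffAt.comp z (hfs z hz) (contMDiffAt_extChartAt_symm x₀ hz.1)).contDiffAt
  have hFd : ∀ z ∈ U, ∀ v, fderiv ℝ F z v = (mfderiv (𝓡 7) 𝓘(ℝ, E7) f (c.symm z)
      (mfderiv 𝓘(ℝ, E7) (𝓡 7) c.symm z v) : E7) := fun z hz v =>
    mfderiv_comp_extChartAt_symm hz.1 ((hfs z hz).mdifferentiableAt (by simp)) v
  have hiso : ∀ z ∈ U, ∀ u v, inner ℝ (fderiv ℝ F z u) (fderiv ℝ F z v) =
      metric φ (c.symm z) (mfderiv 𝓘(ℝ, E7) (𝓡 7) c.symm z u)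
        (mfderiv 𝓘(ℝ, E7) (𝓡 7) c.symm z v) := fun z hz u v => by
    rw [hFd z hz, hFd z hz]
    exact hf _ hz.2 _ _
  have hFb : ∀ z ∈ U, Function.Bijective (fderiv ℝ F z) := fun z hz => by
    have hinj : Function.Injective (fderiv ℝ F z).toLinearMap := by
      refine (injective_iff_map_eq_zero _).2 fun v hv => ?_
      by_contra hv0
      have h1 : mfderiv 𝓘(ℝ, E7) (𝓡 7) c.symm z v ≠ 0 := fun h0 =>
        hv0 ((mfderiv_extChartAt_symm_bijective x₀ hz.1).1 (h0.trans (map_zero _).symm))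
      have h2 := innerOf_self_pos (hφ (c.symm z)) h1
      have h3 := hiso z hz v v
      rw [show fderiv ℝ F z v = 0 from hv, inner_zero_left] at h3
      exact h2.ne h3
    exact ⟨hinj, LinearMap.injective_iff_surjective.1 hinj⟩
  rw [curvature_congr hUo (G' := pullbackMetric F) (fun z hz => ?_) ⟨hy, hyf⟩]
  · exact curvature_pullbackMetric hUo ⟨hy, hyf⟩ hFs hFb l k i j
  · ext a b
    exact (hiso z hz _ _).symm

end Flat

/-! ### The Riemannian distance and a criterion of unboundedness in complete spaces. -/

section Distance

theorem innerOf_smul_smul {W : Type*} [AddCommGroup W] [Module ℝ W] [TopologicalSpace W]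
    {φ : W [⋀^Fin 3]→L[ℝ] ℝ} (h : ∃ L : E7 ≃L[ℝ] W, IsAdapted φ L) (r : ℝ) (u : W) :
    innerOf φ (r • u) (r • u) = r ^ 2 * innerOf φ u u := by
  obtain ⟨K, -, h2, -⟩ := exists_adapted_coordinates h
  rw [h2, h2, map_smul, real_inner_smul_left, real_inner_smul_right]
  ring

variable {M : Type*} [TopologicalSpace M] [ChartedSpace E7 M]
  {φ : ∀ p : M, TangentSpace (𝓡 7) p [⋀^Fin 3]→L[ℝ] ℝ}

/-- The length of a tangent vector. -/
abbrev metricENorm (φ : ∀ p : M, TangentSpace (𝓡 7) p [⋀^Fin 3]→L[ℝ] ℝ) (p : M) :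
    ENorm (TangentSpace (𝓡 7) p) :=
  ⟨fun v => ENNReal.ofReal (Real.sqrt (metric φ p v v))⟩

theorem enormSMulClass (hφ : ∀ p, ∃ L : E7 ≃L[ℝ] TangentSpace (𝓡 7) p, IsAdapted (φ p) L) (p : M) :
    letI := metricENorm φ p
    ENormSMulClass ℝ (TangentSpace (𝓡 7) p) := by
  let _ := metricENorm φ p
  refine ⟨fun r v => ?_⟩
  change ENNReal.ofReal (Real.sqrt (innerOf (φ p) (r • v) (r • v))) =
    ‖r‖ₑ * ENNReal.ofReal (Real.sqrt (innerOf (φ p) v v))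
  rw [innerOf_smul_smul (hφ p), Real.sqrt_mul (sq_nonneg r), Real.sqrt_sq_eq_abs,
    ENNReal.ofReal_mul (abs_nonneg r), ← Real.enorm_eq_ofReal_abs]

theorem riemDist_comm (hφ : ∀ p, ∃ L : E7 ≃L[ℝ] TangentSpace (𝓡 7) p, IsAdapted (φ p) L) (x y : M) :
    riemDist φ x y = riemDist φ y x := by
  let _ := fun p => metricENorm φ p
  have := fun p => enormSMulClass hφ p
  exact Manifold.riemannianEDist_comm (I := 𝓡 7)

theorem riemDist_triangle (hφ : ∀ p, ∃ L : E7 ≃L[ℝ] TangentSpace (𝓡 7) p, IsAdapted (φ p) L)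
    (x y z : M) : riemDist φ x z ≤ riemDist φ x y + riemDist φ y z := by
  let _ := fun p => metricENorm φ p
  have := fun p => enormSMulClass hφ p
  exact Manifold.riemannianEDist_triangle (I := 𝓡 7)

/-- The distance between the end points of a segment in local coordinates. -/
theorem riemDist_le_of_segment (hφ : ∀ p, ∃ L : E7 ≃L[ℝ] TangentSpace (𝓡 7) p, IsAdapted (φ p) L)
    {Ψ : E7 → M} {x w : E7} {k : ℝ} (hk : 0 ≤ k)
    (hΨ : ∀ s ∈ Set.Icc (0 : ℝ) 1, ContMDiffAt 𝓘(ℝ, E7) (𝓡 7) ∞ Ψ (x + s • w) ∧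
      Function.Bijective (mfderiv 𝓘(ℝ, E7) (𝓡 7) Ψ (x + s • w)) ∧
      innerOf (pull φ Ψ (x + s • w)) w w ≤ k ^ 2) :
    riemDist φ (Ψ x) (Ψ (x + w)) ≤ ENNReal.ofReal k := by
  let _ := fun p => metricENorm φ p
  have := fun p => enormSMulClass hφ p
  set γ : ℝ → M := fun s => Ψ (x + s • w) with hγ
  have h1 : riemDist φ (Ψ x) (Ψ (x + w)) ≤ Manifold.pathELength (𝓡 7) γ 0 1 := by
    refine Manifold.riemannianEDist_le_pathELength (I := 𝓡 7) (γ := γ) (fun s hs => ?_)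
      (by simp [hγ]) (by simp [hγ]) zero_le_one
    refine ContMDiffAt.contMDiffWithinAt ?_
    refine ContMDiffAt.comp s (f := fun s : ℝ => x + s • w) ((hΨ s hs).1.of_le (by simp)) ?_
    exact (by fun_prop : ContDiff ℝ 1 fun s : ℝ => x + s • w).contDiffAt.contMDiffAt
  refine h1.trans ?_
  rw [Manifold.pathELength_eq_lintegral_mfderiv_Icc]
  have h2 : ∀ s ∈ Set.Icc (0 : ℝ) 1, ‖mfderiv 𝓘(ℝ, ℝ) (𝓡 7) γ s (1 : ℝ)‖ₑ ≤ ENNReal.ofReal k := by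
    intro s hs
    obtain ⟨a1, a2, a3⟩ := hΨ s hs
    have h3 : HasFDerivAt (fun s : ℝ => x + s • w)
        ((ContinuousLinearMap.id ℝ ℝ).smulRight w) s :=
      ((hasFDerivAt_id s).smul_const w).const_add x
    have h4 := (HasMFDerivAt.comp s (f := fun s : ℝ => x + s • w)
      (a1.mdifferentiableAt (by simp)).hasMFDerivAt h3.hasMFDerivAt).mfderiv
    have h5 : mfderiv 𝓘(ℝ, ℝ) (𝓡 7) γ s (1 : ℝ) = mfderiv 𝓘(ℝ, E7) (𝓡 7) Ψ (x + s • w) w := by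
      refine (DFunLike.congr_fun h4 (1 : ℝ)).trans ?_
      change mfderiv 𝓘(ℝ, E7) (𝓡 7) Ψ (x + s • w) ((1 : ℝ) • w) = _
      rw [one_smul]
    refine ENNReal.ofReal_le_ofReal ?_
    rw [innerOf_pull hφ a2] at a3
    rw [h5]
    exact Real.sqrt_le_iff.2 ⟨hk, a3⟩
  refine (MeasureTheory.setLIntegral_mono' measurableSet_Icc h2).trans ?_
  simp

variable [IsManifold (𝓡 7) ∞ M]

/-- Short coordinate segments are short by continuity of the metric. Only this half of the
comparison of topologies is needed, since completeness is stated with convergence in `M`. -/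
theorem eventually_riemDist_le (hφ : ∀ p, ∃ L : E7 ≃L[ℝ] TangentSpace (𝓡 7) p, IsAdapted (φ p) L)
    (hc : IsClosedForm φ) (p : M) {ε : ℝ} (hε : 0 < ε) :
    ∀ᶠ q in 𝓝 p, riemDist φ p q ≤ ENNReal.ofReal ε := by
  set c := extChartAt (𝓡 7) p with hcdef
  have hp : c p ∈ c.target := mem_extChartAt_target p
  have hcp : c.symm (c p) = p := extChartAt_to_inv p
  have ho : IsOpen (c.target ×ˢ (Set.univ : Set E7)) := (isOpen_extChartAt_target p).prod isOpen_univ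
  have h1 : ContinuousOn (fun z : E7 × E7 => innerOf (pull φ c.symm z.1) z.2 z.2)
      (c.target ×ˢ Set.univ) :=
    continuousOn_innerOf_fields ((hc p).1.continuousOn.comp continuousOn_fst fun z hz => hz.1)
      (fun z hz => exists_adapted_pull hφ (mfderiv_extChartAt_symm_bijective p hz.1))
      continuousOn_snd continuousOn_snd
  have h2 : ∀ᶠ z in 𝓝 (c p, (0 : E7)), z ∈ c.target ×ˢ (Set.univ : Set E7) ∧
      innerOf (pull φ c.symm z.1) z.2 z.2 < ε ^ 2 := by
    have hmem := ho.mem_nhds (show (c p, (0 : E7)) ∈ _ from ⟨hp, trivial⟩)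
    have h3 := innerOf_smul_smul (exists_adapted_pull hφ (mfderiv_extChartAt_symm_bijective p hp))
      0 0
    rw [zero_smul] at h3
    have h4 : innerOf (pull φ c.symm (c p)) 0 0 < ε ^ 2 :=
      h3.trans_lt (by simpa using pow_pos hε 2)
    filter_upwards [hmem, (h1.continuousAt hmem).eventually_lt_const h4] with z hz hz'
      using ⟨hz, hz'⟩
  obtain ⟨r, hr, hball⟩ := Metric.eventually_nhds_iff_ball.1 h2
  filter_upwards [(isOpen_extChartAt_source (I := 𝓡 7) p).mem_nhds (mem_extChartAt_source p),
    continuousAt_extChartAt (I := 𝓡 7) p (Metric.ball_mem_nhds _ hr)] with q hq hq'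
  have h4 := riemDist_le_of_segment hφ (Ψ := c.symm) (x := c p) (w := c q - c p) hε.le
    fun s hs => by
      have h5 : (c p + s • (c q - c p), c q - c p) ∈ Metric.ball (c p, (0 : E7)) r := by
        have h6 : dist (c q) (c p) < r := hq'
        rw [dist_eq_norm] at h6
        rw [← ball_prod_same]
        refine ⟨?_, by simpa using h6⟩
        rw [Metric.mem_ball, dist_eq_norm, add_sub_cancel_left, norm_smul, Real.norm_eq_abs,
          abs_of_nonneg hs.1]
        exact (mul_le_of_le_one_left (norm_nonneg _) hs.2).trans_lt h6
      have h7 := hball _ h5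
      exact ⟨contMDiffAt_extChartAt_symm p h7.1.1, mfderiv_extChartAt_symm_bijective p h7.1.1,
        h7.2.le⟩
  rwa [add_sub_cancel, hcp, c.left_inv hq] at h4

end Distance

/-- In a complete space, a set that is closed and in which one can always move on cannot have
bounded height, if the length of the way is bounded by the gain in height. -/
theorem not_bounded_of_exists_step {X : Type*} [TopologicalSpace X] {d : X → X → ENNReal}
    (hcomm : ∀ x y, d x y = d y x) (htri : ∀ x y z, d x z ≤ d x y + d y z)
    (hnear : ∀ p, ∀ ε : ℝ, 0 < ε → ∀ᶠ q in 𝓝 p, d p q ≤ ENNReal.ofReal ε)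
    (hcomplete : ∀ u : ℕ → X, (∀ ε : ENNReal, 0 < ε → ∃ N, ∀ m ≥ N, ∀ n ≥ N, d (u m) (u n) < ε) →
      ∃ x, Tendsto u atTop (𝓝 x))
    {S : Set X} (hclosed : ∀ (u : ℕ → X) (x : X), Tendsto u atTop (𝓝 x) → (∀ n, u n ∈ S) → x ∈ S)
    {t : X → ℝ} (ht : Continuous t) {k b : ℝ} (hk : 0 < k)
    (hstep : ∀ q ∈ S, ∃ s > 0, ∃ q' ∈ S, t q' = t q + s ∧ d q q' ≤ ENNReal.ofReal (k * s))
    (hb : ∀ q ∈ S, t q ≤ b) : S = ∅ := by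
  by_contra hS
  obtain ⟨q₀, hq₀⟩ := Set.nonempty_iff_ne_empty.2 hS
  -- Reachability with distance at most `k` times the gain in height. It is a preorder; reflexivity
  -- uses `hnear`, as `d q q = 0` is not assumed.
  let r : X → X → Prop := fun q q' => t q ≤ t q' ∧ d q q' ≤ ENNReal.ofReal (k * (t q' - t q))
  have hrefl : ∀ q, r q q := fun q => by
    refine ⟨le_rfl, ?_⟩
    rw [sub_self, mul_zero, ENNReal.ofReal_zero]
    refine ENNReal.le_of_forall_pos_le_add fun ε hε _ => ?_
    rw [zero_add, ← ENNReal.ofReal_coe_nnreal]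
    exact (hnear q ε (by exact_mod_cast hε)).self_of_nhds
  have htrans : ∀ {x y z}, r x y → r y z → r x z := fun {x y z} h1 h2 => by
    refine ⟨h1.1.trans h2.1, (htri x y z).trans ((add_le_add h1.2 h2.2).trans_eq ?_)⟩
    rw [← ENNReal.ofReal_add (mul_nonneg hk.le (sub_nonneg.2 h1.1))
      (mul_nonneg hk.le (sub_nonneg.2 h2.1))]
    congr 1; ring
  let T : X → Set ℝ := fun q => {a | ∃ q' ∈ S, r q q' ∧ t q' = a}
  have hTb : ∀ q, BddAbove (T q) := fun q => ⟨b, by rintro _ ⟨q', hq', -, rfl⟩; exact hb q' hq'⟩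
  -- A greedy choice: each move realises at least half of the height still available. The heights of
  -- the iterates converge to some `L`, and the gains bound the distances, so the iterates are
  -- Cauchy.
  have hnext : ∀ q : S, ∃ q' : S, r q q' ∧ (t q + sSup (T q)) / 2 ≤ t q' := by
    rintro ⟨q, hq⟩
    have hne : (T q).Nonempty := ⟨t q, q, hq, hrefl q, rfl⟩
    rcases (le_csSup (hTb q) (show t q ∈ T q from ⟨q, hq, hrefl q, rfl⟩)).eq_or_lt with h | h
    · exact ⟨⟨q, hq⟩, hrefl q, by simp only; linarith⟩
    · obtain ⟨_, ⟨q', hq', h1, rfl⟩, h2⟩ := exists_lt_of_lt_csSup hne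
        (show (t q + sSup (T q)) / 2 < sSup (T q) by linarith)
      exact ⟨⟨q', hq'⟩, h1, h2.le⟩
  choose f hf1 hf2 using hnext
  let u : ℕ → S := fun n => f^[n] ⟨q₀, hq₀⟩
  have hu : ∀ n, u (n + 1) = f (u n) := fun n => Function.iterate_succ_apply' f n _
  have hmono : ∀ n m, n ≤ m → r (u n) (u m) := fun n m hnm => by
    induction m, hnm using Nat.le_induction with
    | base => exact hrefl _
    | succ m _ ih => exact htrans ih (by rw [hu]; exact hf1 _)
  have htm : Monotone fun n => t (u n) := fun n m hnm => (hmono n m hnm).1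
  have hlim := tendsto_atTop_ciSup htm ⟨b, by rintro _ ⟨n, rfl⟩; exact hb _ (u n).2⟩
  set L := ⨆ n, t (u n) with hL
  have hle : ∀ n, t (u n) ≤ L := fun n => htm.ge_of_tendsto hlim n
  obtain ⟨x, hx⟩ := hcomplete (fun n => (u n : X)) fun ε hε => by
    obtain ⟨δ, hδ, hδε⟩ := ENNReal.lt_iff_exists_nnreal_btwn.1 hε
    have hδ' : (0 : ℝ) < δ := by exact_mod_cast hδ
    obtain ⟨N, hN⟩ := ((hlim.eventually (lt_mem_nhds
      (show L - δ / k < L by linarith [div_pos hδ' hk])))).exists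
    have key : ∀ m ≥ N, ∀ n ≥ m, d (u m) (u n) < ε := fun m hm n hn => by
      refine ((hmono m n hn).2.trans (ENNReal.ofReal_le_ofReal ?_)).trans_lt
        ((ENNReal.ofReal_coe_nnreal (p := δ)).trans_lt hδε)
      have h1 : t (u n) - t (u m) ≤ δ / k := by linarith [hle n, htm hm]
      calc k * (t (u n) - t (u m)) ≤ k * (δ / k) := mul_le_mul_of_nonneg_left h1 hk.le
        _ = δ := by field_simp
    refine ⟨N, fun m hm n hn => ?_⟩
    rcases le_total m n with h | h
    · exact key m hm n h
    · rw [hcomm]; exact key n hn m h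
  have hxS := hclosed _ x hx fun n => (u n).2
  have htx : t x = L := tendsto_nhds_unique ((ht.tendsto x).comp hx) hlim
  have hux : ∀ n, r (u n) x := fun n => by
    refine ⟨htx ▸ hle n, ENNReal.le_of_forall_pos_le_add fun ε hε _ => ?_⟩
    obtain ⟨m, hm1, hm2⟩ := ((hx.eventually (hnear x ε (by exact_mod_cast hε))).and
      (eventually_ge_atTop n)).exists
    rw [ENNReal.ofReal_coe_nnreal, hcomm] at hm1
    refine (htri _ (u m : X) _).trans (add_le_add ((hmono n m hm2).2.trans
      (ENNReal.ofReal_le_ofReal ?_)) hm1)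
    rw [htx]
    exact mul_le_mul_of_nonneg_left (by linarith [hle m]) hk.le
  obtain ⟨s, hs, q', hq', h1, h2⟩ := hstep x hxS
  have hxq : r x q' := ⟨by linarith, h2.trans_eq (by rw [h1, add_sub_cancel_left])⟩
  -- A further step from the limit gains `s > 0` and is reachable from every `u n`, so the greedy
  -- choice gives `t (u (n + 1)) ≥ (t (u n) + L + s) / 2`. Letting `n` grow yields `L + s / 2 ≤ L`.
  have h3 : ∀ n, (t (u n) + (L + s)) / 2 ≤ L := fun n => by
    have h4 : L + s ≤ sSup (T (u n)) :=
      le_csSup (hTb _) ⟨q', hq', htrans (hux n) hxq, by rw [h1, htx]⟩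
    have h5 := hf2 (u n)
    rw [← hu] at h5
    linarith [hle (n + 1)]
  have h6 := le_of_tendsto' ((hlim.add_const (L + s)).div_const 2) h3
  linarith

/-! ### Completeness forces `V` to be locally constant. -/

section Completeness

variable {M : Type*} [TopologicalSpace M] [ChartedSpace E7 M]
  [MulAction T3 M] {φ : ∀ p : M, TangentSpace (𝓡 7) p [⋀^Fin 3]→L[ℝ] ℝ}
  {ν : M → Fin 3 → ℝ} {μ : M → ℝ}

/-- `q` is a regular point near which `V = A + μ C`. -/
structure IsAffineAt (φ : ∀ p : M, TangentSpace (𝓡 7) p [⋀^Fin 3]→L[ℝ] ℝ) (μ : M → ℝ)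
    (A C : Matrix (Fin 3) (Fin 3) ℝ) (q : M) : Prop where
  regular : q ∈ regularSet M
  eventually_eq : ∀ᶠ z in 𝓝 q, matV φ z = A + μ z • C

namespace IsToricG2Manifold

theorem det_matB_mul (h : IsToricG2Manifold φ ν μ) {q : M} (hq : q ∈ regularSet M) :
    (matB φ q).det * (matV φ q).det = 1 := by
  rw [matV, Matrix.det_nonsing_inv, Ring.mul_inverse_cancel _ (h.isUnit_det_matB hq)]

variable [IsManifold (𝓡 7) ∞ M]

/-- Near a regular point `μ` is a coordinate, hence takes two values. So the coefficients of an
affine germ in `μ` are unique. -/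
theorem eq_zero_of_eventually_affine (h : IsToricG2Manifold φ ν μ) {q : M} (hq : q ∈ regularSet M)
    {A C : Matrix (Fin 3) (Fin 3) ℝ} (hAC : ∀ᶠ z in 𝓝 q, A + μ z • C = 0) : A = 0 ∧ C = 0 := by
  obtain ⟨Ψ, O, x, H, hx, hΨx, hN⟩ := h.exists_isActionChart hq hAC
  have h1 : ContinuousAt (fun τ : ℝ => x + τ • bv 6) 0 := by fun_prop
  have h2 : ∀ᶠ τ : ℝ in 𝓝 0, A + (x 6 + τ) • C = 0 := by
    filter_upwards [h1 (by simpa using H.isOpen.mem_nhds hx)] with τ hτ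
    have h3 : A + μ (Ψ (x + τ • bv 6)) • C = 0 := hN _ hτ
    rw [H.mu_eq _ hτ] at h3
    simpa using h3
  have h0 := h2.self_of_nhds
  have h3 : ∀ᶠ τ : ℝ in 𝓝[≠] 0, A + (x 6 + τ) • C = 0 := h2.filter_mono nhdsWithin_le_nhds
  obtain ⟨τ, hτ, hτ0⟩ := (h3.and self_mem_nhdsWithin).exists
  have hC : C = 0 := by
    have h4 : τ • C = (A + (x 6 + τ) • C) - (A + (x 6 + 0) • C) := by
      rw [add_smul, add_smul, zero_smul]; abel
    rw [hτ, h0, sub_zero] at h4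
    exact (smul_eq_zero.1 h4).resolve_left hτ0
  refine ⟨?_, hC⟩
  rw [hC, smul_zero, add_zero] at h0
  exact h0

/-- Being affine with given coefficients is a closed condition. -/
theorem isAffineAt_of_tendsto (h : IsToricG2Manifold φ ν μ) (hV : DependsOnlyOnMu φ μ)
    {A C : Matrix (Fin 3) (Fin 3) ℝ} {u : ℕ → M} {q : M} (hu : Tendsto u atTop (𝓝 q))
    (hA : ∀ n, IsAffineAt φ μ A C (u n)) : IsAffineAt φ μ A C q := by
  have hμ : Tendsto (fun n => μ (u n)) atTop (𝓝 (μ q)) :=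
    (h.smooth_mu.continuous.tendsto q).comp hu
  have hreg : q ∈ regularSet M := by
    rw [h.mem_regularSet_iff]
    -- The product equals one along the sequence, and both factors are continuous up to `q`,
    -- although `V` itself need not be a priori. Hence `det B` is nonzero at the limit.
    have h1 : Tendsto (fun n => (matB φ (u n)).det * (A + μ (u n) • C).det) atTop
        (𝓝 ((matB φ q).det * (A + μ q • C).det)) := by
      refine ((h.continuous_det_matB.tendsto q).comp hu).mul ?_
      have h2 : Continuous fun r : ℝ => (A + r • C).det := by fun_prop
      exact (h2.tendsto _).comp hμ
    have h3 : ∀ n, (matB φ (u n)).det * (A + μ (u n) • C).det = 1 := fun n => by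
      rw [← (hA n).eventually_eq.self_of_nhds, h.det_matB_mul (hA n).regular]
    simp only [h3] at h1
    have h4 := tendsto_nhds_unique h1 tendsto_const_nhds
    exact left_ne_zero_of_mul (h4 ▸ one_ne_zero)
  refine ⟨hreg, ?_⟩
  -- The coefficients at `q` agree with `A`, `C` because both describe `V` near some `u n`.
  obtain ⟨A', C', hAC⟩ := h.exists_local_affine hV hreg
  obtain ⟨n, hn⟩ := (hu.eventually hAC.eventually_nhds).exists
  have h5 : ∀ᶠ z in 𝓝 (u n), (A' - A) + μ z • (C' - C) = 0 := by
    filter_upwards [hn, (hA n).eventually_eq] with z hz hz'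
    rw [hz] at hz'
    rw [smul_sub, sub_add_sub_comm, hz', sub_self]
  obtain ⟨e1, e2⟩ := h.eq_zero_of_eventually_affine (hA n).regular h5
  rw [sub_eq_zero] at e1 e2
  rwa [e1, e2] at hAC

/-- One can move in the direction of the gradient of `μ`. -/
theorem exists_step (h : IsToricG2Manifold φ ν μ) {A C : Matrix (Fin 3) (Fin 3) ℝ} {q : M}
    (hq : IsAffineAt φ μ A C q) {τ k : ℝ} (hk : 0 < k)
    (hk' : τ ^ 2 * (A + μ q • C).det < k ^ 2) :
    ∃ s > 0, ∃ q', IsAffineAt φ μ A C q' ∧ μ q' = μ q + s * τ ∧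
      riemDist φ q q' ≤ ENNReal.ofReal (k * s) := by
  obtain ⟨Ψ, O, x, H, hx, hΨx, hN⟩ := h.exists_isActionChart hq.regular
    hq.eventually_eq.eventually_nhds
  obtain ⟨K, -, hK, -, hU, -, hμ⟩ := h.exists_adapted_frame (Ψ x)
  have hreg := H.mem_regularSet x hx
  have hdet := h.posDef_matB hreg |>.det_pos
  -- The vector `τ ∇μ / |∇μ|²`: it satisfies `dμ(X) = τ` and `|X|² = τ² / det B = τ² det V`. The
  -- strict bound by `k²` persists along a short coordinate segment.
  set X := (τ / (matB φ (Ψ x)).det) • K.symm (chi (K (gen 0 (Ψ x))) (K (gen 1 (Ψ x)))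
    (K (gen 2 (Ψ x)))) with hX
  obtain ⟨w, hw⟩ : ∃ w : E7, mfderiv 𝓘(ℝ, E7) (𝓡 7) Ψ x w = X := (H.mfderiv_bijective h hx).2 X
  have hw6 : w 6 = τ := by
    rw [← H.mfderiv_mu h hx w, hw, hμ, hX, map_smul, K.apply_symm_apply, inner_smul_right,
      hU.inner_chi_chi, ← det_matB hK]
    field_simp
  have hww : innerOf (pull φ Ψ x) w w < k ^ 2 := by
    rw [innerOf_pull h.adapted (H.mfderiv_bijective h hx), hw, hK, hX, map_smul,
      K.apply_symm_apply, inner_smul_left, inner_smul_right, hU.inner_chi_chi, ← det_matB hK]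
    refine lt_of_eq_of_lt ?_ hk'
    have h1 := h.det_matB_mul hreg
    have h2 : matV φ (Ψ x) = A + μ q • C := by
      rw [hΨx]; exact hq.eventually_eq.self_of_nhds
    rw [h2] at h1
    simp only [RCLike.conj_to_real]
    field_simp
    linear_combination (-τ ^ 2) * h1
  have hcont : ContinuousOn (fun y => innerOf (pull φ Ψ y) w w) O :=
    continuousOn_innerOf (fun y hy =>
      (pull_closed h.closed (H.smooth y hy)).1.continuousAt.continuousWithinAt)
      (fun y hy => exists_adapted_pull h.adapted (H.mfderiv_bijective h hy)) w w
  have hline : ContinuousAt (fun s : ℝ => x + s • w) 0 := by fun_prop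
  have hev : ∀ᶠ s : ℝ in 𝓝 0, x + s • w ∈ O ∧ innerOf (pull φ Ψ (x + s • w)) w w < k ^ 2 := by
    have h1 : ∀ᶠ y in 𝓝 (x + (0 : ℝ) • w), y ∈ O ∧ innerOf (pull φ Ψ y) w w < k ^ 2 := by
      rw [zero_smul, add_zero]
      filter_upwards [H.isOpen.mem_nhds hx,
        (hcont.continuousAt (H.isOpen.mem_nhds hx)).eventually_lt_const hww] with y a b
        using ⟨a, b⟩
    exact hline.eventually h1
  obtain ⟨r, hr, hball⟩ := Metric.eventually_nhds_iff_ball.1 hev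
  have hmem : ∀ s : ℝ, 0 ≤ s → s ≤ r / 2 → s ∈ Metric.ball (0 : ℝ) r := fun s h0 h1 => by
    rw [Metric.mem_ball, dist_zero_right, Real.norm_eq_abs, abs_of_nonneg h0]; linarith
  have hmain := (hball _ (hmem (r / 2) (by positivity) le_rfl)).1
  refine ⟨r / 2, by positivity, Ψ (x + (r / 2) • w), ⟨H.mem_regularSet _ hmain, hN _ hmain⟩, ?_, ?_⟩
  · rw [H.mu_eq _ hmain, ← hΨx, H.mu_eq x hx, ← hw6]
    simp
  · rw [← hΨx]
    refine riemDist_le_of_segment h.adapted (by positivity) fun s hs => ?_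
    have h2 := hball _ (hmem (s * (r / 2)) (mul_nonneg hs.1 (by positivity))
      (mul_le_of_le_one_left (by positivity) hs.2))
    rw [smul_smul]
    refine ⟨H.smooth _ h2.1, H.mfderiv_bijective h h2.1, ?_⟩
    rw [innerOf_smul_smul (exists_adapted_pull h.adapted (H.mfderiv_bijective h h2.1)), mul_pow,
      mul_comm]
    exact mul_le_mul_of_nonneg_right h2.2.le (sq_nonneg _)

/-- If the metric is complete, then `V` is locally constant on the regular set. -/
theorem eventually_matV_eq (h : IsToricG2Manifold φ ν μ) (hV : DependsOnlyOnMu φ μ)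
    (hcomplete : IsCompleteMetric φ) {p : M} (hp : p ∈ regularSet M) :
    ∀ᶠ q in 𝓝 p, matV φ q = matV φ p := by
  obtain ⟨A, C, hAC⟩ := h.exists_local_affine hV hp
  -- If the quadratic form of `C` vanishes, then `C` is skew. Differences of `V` are symmetric
  -- multiples of `C`, hence zero.
  by_cases hC : ∀ x : Fin 3 → ℝ, x ⬝ᵥ C.mulVec x = 0
  · have h1 : ∀ i j, C i j + C j i = 0 := fun i j => by
      have e1 := hC (Pi.single i 1)
      have e2 := hC (Pi.single j 1)
      have e3 := hC (Pi.single i 1 + Pi.single j 1)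
      simp only [Matrix.mulVec_add, add_dotProduct, dotProduct_add, Matrix.mulVec_single_one,
        single_one_dotProduct, Matrix.col_apply] at e1 e2 e3
      linarith
    have hsymm : ∀ q i j, matV φ q i j = matV φ q j i := fun q i j => by
      have e : (matB φ q).transpose = matB φ q := by
        ext i j; exact h.matB_isSymm q j i
      have e' : (matV φ q).transpose = matV φ q := by
        rw [matV, Matrix.transpose_nonsing_inv, e]
      exact congrFun (congrFun e' j) i
    filter_upwards [hAC] with q hq
    have h2 : matV φ q - matV φ p = (μ q - μ p) • C := by
      rw [hq, hAC.self_of_nhds, sub_smul]; abel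
    ext i j
    have h3 := congrFun (congrFun h2 i) j
    have h4 := congrFun (congrFun h2 j) i
    simp only [Matrix.sub_apply, Matrix.smul_apply, smul_eq_mul] at h3 h4
    rw [hsymm q j i, hsymm p j i] at h4
    linear_combination (h3 + h4) / 2 + (μ q - μ p) / 2 * h1 i j
  · exfalso
    push Not at hC
    obtain ⟨x, hx⟩ := hC
    have hquad : ∀ r : ℝ, x ⬝ᵥ (A + r • C).mulVec x = x ⬝ᵥ A.mulVec x + r * (x ⬝ᵥ C.mulVec x) :=
      fun r => by
        rw [Matrix.add_mulVec, Matrix.smul_mulVec, dotProduct_add, dotProduct_smul, smul_eq_mul]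
    have hx0 : x ≠ 0 := by rintro rfl; simp at hx
    have hpos : ∀ q, IsAffineAt φ μ A C q → 0 < x ⬝ᵥ A.mulVec x + μ q * (x ⬝ᵥ C.mulVec x) := by
      intro q hq
      rw [← hquad, ← hq.eventually_eq.self_of_nhds]
      simpa using (h.posDef_matV hq.regular).dotProduct_mulVec_pos hx0
    set a := x ⬝ᵥ A.mulVec x
    set c := x ⬝ᵥ C.mulVec x
    have hp' : IsAffineAt φ μ A C p := ⟨hp, hAC⟩
    have ha := hpos p hp'
    -- `μ p + τ` is the value of `μ` at which `xᵀ (A + μ C) x` vanishes, so positivity of `V` bounds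
    -- the height `(μ - μ p) / τ` by one.
    set τ := -(a + μ p * c) / c with hτ
    have hτc : τ * c = -(a + μ p * c) := by rw [hτ]; field_simp
    have hτ0 : τ ≠ 0 := fun h0 => by rw [h0, zero_mul] at hτc; linarith
    have hle : ∀ q, IsAffineAt φ μ A C q → (μ q - μ p) / τ ≤ 1 := by
      intro q hq
      by_contra hcon
      push Not at hcon
      have h1 := hpos q hq
      have h2 : a + μ q * c = (a + μ p * c) * (1 - (μ q - μ p) / τ) := by
        have h3 : μ q = μ p + τ * ((μ q - μ p) / τ) := by field_simp; ring
        generalize (μ q - μ p) / τ = s at h3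
        rw [h3]
        linear_combination s * hτc
      rw [h2] at h1
      nlinarith
    -- On heights in `[0, 1]` the squared speed `τ² det V` is bounded. Adding one below makes the
    -- speed bound `k` positive and strict, as `exists_step` requires.
    obtain ⟨k₀, hk₀⟩ := isCompact_Icc.exists_bound_of_continuousOn
      (f := fun t : ℝ => τ ^ 2 * (A + (μ p + t * τ) • C).det) (s := Set.Icc 0 1)
      (by fun_prop : Continuous fun t : ℝ => τ ^ 2 * (A + (μ p + t * τ) • C).det).continuousOn
    set k := Real.sqrt (|k₀| + 1) with hk
    have hk2 : k ^ 2 = |k₀| + 1 := Real.sq_sqrt (by positivity)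
    have hS := not_bounded_of_exists_step (riemDist_comm h.adapted) (riemDist_triangle h.adapted)
      (fun p ε hε => eventually_riemDist_le h.adapted h.closed p hε) hcomplete
      (S := {q | IsAffineAt φ μ A C q ∧ 0 ≤ (μ q - μ p) / τ})
      (fun u q hu hq => ⟨h.isAffineAt_of_tendsto hV hu fun n => (hq n).1,
        ge_of_tendsto' ((((h.smooth_mu.continuous.sub continuous_const).div_const τ).tendsto
          q).comp hu) fun n => (hq n).2⟩)
      (t := fun q => (μ q - μ p) / τ) ((h.smooth_mu.continuous.sub continuous_const).div_const τ)
      (k := k) (b := 1) (Real.sqrt_pos.2 (by positivity)) ?_ ?_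
    · exact Set.eq_empty_iff_forall_notMem.1 hS p ⟨hp', by simp⟩
    · rintro q ⟨hq, hq0⟩
      have hq1 := hle q hq
      have hb := hk₀ _ ⟨hq0, hq1⟩
      rw [div_mul_cancel₀ _ hτ0, add_sub_cancel] at hb
      obtain ⟨s, hs, q', h1, h2, h3⟩ := h.exists_step hq (τ := τ) (k := k)
        (Real.sqrt_pos.2 (by positivity)) (by
          rw [hk2]
          have := (le_abs_self _).trans (hb.trans (le_abs_self _))
          linarith)
      have h4 : (μ q' - μ p) / τ = (μ q - μ p) / τ + s := by
        rw [h2]; field_simp; ring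
      exact ⟨s, hs, q', ⟨h1, by rw [h4]; positivity⟩, h4, h3⟩
    · exact fun q hq => hle q hq.1

end IsToricG2Manifold

end Completeness

/-! ### Torsion in closed subgroups of a torus. -/

theorem countable_isOfFinOrder_torus {ι : Type*} [Finite ι] :
    {z : ι → Circle | IsOfFinOrder z}.Countable := by
  have h1 : ∀ n : ℕ, 0 < n → {z : Circle | z ^ n = 1}.Finite := fun n hn => by
    refine Set.Finite.of_finite_image (f := fun z : Circle => (z : ℂ)) ?_
      Circle.coe_injective.injOn
    refine (Polynomial.nthRoots n (1 : ℂ)).toFinset.finite_toSet.subset ?_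
    rintro _ ⟨z, hz, rfl⟩
    simp only [Finset.mem_coe, Multiset.mem_toFinset, Polynomial.mem_nthRoots hn]
    have hz' : z ^ n = 1 := hz
    rw [← Circle.coe_pow, hz', Circle.coe_one]
  have h2 : {z : ι → Circle | IsOfFinOrder z} ⊆
      ⋃ n : {n : ℕ // 0 < n}, Set.pi Set.univ fun _ => {z : Circle | z ^ (n : ℕ) = 1} := fun z hz => by
    obtain ⟨n, hn, hzn⟩ := isOfFinOrder_iff_pow_eq_one.1 hz
    exact Set.mem_iUnion.2 ⟨⟨n, hn⟩, fun i _ => congrFun hzn i⟩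
  exact (Set.countable_iUnion fun n : {n : ℕ // 0 < n} =>
    (Set.Finite.pi fun _ => h1 n n.2).countable).mono h2

/-- The preimage of `K` in `ℝ` is dense or cyclic. If dense, it is everything by closedness and
contains `π`. If generated by `a`, it contains `2π`, so `2π = n a` and `exp(i a)` is torsion. -/
theorem exists_isOfFinOrder_of_isClosed_circle {K : Subgroup Circle}
    (hK : IsClosed (K : Set Circle)) (h : K ≠ ⊥) : ∃ z ∈ K, z ≠ 1 ∧ IsOfFinOrder z := by
  obtain ⟨w, hw, hw1⟩ : ∃ w ∈ K, w ≠ 1 := by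
    by_contra! hcon
    exact h ((Subgroup.eq_bot_iff_forall K).2 hcon)
  let L : AddSubgroup ℝ := (Subgroup.toAddSubgroup K).comap Circle.expHom
  have hL : ∀ r, r ∈ L ↔ Circle.exp r ∈ K := fun r => Iff.rfl
  rcases AddSubgroup.dense_or_cyclic L with hd | ⟨a, ha⟩
  · have hc : IsClosed (L : Set ℝ) := hK.preimage Circle.exp.continuous
    have hall : ∀ r, Circle.exp r ∈ K := fun r => by
      have : r ∈ closure (L : Set ℝ) := hd r
      rwa [hc.closure_eq] at this
    refine ⟨Circle.exp Real.pi, hall _, fun e => ?_,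
      isOfFinOrder_iff_pow_eq_one.2 ⟨2, two_pos, ?_⟩⟩
    · have := congrArg (fun z : Circle => (z : ℂ)) e
      norm_num [Circle.coe_exp, Complex.exp_pi_mul_I] at this
    · rw [← Circle.exp_nsmul, nsmul_eq_mul]
      exact_mod_cast Circle.exp_two_pi
  · have hmem : ∀ r, Circle.exp r ∈ K → ∃ n : ℤ, n • a = r := fun r hr => by
      have : r ∈ AddSubgroup.closure {a} := ha ▸ (hL r).2 hr
      exact AddSubgroup.mem_closure_singleton.1 this
    have haK : Circle.exp a ∈ K := (hL a).1 (ha ▸ AddSubgroup.subset_closure rfl)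
    have hz : ∀ n : ℤ, Circle.exp (n • a) = Circle.exp a ^ n := fun n => map_zsmul Circle.expHom n a
    refine ⟨Circle.exp a, haK, fun e => ?_, ?_⟩
    · obtain ⟨r, rfl⟩ := Circle.exp_surjective w
      obtain ⟨n, rfl⟩ := hmem r hw
      rw [hz, e, one_zpow] at hw1
      exact hw1 rfl
    · obtain ⟨n, hn⟩ := hmem (2 * Real.pi) (by rw [Circle.exp_two_pi]; exact K.one_mem)
      refine isOfFinOrder_iff_zpow_eq_one.2 ⟨n, ?_, by rw [← hz, hn, Circle.exp_two_pi]⟩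
      rintro rfl
      rw [zero_smul] at hn
      linarith [Real.pi_pos]

/-- A nontrivial closed subgroup of a torus has torsion. -/
theorem exists_isOfFinOrder_of_isClosed {ι : Type*} (S : Finset ι) {K : Subgroup (ι → Circle)}
    (hK : IsClosed (K : Set (ι → Circle))) (hS : ∀ z ∈ K, ∀ i ∉ S, z i = 1) (h : K ≠ ⊥) :
    ∃ z ∈ K, z ≠ 1 ∧ IsOfFinOrder z := by
  classical
  induction S using Finset.induction_on generalizing K with
  | empty =>
    exact absurd ((Subgroup.eq_bot_iff_forall K).2 fun z hz => funext fun i => hS z hz i (by simp)) h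
  | insert i S _ ih =>
    let π : (ι → Circle) →* Circle := Pi.evalMonoidHom (fun _ => Circle) i
    -- Either the projection to the `i`-th circle is injective on `K`, and a torsion element of its
    -- closed image lifts, or its kernel in `K` is a nontrivial closed subgroup with one coordinate
    -- fewer.
    by_cases hb : K ⊓ π.ker = ⊥
    · have hinj : ∀ z ∈ K, z i = 1 → z = 1 := fun z hz hzi => by
        have : z ∈ K ⊓ π.ker := ⟨hz, hzi⟩
        rwa [hb, Subgroup.mem_bot] at this
      obtain ⟨_, ⟨z, hz, rfl⟩, hz1, hfin⟩ := exists_isOfFinOrder_of_isClosed_circle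
        (K := K.map π) (hK.isCompact.image (continuous_apply i)).isClosed fun e => h <| by
          refine (Subgroup.eq_bot_iff_forall K).2 fun z hz => hinj z hz ?_
          have : π z ∈ K.map π := ⟨z, hz, rfl⟩
          rwa [e, Subgroup.mem_bot] at this
      obtain ⟨n, hn, hzn⟩ := isOfFinOrder_iff_pow_eq_one.1 hfin
      refine ⟨z, hz, fun e => hz1 (by rw [e, map_one]), isOfFinOrder_iff_pow_eq_one.2
        ⟨n, hn, hinj _ (K.pow_mem hz n) ?_⟩⟩
      rw [← map_pow] at hzn
      exact hzn
    · obtain ⟨z, hz, h1⟩ := ih (K := K ⊓ π.ker)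
        (hK.inter (isClosed_singleton.preimage (continuous_apply i))) (fun z hz j hj => by
          rcases eq_or_ne j i with rfl | hji
          · exact hz.2
          · exact hS z hz.1 j (by simp [hji, hj])) hb
      exact ⟨z, hz.1, h1⟩

/-! ### Effectiveness: every point is regular. -/

section Effective

variable {M : Type*} [TopologicalSpace M] [ChartedSpace E7 M]
  [MulAction T3 M] {φ : ∀ p : M, TangentSpace (𝓡 7) p [⋀^Fin 3]→L[ℝ] ℝ}
  {ν : M → Fin 3 → ℝ} {μ : M → ℝ}

namespace IsToricG2Manifold

/-- Regularity of the action in the group variable is stated through the covering `ℝ³ → T³`, so the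
stabiliser is exhibited as the image of a closed part of a compact box. -/
theorem isClosed_stabilizer [T2Space M] (h : IsToricG2Manifold φ ν μ) (p : M) :
    IsClosed (MulAction.stabilizer T3 p : Set T3) := by
  have hc : Continuous fun s : Fin 3 → ℝ => expT s • p :=
    h.smooth_action.continuous.comp (by fun_prop : Continuous fun s : Fin 3 → ℝ => (s, p))
  have he : Continuous expT := continuous_pi fun j =>
    Circle.exp.continuous.comp (continuous_apply j)
  have h1 : (MulAction.stabilizer T3 p : Set T3) =
      expT '' (Set.Icc (fun _ => -Real.pi) (fun _ => Real.pi) ∩ {s | expT s • p = p}) := by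
    ext t
    constructor
    · intro ht
      have ht' : expT (fun j => Complex.arg (t j)) = t := funext fun j => Circle.exp_arg (t j)
      refine ⟨_, ⟨⟨fun j => (Complex.neg_pi_lt_arg _).le, fun j => Complex.arg_le_pi _⟩, ?_⟩, ht'⟩
      change expT _ • p = p
      rw [ht']
      exact ht
    · rintro ⟨s, ⟨-, hs⟩, rfl⟩
      exact hs
  rw [h1]
  exact ((isCompact_Icc.inter_right (isClosed_eq hc continuous_const)).image he).isClosed

/-- The orbit map of a one-parameter subgroup whose generator vanishes at `p` is constant. -/
theorem expT_smul_eq (h : IsToricG2Manifold φ ν μ) [IsManifold (𝓡 7) ∞ M] {p : M} {v : Fin 3 → ℝ}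
    (hv : ∑ i, v i • gen i p = 0) (τ : ℝ) : expT (τ • v) • p = p := by
  set Ψ : (Fin 3 → ℝ) → M := fun s => expT s • p with hΨ
  have hΨs : ∀ s, HasMFDerivAt 𝓘(ℝ, Fin 3 → ℝ) (𝓡 7) Ψ s (mfderiv 𝓘(ℝ, Fin 3 → ℝ) (𝓡 7) Ψ s) :=
    fun s => ((h.contMDiffAt_expT_smul (f := fun s => s) (by fun_prop)
      contMDiffAt_const).mdifferentiableAt (by simp)).hasMFDerivAt
  let D : (Fin 3 → ℝ) →L[ℝ] E7 := mfderiv 𝓘(ℝ, Fin 3 → ℝ) (𝓡 7) Ψ 0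
  have hline : ∀ w : Fin 3 → ℝ, MDifferentiableAt 𝓘(ℝ, ℝ) (𝓡 7) (fun τ : ℝ => expT (τ • w) • p) 0 ∧
      (mfderiv 𝓘(ℝ, ℝ) (𝓡 7) (fun τ : ℝ => expT (τ • w) • p) 0 (1 : ℝ) : E7) = D w := fun w => by
    have h1 : HasFDerivAt (fun τ : ℝ => τ • w)
        ((1 : ℝ →L[ℝ] ℝ).smulRight w) (0 : ℝ) := (hasFDerivAt_id (0 : ℝ)).smul_const w
    have h2 := HasMFDerivAt.comp (f := fun τ : ℝ => τ • w) (0 : ℝ) (hΨs _) h1.hasMFDerivAt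
    refine ⟨h2.mdifferentiableAt, ?_⟩
    have h3 : (mfderiv 𝓘(ℝ, ℝ) (𝓡 7) (fun τ : ℝ => expT (τ • w) • p) 0 (1 : ℝ) : E7) =
        (mfderiv 𝓘(ℝ, Fin 3 → ℝ) (𝓡 7) Ψ ((0 : ℝ) • w) ((1 : ℝ) • w) : E7) :=
      DFunLike.congr_fun h2.mfderiv (1 : ℝ)
    rw [h3, one_smul]
    exact congrArg (fun s => (mfderiv 𝓘(ℝ, Fin 3 → ℝ) (𝓡 7) Ψ s w : E7)) (zero_smul ℝ w)
  have hDv : D v = 0 := by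
    have h1 : v = ∑ i, v i • (Pi.single i 1 : Fin 3 → ℝ) := by
      ext j; simp [Finset.sum_apply, Pi.single_apply]
    have h2 : ∀ i, D (Pi.single i 1) = (gen i p : E7) := fun i => by
      rw [gen_eq]; exact (hline _).2.symm
    rw [h1, map_sum]
    simp only [map_smul, h2]
    exact hv
  set γ : ℝ → M := fun τ => expT (τ • v) • p with hγ
  have hγ0 : HasMFDerivAt 𝓘(ℝ, ℝ) (𝓡 7) γ 0 0 := by
    have h1 : mfderiv 𝓘(ℝ, ℝ) (𝓡 7) γ 0 = 0 := by
      refine ContinuousLinearMap.ext_ring ?_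
      exact (hline v).2.trans hDv
    rw [← h1]
    exact (hline v).1.hasMFDerivAt
  -- The curve near `τ₀` is the curve near zero moved by a group element, so its velocity vanishes
  -- everywhere.
  have hγτ : ∀ τ₀ : ℝ, HasMFDerivAt 𝓘(ℝ, ℝ) (𝓡 7) γ τ₀ 0 := fun τ₀ => by
    have h1 : HasFDerivAt (fun τ : ℝ => τ - τ₀) (1 : ℝ →L[ℝ] ℝ) τ₀ := (hasFDerivAt_id τ₀).sub_const τ₀
    have h2 : HasMFDerivAt 𝓘(ℝ, ℝ) (𝓡 7) γ (τ₀ - τ₀) 0 := by rw [sub_self]; exact hγ0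
    have h3 := HasMFDerivAt.comp (f := fun τ : ℝ => τ - τ₀) τ₀ h2 h1.hasMFDerivAt
    have h4 := HasMFDerivAt.comp (f := γ ∘ fun τ : ℝ => τ - τ₀) τ₀
      (h.mdifferentiableAt_smul (expT (τ₀ • v)) _).hasMFDerivAt h3
    have h5 : (fun q : M => expT (τ₀ • v) • q) ∘ (γ ∘ fun τ : ℝ => τ - τ₀) = γ := by
      ext τ
      simp only [hγ, Function.comp_apply, smul_smul, ← expT_add, ← add_smul]
      rw [add_sub_cancel]
    have h6 : mfderiv 𝓘(ℝ, ℝ) (𝓡 7) γ τ₀ = 0 := by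
      have h7 := h4.mfderiv
      rw [h5] at h7
      refine ContinuousLinearMap.ext_ring ?_
      refine (DFunLike.congr_fun h7 (1 : ℝ)).trans ?_
      exact map_zero (mfderiv (𝓡 7) (𝓡 7) (fun q : M => expT (τ₀ • v) • q) _)
    rw [h5] at h4
    rw [← h6]
    exact h4.mdifferentiableAt.hasMFDerivAt
  have hloc : IsLocallyConstant γ := by
    refine (IsLocallyConstant.iff_eventually_eq γ).2 fun τ₀ => ?_
    set c := extChartAt (𝓡 7) (γ τ₀) with hc
    have h1 : ∀ᶠ τ in 𝓝 τ₀, γ τ ∈ c.source :=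
      (hγτ τ₀).continuousAt (extChartAt_source_mem_nhds (I := 𝓡 7) (γ τ₀))
    obtain ⟨r, hr, hball⟩ := Metric.eventually_nhds_iff_ball.1 h1
    have h2 : ∀ τ ∈ Metric.ball τ₀ r, HasFDerivAt (fun τ => c (γ τ)) (0 : ℝ →L[ℝ] E7) τ := by
      intro τ hτ
      have h3 : MDifferentiableAt (𝓡 7) 𝓘(ℝ, E7) c (γ τ) :=
        (contMDiffAt_extChartAt' (n := ∞) (by
          rw [← extChartAt_source (𝓡 7)]; exact hball τ hτ)).mdifferentiableAt (by simp)
      have h4 := HasMFDerivAt.comp τ h3.hasMFDerivAt (hγτ τ)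
      rw [ContinuousLinearMap.comp_zero] at h4
      exact h4.hasFDerivAt
    filter_upwards [Metric.ball_mem_nhds τ₀ hr] with τ hτ
    refine c.injOn (hball τ hτ) (hball τ₀ (Metric.mem_ball_self hr)) ?_
    exact Metric.isOpen_ball.is_const_of_fderiv_eq_zero (convex_ball τ₀ r).isPreconnected
      (fun τ hτ => (h2 τ hτ).differentiableAt.differentiableWithinAt)
      (fun τ hτ => (h2 τ hτ).fderiv) hτ (Metric.mem_ball_self hr)
  have := hloc.apply_eq_of_preconnectedSpace τ 0
  simpa only [hγ, zero_smul, expT_zero, one_smul] using this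

/-- A linear relation between the generators gives a one-parameter group fixing `p`. At time `π / v
i` its `i`-th coordinate is `-1`. -/
theorem stabilizer_ne_bot (h : IsToricG2Manifold φ ν μ) [IsManifold (𝓡 7) ∞ M] {p : M}
    (hp : p ∉ regularSet M) : MulAction.stabilizer T3 p ≠ ⊥ := by
  obtain ⟨v, hv, i, hi⟩ := Fintype.not_linearIndependent_iff.1 hp
  intro hb
  have h1 : expT ((Real.pi / v i) • v) ∈ MulAction.stabilizer T3 p := h.expT_smul_eq hv _
  rw [hb, Subgroup.mem_bot] at h1
  have h2 := congrArg (fun z : Circle => (z : ℂ)) (congrFun h1 i)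
  simp only [expT, Pi.smul_apply, smul_eq_mul, div_mul_cancel₀ _ hi] at h2
  norm_num [Circle.coe_exp, Complex.exp_pi_mul_I] at h2

variable [IsManifold (𝓡 7) ∞ M]

/-- A torsion element that fixes a neighbourhood of points accumulating at `q` fixes a
neighbourhood of `q`. -/
theorem mem_interior_fixedBy (h : IsToricG2Manifold φ ν μ) [T2Space M] {t : T3}
    (ht : IsOfFinOrder t) {q : M} (hq : q ∈ closure (interior (MulAction.fixedBy M t))) :
    q ∈ interior (MulAction.fixedBy M t) := by
  obtain ⟨n, hn, htn⟩ := isOfFinOrder_iff_pow_eq_one.1 ht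
  have hclosed : IsClosed (MulAction.fixedBy M t) :=
    isClosed_eq (h.contMDiff_smul t).continuous continuous_id
  have hfix : ∀ x ∈ MulAction.fixedBy M t, ∀ k : ℕ, t ^ k • x = x := fun x hx k => by
    induction k with
    | zero => rw [pow_zero, one_smul]
    | succ k ih => rw [pow_succ, mul_smul, MulAction.mem_fixedBy.1 hx, ih]
  have hqf : q ∈ MulAction.fixedBy M t := closure_minimal interior_subset hclosed hq
  set c := extChartAt (𝓡 7) q with hc
  have hcq : c.symm (c q) = q := extChartAt_to_inv q
  have hcs : c.source ∈ 𝓝 q := extChartAt_source_mem_nhds (I := 𝓡 7) q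
  have hcc : ContinuousAt c q := continuousAt_extChartAt q
  let f : ℕ → E7 → E7 := fun k y => c (t ^ k • c.symm y)
  have hfs : ∀ k, ∀ᶠ y in 𝓝 (c q), ContDiffAt ℝ ∞ (f k) y := fun k => by
    have h1 : ContinuousAt (fun y => t ^ k • c.symm y) (c q) :=
      (h.contMDiff_smul (t ^ k)).continuous.continuousAt.comp
        (contMDiffAt_extChartAt_symm q (mem_extChartAt_target q)).continuousAt
    have h2 : c.source ∈ 𝓝 (t ^ k • c.symm (c q)) := by rwa [hcq, hfix q hqf]
    filter_upwards [h1 h2, extChartAt_target_mem_nhds (I := 𝓡 7) q] with y hy hy'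
    have hy2 : t ^ k • c.symm y ∈ (chartAt E7 q).source := by
      rw [← extChartAt_source (𝓡 7)]; exact hy
    exact (ContMDiffAt.comp y (contMDiffAt_extChartAt' hy2)
      (ContMDiffAt.comp y (h.contMDiff_smul (t ^ k)).contMDiffAt
        (contMDiffAt_extChartAt_symm q hy'))).contDiffAt
  -- At interior fixed points the powers of `t` are locally the identity. Such points accumulate at
  -- `q`, and the derivative is continuous.
  have hfd : ∀ k, HasFDerivAt (f k) (ContinuousLinearMap.id ℝ E7) (c q) := fun k => by
    have h1 := (hfs k).self_of_nhds
    have h2 : ContinuousAt (fderiv ℝ (f k)) (c q) :=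
      (h1.fderiv_right (m := ∞) (by simp)).continuousAt
    have h3 : ∃ᶠ y in 𝓝 (c q), fderiv ℝ (f k) y ∈ ({ContinuousLinearMap.id ℝ E7} : Set _) := by
      refine hcc.frequently (((mem_closure_iff_frequently.1 hq).and_eventually hcs).mono ?_)
      rintro x ⟨hx, hxs⟩
      have h4 : f k =ᶠ[𝓝 (c x)] id := by
        have h5 : ContinuousAt c.symm (c x) :=
          (contMDiffAt_extChartAt_symm q (c.map_source hxs)).continuousAt
        have h6 : interior (MulAction.fixedBy M t) ∈ 𝓝 (c.symm (c x)) := by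
          rw [c.left_inv hxs]; exact isOpen_interior.mem_nhds hx
        filter_upwards [h5 h6, (isOpen_extChartAt_target q).mem_nhds (c.map_source hxs)] with y hy hy'
        simp only [f, id, hfix _ (interior_subset hy)]
        exact c.right_inv hy'
      rw [Set.mem_singleton_iff, h4.fderiv_eq, fderiv_id]
    have h4 := isClosed_singleton.mem_of_frequently_of_tendsto h3 h2
    rw [← Set.mem_singleton_iff.1 h4]
    exact (h1.differentiableAt (by simp)).hasFDerivAt
  -- Averaging the chart over the finite group generated by `t` gives a function invariant under `t`
  -- with derivative `n · id`, hence injective near `q`. Points near `q` are therefore fixed.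
  let F : E7 → E7 := fun y => ∑ k ∈ Finset.range n, f k y
  have hF : HasFDerivAt F ((n : ℝ) • ContinuousLinearMap.id ℝ E7) (c q) := by
    have h1 := HasFDerivAt.fun_sum (u := Finset.range n) fun k _ => hfd k
    rwa [Finset.sum_const, Finset.card_range, ← Nat.cast_smul_eq_nsmul ℝ] at h1
  have hn0 : (n : ℝ) ≠ 0 := by positivity
  obtain ⟨e, he, heF, -⟩ := exists_smooth_openPartialHomeomorph (f := F) (a := c q)
    (by
      filter_upwards [(Finset.range n).eventually_all.2 fun k _ => hfs k] with y hy
      exact ContDiffAt.sum hy)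
    (by
      rw [hF.fderiv]
      exact ⟨fun x y hxy => smul_right_injective E7 hn0 hxy,
        fun y => ⟨(n : ℝ)⁻¹ • y, by simp [smul_smul, hn0]⟩⟩)
  have hU : ∀ᶠ x in 𝓝 q, x ∈ c.source ∧ c x ∈ e.source := by
    filter_upwards [hcs, hcc (e.open_source.mem_nhds he)] with x h1 h2 using ⟨h1, h2⟩
  have hU' : ∀ᶠ x in 𝓝 q, t • x ∈ c.source ∧ c (t • x) ∈ e.source := by
    have h1 : Tendsto (fun x : M => t • x) (𝓝 q) (𝓝 (t • q)) :=
      (h.contMDiff_smul t).continuous.tendsto q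
    rw [MulAction.mem_fixedBy.1 hqf] at h1
    exact h1.eventually hU
  refine mem_interior_iff_mem_nhds.2 ?_
  filter_upwards [hU, hU'] with x hx hx'
  refine c.injOn hx'.1 hx.1 (e.injOn hx'.2 hx.2 ?_)
  rw [heF, heF]
  simp only [F, f, c.left_inv hx.1, c.left_inv hx'.1, smul_smul, ← pow_succ]
  have h1 := Finset.sum_range_succ (fun k => c (t ^ k • x)) n
  rw [Finset.sum_range_succ', htn, pow_zero] at h1
  exact add_right_cancel h1

variable [T2Space M] [ConnectedSpace M]

/-- Passing to torsion elements makes the union of fixed-point sets countable, so Baire's theorem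
applies. The interior of a torsion element's fixed-point set is closed, and effectiveness gives the
contradiction. -/
theorem nonempty_regularSet (h : IsToricG2Manifold φ ν μ) : (regularSet M).Nonempty := by
  by_contra hne
  rw [Set.not_nonempty_iff_eq_empty] at hne
  have : LocallyCompactSpace M := ChartedSpace.locallyCompactSpace E7 M
  have : BaireSpace M := BaireSpace.of_t2Space_locallyCompactSpace
  have : Countable {z : T3 | z ≠ 1 ∧ IsOfFinOrder z} :=
    (countable_isOfFinOrder_torus.mono fun z hz => hz.2).to_subtype
  obtain ⟨⟨t, ht1, ht⟩, hint⟩ := nonempty_interior_of_iUnion_of_closed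
    (f := fun z : {z : T3 | z ≠ 1 ∧ IsOfFinOrder z} => MulAction.fixedBy M (z : T3))
    (fun z => isClosed_eq (h.contMDiff_smul z).continuous continuous_id)
    (Set.eq_univ_of_forall fun p => by
      obtain ⟨z, hz, h1⟩ := exists_isOfFinOrder_of_isClosed Finset.univ (h.isClosed_stabilizer p)
        (by simp) (h.stabilizer_ne_bot (p := p) (by rw [hne]; exact Set.notMem_empty p))
      exact Set.mem_iUnion.2 ⟨⟨z, h1⟩, hz⟩)
  have hclopen : IsClopen (interior (MulAction.fixedBy M t)) :=
    ⟨closure_subset_iff_isClosed.1 fun q hq => h.mem_interior_fixedBy ht hq, isOpen_interior⟩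
  have huniv := hclopen.eq_univ hint
  refine ht1 (h.effective t fun p => ?_)
  have hp : p ∈ interior (MulAction.fixedBy M t) := by rw [huniv]; exact Set.mem_univ p
  exact MulAction.mem_fixedBy.1 (interior_subset hp)

/-- Singular points are zeros of `det B`, which is continuous on `M` and locally constant where
nonzero, so connectedness keeps it away from zero. -/
theorem mem_regularSet_of_complete (h : IsToricG2Manifold φ ν μ) (hV : DependsOnlyOnMu φ μ)
    (hcomplete : IsCompleteMetric φ) (p : M) : p ∈ regularSet M := by
  obtain ⟨p₀, hp₀⟩ := h.nonempty_regularSet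
  have hdet := h.mem_regularSet_iff.1 hp₀
  have hclopen : IsClopen {q : M | (matB φ q).det = (matB φ p₀).det} := by
    refine ⟨isClosed_eq h.continuous_det_matB continuous_const, isOpen_iff_mem_nhds.2 fun q hq => ?_⟩
    have hq' : (matB φ q).det = (matB φ p₀).det := hq
    have hqr : q ∈ regularSet M := h.mem_regularSet_iff.2 (hq' ▸ hdet)
    filter_upwards [h.eventually_matV_eq hV hcomplete hqr, h.isOpen_regularSet.mem_nhds hqr]
      with z hz hzr
    have h1 := h.det_matB_mul hqr
    have h2 := h.det_matB_mul hzr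
    rw [hz, ← h1] at h2
    exact (mul_right_cancel₀ (right_ne_zero_of_mul (h1 ▸ one_ne_zero)) h2).trans hq'
  have huniv := hclopen.eq_univ ⟨p₀, rfl⟩
  have hp : (matB φ p).det = (matB φ p₀).det := huniv.ge (Set.mem_univ p)
  exact h.mem_regularSet_iff.2 (hp ▸ hdet)

end IsToricG2Manifold

end Effective

end ToricG2

end

theorem mainTheorem12 {M : Type*} [TopologicalSpace M] [T2Space M] [SecondCountableTopology M]
    [ConnectedSpace M] [ChartedSpace ToricG2.E7 M] [IsManifold (𝓡 7) ∞ M]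
    [MulAction ToricG2.T3 M]
    (φ : ∀ p : M, TangentSpace (𝓡 7) p [⋀^Fin 3]→L[ℝ] ℝ)
    (ν : M → Fin 3 → ℝ) (μ : M → ℝ)
    (htoric : ToricG2.IsToricG2Manifold φ ν μ)
    (hV : ToricG2.DependsOnlyOnMu φ μ)
    (hcomplete : ToricG2.IsCompleteMetric φ) :
    ToricG2.IsFlat φ ∧ ToricG2.IsLocallyIsometricToE7 φ := by
  have hreg := htoric.mem_regularSet_of_complete hV hcomplete
  have hloc : ToricG2.IsLocallyIsometricToE7 φ := fun p =>
    htoric.exists_isometric_chart (hreg p) (htoric.eventually_matV_eq hV hcomplete (hreg p))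
  exact ⟨hloc.isFlat htoric.adapted, hloc⟩
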